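/- For $\epsilon>0$ let $c_\epsilon(x,y)=\sum_{i=1}^d \epsilon^{i-1}(x_i-y_i)^2$ on $\mathbb{R}^d\times\mathbb{R}^d$. Let $\mu_\epsilon,\nu_\epsilon$ ($\epsilon>0$) and $\mu,\nu$ be Borel probability measures on $\mathbb{R}^d$, all absolutely continuous with respect to the Lebesgue measure, such that there are compact sets $K,L\subset\mathbb{R}^d$ with $\mu_\epsilon(K)=\nu_\epsilon(L)=1$ for all $\epsilon>0$. Suppose that $\mu_\epsilon\rightharpoonup\mu$ and $\nu_\epsilon\rightharpoonup\nu$ narrowly (in duality with bounded continuous functions) as $\epsilon\to0^+$, and that $\mu_\epsilon,\nu_\epsilon,\mu,\nu$ have densities $f_\epsilon,g_\epsilon,f,g$ such that $f_\epsilon\to f$ and $g_\epsilon\to g$ pointwise Lebesgue-almost everywhere as $\epsilon\to 0^+$. For each $\epsilon>0$ let $\gamma_\epsilon$ be an optimal transport plan from $\mu_\epsilon$ to $\nu_\epsilon$ for $c_\epsilon$, i.e. a minimizer of $\int c_\epsilon\,d\gamma$ over the set $\Pi(\mu_\epsilon,\nu_\epsilon)$ of couplings. For a probability measure $\rho$ on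 $\mathbb{R}^d$ write $\rho^i_{x_{1:i-1}}$ for the conditional law of the coordinate $x_i$ under $\rho$ given the coordinates $x_{1:i-1}=(x_1,\dots,x_{i-1})$. The monotone coupling of two probability measures on $\mathbb{R}$ is the joint law of their quantile functions evaluated at one uniform random point of $(0,1)$. A *Knothe–Rosenblatt (KR) plan* from $\mu$ to $\nu$ is a coupling $\gamma\in\Pi(\mu,\nu)$ such that for each $i=1,\dots,d$ and $\gamma$-a.e. $(x,y)$, the conditional law under $\gamma$ of $(x_i,y_i)$ given $(x_{1:i-1},y_{1:i-1})$ is the monotone coupling of $\mu^i_{x_{1:i-1}}$ and $\nu^i_{y_{1:i-1}}$. A *KR map* from $\mu$ to $\nu$ is a Borel map $T(x)=(T_1(x_1),T_2(x_1,x_2),\dots,T_d(x_1,\dots,x_d))$ with $T_\sharp\mu=\nu$ such that for each $i$ and $\mu$-a.e. $x$, the function $t\mapsto T_i(x_{1:i-1},t)$ is nondecreasing and pushes $\mu^i_{x_{1:i-1}}$ forward to $\nu^i_{T_1(x),\dots,T_{i-1}(x)}$. Then: 1. There is exactly one KR plan $\gamma_{\mathrm{KR}}$ from $\mu$ to $\nu$,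 and $\gamma_\epsilon\rightharpoonup\gamma_{\mathrm{KR}}$ narrowly as $\epsilon\to0^+$. 2. There is a KR map $T_{\mathrm{KR}}$ from $\mu$ to $\nu$, unique up to equality $\mu$-a.e., and it induces $\gamma_{\mathrm{KR}}$: $\gamma_{\mathrm{KR}}=(\mathrm{id},T_{\mathrm{KR}})_\sharp\mu$. 3. If in addition $\mu_\epsilon=\mu$ for all $\epsilon>0$, and $T_\epsilon$ is, for each $\epsilon>0$, an optimal transport map from $\mu$ to $\nu_\epsilon$ for $c_\epsilon$, i.e. a minimizer of $\int c_\epsilon(x,T(x))\,d\mu(x)$ among the Borel maps $T$ with $T_\sharp\mu=\nu_\epsilon$, then $T_\epsilon$ and $T_{\mathrm{KR}}$ belong to $L^2(\mu)$ and $T_\epsilon\to T_{\mathrm{KR}}$ in $L^2(\mu)$ as $\epsilon\to0^+$. -/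

import Mathlib

open MeasureTheory ProbabilityTheory Filter Topology
open scoped ENNReal

namespace KR

/-- The space `ℝ^d` with its Euclidean norm and Lebesgue measure. -/
abbrev E (d : ℕ) : Type := EuclideanSpace ℝ (Fin d)

/-- The weighted quadratic cost `c_ε(x, y) = ∑ ε^(i-1) (x_i - y_i)^2`. The coordinates are indexed
by `0, …, d-1`, so that the weight of the coordinate `i` is `ε^i`. -/
noncomputable def weightedCost {d : ℕ} (ε : ℝ) (x y : E d) : ℝ :=
  ∑ i : Fin d, ε ^ (i : ℕ) * (x i - y i) ^ 2

/-- `γ ∈ Π(μ, ν)`: the first marginal of `γ` is `μ` and the second one is `ν`. -/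
def IsCoupling {d : ℕ} (μ ν : Measure (E d)) (γ : Measure (E d × E d)) : Prop :=
  γ.fst = μ ∧ γ.snd = ν

/-- Optimal plans: minimizers of the Kantorovich problem for a (nonnegative) cost `c`. -/
def IsOptimalPlan {d : ℕ} (c : E d → E d → ℝ) (μ ν : Measure (E d))
    (γ : Measure (E d × E d)) : Prop :=
  IsCoupling μ ν γ ∧ ∀ γ' : Measure (E d × E d), IsCoupling μ ν γ' →
    ∫⁻ z, ENNReal.ofReal (c z.1 z.2) ∂γ ≤ ∫⁻ z, ENNReal.ofReal (c z.1 z.2) ∂γ'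

/-- Optimal maps: minimizers of the Monge problem for a (nonnegative) cost `c`, among all Borel
maps that push `μ` forward to `ν`. -/
def IsOptimalMap {d : ℕ} (c : E d → E d → ℝ) (μ ν : Measure (E d)) (T : E d → E d) : Prop :=
  (Measurable T ∧ μ.map T = ν) ∧ ∀ S : E d → E d, Measurable S → μ.map S = ν →
    ∫⁻ x, ENNReal.ofReal (c x (T x)) ∂μ ≤ ∫⁻ x, ENNReal.ofReal (c x (S x)) ∂μ

/-- The coordinates `x_j`, `j < i`, of `x`. -/
def before {d : ℕ} (i : Fin d) (x : E d) : Set.Iio i → ℝ := fun j => x j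

/-- The marginal conditional of `μ`: the law of the coordinate `x_i` under `μ` given the
coordinates `x_j`, `j < i`. -/
noncomputable def conditional {d : ℕ} (μ : Measure (E d)) [IsFiniteMeasure μ] (i : Fin d) :
    Kernel (Set.Iio i → ℝ) ℝ :=
  condDistrib (fun x : E d => x i) (before i) μ

/-- The quantile function (generalized inverse of the distribution function) of a probability
measure on `ℝ`; only its values at `0 < t < 1` matter. -/
noncomputable def quantile (a : Measure ℝ) (t : ℝ) : ℝ := sInf {x : ℝ | t ≤ cdf a x}

/-- The monotone (nondecreasing) coupling of two probability measures on `ℝ`: the joint law of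
their quantile functions at a uniform random point of `(0, 1)`. -/
noncomputable def monotoneCoupling (a b : Measure ℝ) : Measure (ℝ × ℝ) :=
  (volume.restrict (Set.Ioo (0 : ℝ) 1)).map fun t => (quantile a t, quantile b t)

/-- `γ` is the Knothe-Rosenblatt plan from `μ` to `ν`: a coupling of `μ` and `ν` such that, for each
coordinate `i`, the conditional law of `(x_i, y_i)` given `(x_j, y_j)`, `j < i`, is the monotone
coupling of the marginal conditionals of `μ` at `(x_j)`, `j < i`, and of `ν` at `(y_j)`, `j < i`. -/
structure IsKRPlan {d : ℕ} (μ ν : Measure (E d)) [IsFiniteMeasure μ] [IsFiniteMeasure ν]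
    (γ : Measure (E d × E d)) [IsFiniteMeasure γ] : Prop where
  coupling : IsCoupling μ ν γ
  monotone : ∀ i : Fin d, ∀ᵐ z ∂γ,
    condDistrib (fun z : E d × E d => (z.1 i, z.2 i))
        (fun z : E d × E d => (before i z.1, before i z.2)) γ (before i z.1, before i z.2) =
      monotoneCoupling (conditional μ i (before i z.1)) (conditional ν i (before i z.2))

/-- The point `x` with its coordinate `i` replaced by `t`. -/
noncomputable def replace {d : ℕ} (x : E d) (i : Fin d) (t : ℝ) : E d :=
  WithLp.toLp 2 (Function.update (fun j => x j) i t)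

/-- `T` is the Knothe-Rosenblatt map from `μ` to `ν`: it is lower triangular (`T_i` depends on `x_j`,
`j ≤ i`, only), pushes `μ` forward to `ν`, and for each coordinate `i` the function
`x_i ↦ T_i(x_1, …, x_i)` is the monotone rearrangement of the marginal conditional of `μ` at
`(x_j)`, `j < i`, onto the marginal conditional of `ν` at `(T_j(x))`, `j < i`. -/
structure IsKRMap {d : ℕ} (μ ν : Measure (E d)) [IsFiniteMeasure μ] [IsFiniteMeasure ν]
    (T : E d → E d) : Prop where
  measurable : Measurable T
  map_eq : μ.map T = ν
  triangular : ∀ (i : Fin d) (x x' : E d), (∀ j ≤ i, x j = x' j) → T x i = T x' i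
  rearrangement : ∀ i : Fin d, ∀ᵐ x ∂μ,
    Monotone (fun t : ℝ => T (replace x i t) i) ∧
      (conditional μ i (before i x)).map (fun t : ℝ => T (replace x i t) i) =
        conditional ν i (before i (T x))

end KR

/-!
The Knothe–Rosenblatt rearrangement is the limit of the optimal transports for the costs `c_ε`,
because these costs become lexicographic as `ε → 0`: the coordinates `j < i` of an optimal plan are
dealt with first, and given their coupling the coordinate `i` has to be coupled as well as possible
up to an error of order `ε`.

**Plans as iterated kernels.** A coupling is a Knothe–Rosenblatt plan iff, for each `i`, the law of
its coordinates up to `i` is the product of the law of its coordinates before `i` with the kernel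
`stepKernel` of monotone couplings of the conditional laws (`isKRPlan_iff`). Uniqueness of the plan
follows by induction on `i` (`IsKRPlan.unique`). The maps are built one coordinate at a time, as
`clampedQuantile` of the target composed with the distribution function of the source, the
conditional laws of an absolutely continuous measure having no atoms (`exists_isKRMap`). A map
induces a plan (`IsKRMap.isKRPlan`), whence the uniqueness of the map (`IsKRMap.ae_eq`).

**Limits of optimal plans.** Let `γ` be a narrow limit of optimal plans `γ_ε`, and suppose that `γ`
agrees with the Knothe–Rosenblatt plan before the coordinate `i`. Compare `γ_ε` with a competitor
having the same coordinates before `i`, monotonically coupled coordinates `i`, and arbitrary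
coordinates afterwards (`exists_competitor`, `IsOptimalPlan.integral_sq_le`). For fixed marginals
the quadratic cost is a constant minus twice the integral of the joint distribution function over a
box (`integral_correlation_sub`, `lintegral_measure_Iic_prod`). The joint distribution functions of
the competitors are integrals of `min (F_ε (x)) (G_ε (y))`, where `F_ε` and `G_ε` are conditional
distribution functions. They do converge, although conditioning is not continuous for narrow
convergence, because almost everywhere convergence of the densities gives convergence in total
variation (Scheffé's argument, `exists_tvClose_of_tendsto_density`), hence convergence of
conditional distribution functions in `L¹` (`integral_abs_kernel_sub_le`, `tendsto_integral_min`).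
In the limit, the joint distribution function of the coordinates `i` under `γ` has at least the
integral of the one with monotone fibres. The latter being the largest one possible, both are equal,
and so are the plans (`eq_compProd_pairKernel_of_tendsto`). This last step uses that under `γ` the
coordinates `x_j` and `y_j`, `j < i`, determine each other, so that conditioning on both of them is
conditioning on one; it holds since both `μ` and `ν` are absolutely continuous, which provides
Knothe–Rosenblatt maps in both directions. Compactness then gives the convergence
(`tendsto_of_isOptimalPlan`).

**Maps.** From an absolutely continuous source, every plan is approximated in cost by maps: cut the
source into small pieces and transport each of them, by a Knothe–Rosenblatt map, to the share of the
target that the plan assigns to it (`exists_map_lintegral_le`). So optimal maps induce optimal plans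
(`IsOptimalMap.isOptimalPlan`), these converge narrowly to the plan induced by the Knothe–Rosenblatt
map, and for uniformly bounded maps this is convergence in `L²` (`tendsto_eLpNorm_of_tendsto_plan`).
-/

namespace KR

/-! ### Quantile functions and monotone couplings on the line -/

/-- The Galois connection between quantiles and values of the distribution function. -/
lemma quantile_le_iff (a : Measure ℝ) {u : ℝ} (hu : u ∈ Set.Ioo (0 : ℝ) 1) (s : ℝ) :
    quantile a u ≤ s ↔ u ≤ cdf a s := by
  have hne : {x : ℝ | u ≤ cdf a x}.Nonempty := by
    obtain ⟨x, hx⟩ := ((tendsto_cdf_atTop a).eventually (lt_mem_nhds hu.2)).exists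
    exact ⟨x, le_of_lt hx⟩
  have hbdd : BddBelow {x : ℝ | u ≤ cdf a x} := by
    obtain ⟨y, hy⟩ := ((tendsto_cdf_atBot a).eventually (gt_mem_nhds hu.1)).exists
    refine ⟨y, fun x hx => ?_⟩
    by_contra h
    exact absurd (monotone_cdf a (le_of_lt (not_le.1 h))) (not_le.2 (lt_of_lt_of_le hy hx))
  constructor
  · intro h
    have hr := (cdf a).right_continuous s
    -- every `x > s` lies in the set defining the quantile; conclude by right-continuity
    refine ge_of_tendsto (hr.tendsto.mono_left (nhdsWithin_mono s Set.Ioi_subset_Ici_self)) ?_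
    filter_upwards [self_mem_nhdsWithin] with x hx
    obtain ⟨y, hy, hyx⟩ := exists_lt_of_csInf_lt hne (lt_of_le_of_lt h hx)
    exact le_trans hy (monotone_cdf a hyx.le)
  · exact fun h => csInf_le hbdd h

lemma aemeasurable_quantile (a : Measure ℝ) :
    AEMeasurable (quantile a) (volume.restrict (Set.Ioo (0 : ℝ) 1)) := by
  refine aemeasurable_restrict_of_monotoneOn measurableSet_Ioo ?_
  intro u hu v hv huv
  rw [quantile_le_iff a hu]
  exact huv.trans ((quantile_le_iff a hv _).1 le_rfl)

lemma volume_Ioo_inter_Iic {v : ℝ} (hv1 : v ≤ 1) :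
    volume (Set.Ioo (0 : ℝ) 1 ∩ Set.Iic v) = ENNReal.ofReal v := by
  refine le_antisymm ?_ ?_
  · refine (measure_mono (t := Set.Ioc 0 v) fun x hx => ⟨hx.1.1, hx.2⟩).trans ?_
    simp
  · refine le_trans ?_ (measure_mono (s := Set.Ioo 0 v) fun x hx =>
      ⟨⟨hx.1, hx.2.trans_le hv1⟩, hx.2.le⟩)
    simp

/-- The joint distribution function of the monotone coupling is the minimum of the distribution
functions, the largest value that a coupling can have (the Fréchet–Hoeffding bound). -/
lemma monotoneCoupling_Iic_prod (a b : Measure ℝ) [IsProbabilityMeasure a]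
    [IsProbabilityMeasure b] (s t : ℝ) :
    monotoneCoupling a b (Set.Iic s ×ˢ Set.Iic t) = min (a (Set.Iic s)) (b (Set.Iic t)) := by
  rw [monotoneCoupling, Measure.map_apply_of_aemeasurable
    ((aemeasurable_quantile a).prodMk (aemeasurable_quantile b))
    (measurableSet_Iic.prod measurableSet_Iic), Measure.restrict_apply' measurableSet_Ioo]
  have : (fun t => (quantile a t, quantile b t)) ⁻¹' (Set.Iic s ×ˢ Set.Iic t) ∩ Set.Ioo 0 1 =
      Set.Ioo 0 1 ∩ Set.Iic (min (cdf a s) (cdf b t)) := by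
    ext u
    simp only [Set.mem_inter_iff, Set.mem_preimage, Set.mem_prod, Set.mem_Iic, le_min_iff]
    constructor
    · rintro ⟨⟨h1, h2⟩, h⟩
      exact ⟨h, (quantile_le_iff a h s).1 h1, (quantile_le_iff b h t).1 h2⟩
    · rintro ⟨h, h1, h2⟩
      exact ⟨⟨(quantile_le_iff a h s).2 h1, (quantile_le_iff b h t).2 h2⟩, h⟩
  rw [this, volume_Ioo_inter_Iic
    (min_le_of_left_le (cdf_le_one a s)), ENNReal.ofReal_min, ofReal_cdf, ofReal_cdf]

instance isProbabilityMeasure_monotoneCoupling (a b : Measure ℝ) :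
    IsProbabilityMeasure (monotoneCoupling a b) := by
  have : IsProbabilityMeasure (volume.restrict (Set.Ioo (0 : ℝ) 1)) := ⟨by simp⟩
  exact Measure.isProbabilityMeasure_map
    ((aemeasurable_quantile a).prodMk (aemeasurable_quantile b))

/-- The π-system of the lower left quadrants of the plane. -/
def quadrants : Set (Set (ℝ × ℝ)) := {A | ∃ s t : ℝ, A = Set.Iic s ×ˢ Set.Iic t}

lemma isPiSystem_quadrants : IsPiSystem quadrants := by
  rintro _ ⟨s, t, rfl⟩ _ ⟨s', t', rfl⟩ -
  exact ⟨min s s', min t t', by rw [Set.prod_inter_prod, Set.Iic_inter_Iic, Set.Iic_inter_Iic]⟩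

lemma generateFrom_quadrants :
    (inferInstance : MeasurableSpace (ℝ × ℝ)) = MeasurableSpace.generateFrom quadrants := by
  refine le_antisymm ?_ (MeasurableSpace.generateFrom_le ?_)
  · have hs : IsCountablySpanning (Set.range (Set.Iic : ℝ → Set ℝ)) :=
      ⟨fun n : ℕ => Set.Iic (n : ℝ), fun n => ⟨n, rfl⟩, by
        ext x; simpa using exists_nat_ge x⟩
    have h := generateFrom_eq_prod (α := ℝ) (β := ℝ)
      (borel_eq_generateFrom_Iic ℝ ▸ (BorelSpace.measurable_eq (α := ℝ)).symm)
      (borel_eq_generateFrom_Iic ℝ ▸ (BorelSpace.measurable_eq (α := ℝ)).symm) hs hs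
    refine h.symm.le.trans (MeasurableSpace.generateFrom_mono ?_)
    rintro _ ⟨_, ⟨s, rfl⟩, _, ⟨t, rfl⟩, rfl⟩
    exact ⟨s, t, rfl⟩
  · rintro _ ⟨s, t, rfl⟩
    exact measurableSet_Iic.prod measurableSet_Iic

lemma ext_of_Iic_prod {P Q : Measure (ℝ × ℝ)} [IsProbabilityMeasure P] [IsProbabilityMeasure Q]
    (h : ∀ s t : ℝ, P (Set.Iic s ×ˢ Set.Iic t) = Q (Set.Iic s ×ˢ Set.Iic t)) : P = Q := by
  refine ext_of_generate_finite _ generateFrom_quadrants isPiSystem_quadrants ?_ (by simp)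
  rintro _ ⟨s, t, rfl⟩
  exact h s t

lemma tendsto_measure_Iic_prod (P : Measure (ℝ × ℝ)) [IsFiniteMeasure P] (s t : ℝ) :
    Tendsto (fun n : ℕ => P (Set.Iic (s + 1 / ((n : ℝ) + 1)) ×ˢ Set.Iic (t + 1 / ((n : ℝ) + 1))))
      atTop (𝓝 (P (Set.Iic s ×ˢ Set.Iic t))) := by
  have hmono : ∀ {m n : ℕ}, m ≤ n → (1 : ℝ) / ((n : ℝ) + 1) ≤ 1 / ((m : ℝ) + 1) :=
    fun h => Nat.one_div_le_one_div h
  have hinter : ⋂ n : ℕ, (Set.Iic (s + 1 / ((n : ℝ) + 1)) ×ˢ Set.Iic (t + 1 / ((n : ℝ) + 1))) =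
      Set.Iic s ×ˢ Set.Iic t := by
    ext ⟨x, y⟩
    simp only [Set.mem_iInter, Set.mem_prod, Set.mem_Iic]
    have hlim : ∀ c : ℝ, Tendsto (fun n : ℕ => c + 1 / ((n : ℝ) + 1)) atTop (𝓝 c) := fun c => by
      simpa using (tendsto_const_nhds (x := c)).add
        (tendsto_one_div_add_atTop_nhds_zero_nat (𝕜 := ℝ))
    constructor
    · intro h
      exact ⟨ge_of_tendsto' (hlim s) fun n => (h n).1, ge_of_tendsto' (hlim t) fun n => (h n).2⟩
    · rintro ⟨h1, h2⟩ n
      have : (0 : ℝ) ≤ 1 / ((n : ℝ) + 1) := by positivity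
      exact ⟨by linarith, by linarith⟩
  rw [← hinter]
  refine tendsto_measure_iInter_atTop
    (fun n => (measurableSet_Iic.prod measurableSet_Iic).nullMeasurableSet) ?_
    ⟨0, measure_ne_top _ _⟩
  intro m n h
  exact Set.prod_mono (Set.Iic_subset_Iic.2 (by linarith [hmono h]))
    (Set.Iic_subset_Iic.2 (by linarith [hmono h]))

/-- A nondecreasing map that pushes `a` forward to `b` induces the monotone coupling. -/
lemma map_prodMk_eq_monotoneCoupling {a b : Measure ℝ} [IsProbabilityMeasure a] {h : ℝ → ℝ}
    (hh : Monotone h) (hb : a.map h = b) :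
    a.map (fun x => (x, h x)) = monotoneCoupling a b := by
  have hbp : IsProbabilityMeasure b :=
    hb ▸ Measure.isProbabilityMeasure_map hh.measurable.aemeasurable
  have hm : Measurable fun x => (x, h x) := measurable_id.prodMk hh.measurable
  have := Measure.isProbabilityMeasure_map (μ := a) hm.aemeasurable
  refine ext_of_Iic_prod fun s t => ?_
  rw [monotoneCoupling_Iic_prod, Measure.map_apply hm (measurableSet_Iic.prod measurableSet_Iic),
    ← hb, Measure.map_apply hh.measurable measurableSet_Iic, Set.mk_preimage_prod, Set.preimage_id']
  -- both sets are lower sets of the line, so one contains the other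
  have hl : IsLowerSet (h ⁻¹' Set.Iic t) := fun x y hyx hx => (hh hyx).trans hx
  rcases (isLowerSet_Iic s).total hl with hsub | hsub
  · rw [Set.inter_eq_left.2 hsub, min_eq_left (measure_mono hsub)]
  · rw [Set.inter_eq_right.2 hsub, min_eq_right (measure_mono hsub)]

lemma monotoneCoupling_map_swap (a b : Measure ℝ) [IsProbabilityMeasure a]
    [IsProbabilityMeasure b] :
    (monotoneCoupling a b).map Prod.swap = monotoneCoupling b a := by
  have := Measure.isProbabilityMeasure_map (μ := monotoneCoupling a b)
    measurable_swap.aemeasurable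
  refine ext_of_Iic_prod fun s t => ?_
  rw [Measure.map_apply measurable_swap (measurableSet_Iic.prod measurableSet_Iic),
    Set.preimage_swap_prod, monotoneCoupling_Iic_prod, monotoneCoupling_Iic_prod, min_comm]

/-- An atomless law `a` is mapped to the uniform law by its distribution function. -/
lemma measure_cdf_le (a : Measure ℝ) [IsProbabilityMeasure a] [NullSingletonClass a] {v : ℝ}
    (hv0 : 0 ≤ v) (hv1 : v ≤ 1) : a {x | cdf a x ≤ v} = ENNReal.ofReal v := by
  have hset : ∀ x, cdf a x ≤ v → Set.Iic x ⊆ {x | cdf a x ≤ v} := fun x hx y hy =>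
    (monotone_cdf a hy).trans hx
  rcases hv1.eq_or_lt with rfl | hv1
  · have : {x | cdf a x ≤ 1} = Set.univ := Set.eq_univ_of_forall fun x => cdf_le_one a x
    simp [this]
  by_cases hne : {x | cdf a x ≤ v}.Nonempty
  · have hbdd : BddAbove {x | cdf a x ≤ v} := by
      obtain ⟨y, hy⟩ := ((tendsto_cdf_atTop a).eventually (lt_mem_nhds hv1)).exists
      refine ⟨y, fun x hx => ?_⟩
      by_contra h
      exact absurd (monotone_cdf a (le_of_lt (not_le.1 h))) (not_le.2 (lt_of_le_of_lt hx hy))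
    set s := sSup {x | cdf a x ≤ v} with hs
    have hlow : Set.Iio s ⊆ {x | cdf a x ≤ v} := fun x hx => by
      obtain ⟨y, hy, hxy⟩ := exists_lt_of_lt_csSup hne hx
      exact hset y hy hxy.le
    have hup : {x | cdf a x ≤ v} ⊆ Set.Iic s := fun x hx => le_csSup hbdd hx
    have hIic : a {x | cdf a x ≤ v} = a (Set.Iic s) :=
      le_antisymm (measure_mono hup) (Iio_ae_eq_Iic (μ := a).measure_eq ▸ measure_mono hlow)
    rw [hIic]
    refine le_antisymm ?_ ?_
    · -- the mass of `Iio s` is the limit of the masses of `Iic x`, `x < s`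
      rw [← Iio_ae_eq_Iic.measure_eq]
      have hU : Set.Iio s = ⋃ n : ℕ, Set.Iic (s - 1 / ((n : ℝ) + 1)) := by
        ext x
        simp only [Set.mem_Iio, Set.mem_iUnion, Set.mem_Iic]
        constructor
        · intro hx
          obtain ⟨n, hn⟩ := exists_nat_one_div_lt (sub_pos.2 hx)
          exact ⟨n, by linarith⟩
        · rintro ⟨n, hn⟩
          have : (0 : ℝ) < 1 / ((n : ℝ) + 1) := by positivity
          linarith
      have hm : Monotone fun n : ℕ => Set.Iic (s - 1 / ((n : ℝ) + 1)) := fun m n h =>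
        Set.Iic_subset_Iic.2 (by
          have := Nat.one_div_le_one_div (α := ℝ) h
          linarith)
      rw [hU, hm.measure_iUnion]
      refine iSup_le fun n => ?_
      rw [← ofReal_cdf]
      refine ENNReal.ofReal_le_ofReal (hlow ?_)
      have : (0 : ℝ) < 1 / ((n : ℝ) + 1) := by positivity
      simp only [Set.mem_Iio]
      linarith
    · rw [← ofReal_cdf]
      refine ENNReal.ofReal_le_ofReal ?_
      refine ge_of_tendsto ((cdf a).right_continuous s |>.tendsto.mono_left
        (nhdsWithin_mono s Set.Ioi_subset_Ici_self)) ?_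
      filter_upwards [self_mem_nhdsWithin] with x hx
      by_contra h
      have h1 : x ≤ s := hup (le_of_lt (not_le.1 h) : cdf a x ≤ v)
      exact not_le.2 (Set.mem_Ioi.1 hx) h1
  · have h0 : v = 0 := by
      refine le_antisymm (ge_of_tendsto' (tendsto_cdf_atBot a) fun x => ?_) hv0
      by_contra h
      exact hne ⟨x, le_of_lt (not_le.1 h)⟩
    rw [Set.not_nonempty_iff_eq_empty.1 hne, h0]
    simp

/-- The quantile function of `b` truncated to `[-R, R]`. Unlike `quantile b`, it is monotone on the
whole line, and it has the same pushforward of the uniform law when `b` is carried by `[-R, R]`. -/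
noncomputable def clampedQuantile (R : ℝ) (b : Measure ℝ) (u : ℝ) : ℝ :=
  sInf {x : ℝ | -R ≤ x ∧ (R ≤ x ∨ u ≤ cdf b x)}

lemma clampedQuantile_le_iff {R : ℝ} (hR : 0 ≤ R) (b : Measure ℝ) (u s : ℝ) :
    clampedQuantile R b u ≤ s ↔ -R ≤ s ∧ (R ≤ s ∨ u ≤ cdf b s) := by
  have hne : {x : ℝ | -R ≤ x ∧ (R ≤ x ∨ u ≤ cdf b x)}.Nonempty :=
    ⟨R, by linarith, Or.inl le_rfl⟩
  have hbdd : BddBelow {x : ℝ | -R ≤ x ∧ (R ≤ x ∨ u ≤ cdf b x)} := ⟨-R, fun x hx => hx.1⟩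
  constructor
  · intro h
    refine ⟨(le_csInf hne fun x hx => hx.1).trans h, ?_⟩
    by_contra! hcon
    have hev : ∀ᶠ x in 𝓝[>] s, cdf b x < u :=
      ((cdf b).right_continuous s |>.tendsto.mono_left
        (nhdsWithin_mono s Set.Ioi_subset_Ici_self)).eventually (gt_mem_nhds hcon.2)
    obtain ⟨x, ⟨hx1, hx2⟩, hx3⟩ := ((hev.and
      (mem_nhdsWithin_of_mem_nhds (gt_mem_nhds hcon.1))).and self_mem_nhdsWithin).exists
    obtain ⟨y, hy, hyx⟩ := exists_lt_of_csInf_lt hne (lt_of_le_of_lt h hx3)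
    rcases hy.2 with hy2 | hy2
    · exact absurd hy2 (not_le.2 (hyx.trans hx2))
    · exact absurd (hy2.trans (monotone_cdf b hyx.le)) (not_le.2 hx1)
  · exact fun h => csInf_le hbdd h

lemma monotone_clampedQuantile {R : ℝ} (hR : 0 ≤ R) (b : Measure ℝ) :
    Monotone (clampedQuantile R b) := by
  intro u v huv
  rw [clampedQuantile_le_iff hR]
  have h := (clampedQuantile_le_iff hR b v _).1 le_rfl
  exact ⟨h.1, h.2.imp id huv.trans⟩

/-- The monotone rearrangement of an atomless law `a` onto a law `b` carried by `[-R, R]`. -/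
lemma map_clampedQuantile_cdf {R : ℝ} (hR : 0 ≤ R) (a b : Measure ℝ) [IsProbabilityMeasure a]
    [NullSingletonClass a] [IsProbabilityMeasure b] (hb : b (Set.Icc (-R) R)ᶜ = 0) :
    a.map (fun x => clampedQuantile R b (cdf a x)) = b := by
  have hm : Monotone fun x => clampedQuantile R b (cdf a x) :=
    (monotone_clampedQuantile hR b).comp (monotone_cdf a)
  have := Measure.isProbabilityMeasure_map (μ := a) hm.measurable.aemeasurable
  refine Measure.ext_of_Iic _ _ fun s => ?_
  rw [Measure.map_apply hm.measurable measurableSet_Iic]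
  rcases lt_or_ge s (-R) with hs | hs
  · have h1 : (fun x => clampedQuantile R b (cdf a x)) ⁻¹' Set.Iic s = ∅ := by
      ext x
      simp [clampedQuantile_le_iff hR, not_le.2 hs]
    have h2 : b (Set.Iic s) = 0 := by
      refine measure_mono_null (fun x hx => ?_) hb
      have hx' : x ≤ s := hx
      exact fun h => absurd (h.1.trans hx') (not_le.2 hs)
    rw [h1, h2, measure_empty]
  rcases le_or_gt R s with hs' | hs'
  · have h1 : (fun x => clampedQuantile R b (cdf a x)) ⁻¹' Set.Iic s = Set.univ := by
      ext x
      simp [clampedQuantile_le_iff hR, hs, hs']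
    have h2 : b (Set.Iic s) = 1 := by
      rw [prob_compl_eq_zero_iff measurableSet_Icc] at hb
      exact le_antisymm prob_le_one (hb ▸ measure_mono fun x hx => hx.2.trans hs')
    rw [h1, h2, measure_univ]
  · have h1 : (fun x => clampedQuantile R b (cdf a x)) ⁻¹' Set.Iic s =
        {x | cdf a x ≤ cdf b s} := by
      ext x
      simp [clampedQuantile_le_iff hR, hs, not_le.2 hs']
    rw [h1, measure_cdf_le a (cdf_nonneg b s) (cdf_le_one b s), ofReal_cdf]

/-! ### Kernels of monotone couplings -/

section Kernels

variable {A B X Y : Type*} [MeasurableSpace A] [MeasurableSpace B] [MeasurableSpace X]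
  [MeasurableSpace Y]

/-- Disintegrations transform along `(a, s) ↦ (f a, g a s)` as soon as the maps `g a` transform
the fibres. -/
lemma map_compProd_eq {m : Measure A} [SFinite m] {κ : Kernel A X} [IsSFiniteKernel κ]
    {K : Kernel B Y} [IsSFiniteKernel K] {f : A → B} (hf : Measurable f) {g : A → X → Y}
    (hg : Measurable fun p : A × X => g p.1 p.2) (h : ∀ᵐ a ∂m, K (f a) = (κ a).map (g a)) :
    (m.map f) ⊗ₘ K = (m ⊗ₘ κ).map fun p => (f p.1, g p.1 p.2) := by
  ext S hS
  have hG : Measurable fun p : A × X => (f p.1, g p.1 p.2) := (hf.comp measurable_fst).prodMk hg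
  rw [Measure.compProd_apply hS, lintegral_map (Kernel.measurable_kernel_prodMk_left hS) hf,
    Measure.map_apply hG hS, Measure.compProd_apply (hG hS)]
  refine lintegral_congr_ae ?_
  filter_upwards [h] with a ha
  have hga : Measurable (g a) := hg.comp measurable_prodMk_left
  rw [ha, Measure.map_apply hga (measurable_prodMk_left hS)]
  rfl

/-- The kernel of the monotone couplings of the fibres of two Markov kernels. -/
noncomputable def monotoneKernel (κ η : Kernel A ℝ) [IsMarkovKernel κ] [IsMarkovKernel η] :
    Kernel A (ℝ × ℝ) where
  toFun a := monotoneCoupling (κ a) (η a)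
  measurable' := by
    refine Measurable.measure_of_isPiSystem_of_isProbabilityMeasure generateFrom_quadrants
      isPiSystem_quadrants ?_
    rintro _ ⟨s, t, rfl⟩
    simp only [monotoneCoupling_Iic_prod]
    exact (κ.measurable_coe measurableSet_Iic).min (η.measurable_coe measurableSet_Iic)

instance (κ η : Kernel A ℝ) [IsMarkovKernel κ] [IsMarkovKernel η] :
    IsMarkovKernel (monotoneKernel κ η) :=
  ⟨fun a => isProbabilityMeasure_monotoneCoupling (κ a) (η a)⟩

/-- The first marginals of monotone couplings are the given ones. -/
lemma monotoneCoupling_fst (a b : Measure ℝ) [IsProbabilityMeasure a] [IsProbabilityMeasure b] :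
    (monotoneCoupling a b).map Prod.fst = a := by
  have := Measure.isProbabilityMeasure_map (μ := monotoneCoupling a b) measurable_fst.aemeasurable
  refine Measure.ext_of_Iic _ _ fun s => ?_
  rw [Measure.map_apply measurable_fst measurableSet_Iic]
  have hU : Prod.fst ⁻¹' Set.Iic s = ⋃ n : ℕ, Set.Iic s ×ˢ Set.Iic (n : ℝ) := by
    ext ⟨x, y⟩
    simpa using fun _ => exists_nat_ge y
  have hm : Monotone fun n : ℕ => Set.Iic s ×ˢ Set.Iic (n : ℝ) := fun m n h =>
    Set.prod_mono le_rfl (Set.Iic_subset_Iic.2 (Nat.cast_le.2 h))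
  have hb : (⨆ n : ℕ, b (Set.Iic (n : ℝ))) = 1 := by
    rw [← Monotone.measure_iUnion fun m n h => Set.Iic_subset_Iic.2 (Nat.cast_le.2 h),
      Set.iUnion_eq_univ_iff.2 fun x => (exists_nat_ge x).imp fun _ h => Set.mem_Iic.2 h,
      measure_univ]
  rw [hU, hm.measure_iUnion]
  simp only [monotoneCoupling_Iic_prod]
  rw [← inf_iSup_eq, hb]
  exact min_eq_left prob_le_one

lemma monotoneCoupling_snd (a b : Measure ℝ) [IsProbabilityMeasure a] [IsProbabilityMeasure b] :
    (monotoneCoupling a b).map Prod.snd = b := by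
  rw [← monotoneCoupling_map_swap b a, Measure.map_map measurable_snd measurable_swap]
  exact monotoneCoupling_fst b a

/-- The kernel of the monotone couplings of the fibres of two Markov kernels with their own
parameters. -/
noncomputable def pairKernel (κ : Kernel A ℝ) (η : Kernel B ℝ) [IsMarkovKernel κ]
    [IsMarkovKernel η] : Kernel (A × B) (ℝ × ℝ) :=
  monotoneKernel (κ.comap Prod.fst measurable_fst) (η.comap Prod.snd measurable_snd)

lemma pairKernel_apply (κ : Kernel A ℝ) (η : Kernel B ℝ) [IsMarkovKernel κ] [IsMarkovKernel η]
    (p : A × B) : pairKernel κ η p = monotoneCoupling (κ p.1) (η p.2) := rfl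

instance (κ : Kernel A ℝ) (η : Kernel B ℝ) [IsMarkovKernel κ] [IsMarkovKernel η] :
    IsMarkovKernel (pairKernel κ η) := by
  rw [pairKernel]; infer_instance

lemma map_compProd_pairKernel_left (θ : Measure (A × B)) [SFinite θ] (κ : Kernel A ℝ)
    (η : Kernel B ℝ) [IsMarkovKernel κ] [IsMarkovKernel η] :
    (θ ⊗ₘ pairKernel κ η).map (fun p => (p.1.1, p.2.1)) = (θ.map Prod.fst) ⊗ₘ κ :=
  (map_compProd_eq (g := fun _ => Prod.fst) measurable_fst (measurable_fst.comp measurable_snd)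
    (ae_of_all _ fun p => (monotoneCoupling_fst (κ p.1) (η p.2)).symm)).symm

lemma map_compProd_pairKernel_right (θ : Measure (A × B)) [SFinite θ] (κ : Kernel A ℝ)
    (η : Kernel B ℝ) [IsMarkovKernel κ] [IsMarkovKernel η] :
    (θ ⊗ₘ pairKernel κ η).map (fun p => (p.1.2, p.2.2)) = (θ.map Prod.snd) ⊗ₘ η :=
  (map_compProd_eq (g := fun _ => Prod.snd) measurable_snd (measurable_snd.comp measurable_snd)
    (ae_of_all _ fun p => (monotoneCoupling_snd (κ p.1) (η p.2)).symm)).symm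

end Kernels

/-! ### Coordinates -/

section Coordinates

variable {d : ℕ}

lemma measurable_coord (i : Fin d) : Measurable fun x : E d => x i := by fun_prop

lemma measurable_before (i : Fin d) : Measurable (before i : E d → Set.Iio i → ℝ) :=
  measurable_pi_lambda _ fun j => measurable_coord (j : Fin d)

instance (μ : Measure (E d)) [IsFiniteMeasure μ] (i : Fin d) :
    IsMarkovKernel (conditional μ i) := by
  rw [conditional]; infer_instance

/-- The pair formed by the coordinates `x_j`, `j < i`, and the coordinate `x_i`. -/
def upTo (i : Fin d) (x : E d) : (Set.Iio i → ℝ) × ℝ := (before i x, x i)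

lemma measurable_upTo (i : Fin d) : Measurable (upTo i) :=
  (measurable_before i).prodMk (measurable_coord i)

lemma map_upTo (μ : Measure (E d)) [IsFiniteMeasure μ] (i : Fin d) :
    μ.map (upTo i) = μ.map (before i) ⊗ₘ conditional μ i :=
  (compProd_map_condDistrib (measurable_coord i).aemeasurable).symm

/-- The point with the coordinates `a` before `i`, the coordinate `s` at `i`, and `0` after `i`. -/
noncomputable def glue (i : Fin d) (a : Set.Iio i → ℝ) (s : ℝ) : E d :=
  WithLp.toLp 2 fun j => if h : j < i then a ⟨j, h⟩ else if j = i then s else 0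

lemma measurable_glue (i : Fin d) :
    Measurable fun p : (Set.Iio i → ℝ) × ℝ => glue i p.1 p.2 := by
  refine (WithLp.measurable_toLp 2 _).comp (measurable_pi_lambda _ fun j => ?_)
  by_cases h : j < i
  · simp only [h, dif_pos]; fun_prop
  · simp only [h, dif_neg, not_false_eq_true]
    split_ifs <;> fun_prop

lemma glue_apply_of_lt {i j : Fin d} (h : j < i) (a : Set.Iio i → ℝ) (s : ℝ) :
    glue i a s j = a ⟨j, h⟩ := by simp [glue, h]

lemma glue_apply_self (i : Fin d) (a : Set.Iio i → ℝ) (s : ℝ) : glue i a s i = s := by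
  simp [glue]

lemma before_glue (i : Fin d) (a : Set.Iio i → ℝ) (s : ℝ) : before i (glue i a s) = a := by
  ext j
  exact glue_apply_of_lt j.2 a s

/-- The point `x` with its coordinates of index at least `n` replaced by `0`. -/
noncomputable def trunc (n : ℕ) (x : E d) : E d :=
  WithLp.toLp 2 fun j => if (j : ℕ) < n then x j else 0

lemma measurable_trunc (n : ℕ) : Measurable (trunc n : E d → E d) := by
  refine (WithLp.measurable_toLp 2 _).comp (measurable_pi_lambda _ fun j => ?_)
  split_ifs <;> fun_prop

lemma trunc_zero (x : E d) : trunc 0 x = 0 := by ext j; simp [trunc]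

lemma trunc_dim (x : E d) : trunc d x = x := by ext j; simp [trunc]

lemma before_trunc (i : Fin d) (x : E d) : before i (trunc i x) = before i x := by
  ext j
  have : (j : Fin d) < i := j.2
  simp [before, trunc, this]

lemma trunc_succ (i : Fin d) (x : E d) : trunc (i + 1) x = glue i (before i x) (x i) := by
  ext j
  rcases lt_trichotomy j i with h | h | h
  · rw [glue_apply_of_lt h]
    have h1 : (j : ℕ) < i + 1 := Nat.lt_succ_of_lt (Fin.lt_def.1 h)
    simp only [trunc, before, h1, if_true]
  · subst h
    simp [trunc, glue]
  · have h1 : ¬ (j : ℕ) < i + 1 := by have := Fin.lt_def.1 h; omega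
    simp only [trunc, glue, h1, h.not_gt, h.ne', if_false, dif_neg, not_false_eq_true]

lemma before_replace (i : Fin d) (x : E d) (t : ℝ) : before i (replace x i t) = before i x := by
  ext j
  have : (j : Fin d) ≠ i := ne_of_lt j.2
  simp [before, replace, this]

lemma replace_self_apply (i : Fin d) (x : E d) (t : ℝ) : replace x i t i = t := by
  simp [replace]

lemma replace_apply_of_lt {i j : Fin d} (h : j < i) (x : E d) (t : ℝ) :
    replace x i t j = x j := by
  simp [replace, h.ne]

lemma upTo_glue_agree (i : Fin d) (x : E d) {s : ℝ} (hs : x i = s) :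
    ∀ j ≤ i, x j = glue i (before i x) s j := by
  intro j hj
  rcases hj.lt_or_eq with h | rfl
  · rw [glue_apply_of_lt h]; rfl
  · rw [glue_apply_self, hs]

end Coordinates

/-! ### Knothe–Rosenblatt plans as iterated products of kernels -/

section Plans

variable {d : ℕ}

/-- The coordinates `j < i` of both points of a pair. -/
def befores (i : Fin d) (z : E d × E d) : (Set.Iio i → ℝ) × (Set.Iio i → ℝ) :=
  (before i z.1, before i z.2)

/-- The coordinates `j < i` of both points of a pair, and their coordinates `i`. -/
def upTos (i : Fin d) (z : E d × E d) :
    ((Set.Iio i → ℝ) × (Set.Iio i → ℝ)) × (ℝ × ℝ) :=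
  (befores i z, (z.1 i, z.2 i))

lemma measurable_befores (i : Fin d) : Measurable (befores i) :=
  ((measurable_before i).comp measurable_fst).prodMk ((measurable_before i).comp measurable_snd)

lemma measurable_upTos (i : Fin d) : Measurable (upTos i) :=
  (measurable_befores i).prodMk (((measurable_coord i).comp measurable_fst).prodMk
    ((measurable_coord i).comp measurable_snd))

/-- The kernel that maps `(x_j, y_j)`, `j < i`, to the monotone coupling of the conditional laws of
`μ` given `(x_j)` and of `ν` given `(y_j)`. -/
noncomputable def stepKernel (μ ν : Measure (E d)) [IsFiniteMeasure μ] [IsFiniteMeasure ν]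
    (i : Fin d) : Kernel ((Set.Iio i → ℝ) × (Set.Iio i → ℝ)) (ℝ × ℝ) :=
  pairKernel (conditional μ i) (conditional ν i)

instance (μ ν : Measure (E d)) [IsFiniteMeasure μ] [IsFiniteMeasure ν] (i : Fin d) :
    IsMarkovKernel (stepKernel μ ν i) := by
  rw [stepKernel]; infer_instance

lemma stepKernel_apply (μ ν : Measure (E d)) [IsFiniteMeasure μ] [IsFiniteMeasure ν]
    (i : Fin d) (p : (Set.Iio i → ℝ) × (Set.Iio i → ℝ)) :
    stepKernel μ ν i p = monotoneCoupling (conditional μ i p.1) (conditional ν i p.2) := rfl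

/-- The Knothe–Rosenblatt plans in terms of products of kernels instead of conditional laws. -/
lemma isKRPlan_iff {μ ν : Measure (E d)} [IsFiniteMeasure μ] [IsFiniteMeasure ν]
    {γ : Measure (E d × E d)} [IsFiniteMeasure γ] :
    IsKRPlan μ ν γ ↔ IsCoupling μ ν γ ∧
      ∀ i, γ.map (upTos i) = γ.map (befores i) ⊗ₘ stepKernel μ ν i := by
  have key : ∀ i : Fin d, (∀ᵐ z ∂γ,
      condDistrib (fun z : E d × E d => (z.1 i, z.2 i))
          (fun z : E d × E d => (before i z.1, before i z.2)) γ (before i z.1, before i z.2) =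
        monotoneCoupling (conditional μ i (before i z.1)) (conditional ν i (before i z.2))) ↔
      γ.map (upTos i) = γ.map (befores i) ⊗ₘ stepKernel μ ν i := by
    intro i
    have hm : Measurable fun z : E d × E d => (z.1 i, z.2 i) :=
      ((measurable_coord i).comp measurable_fst).prodMk ((measurable_coord i).comp measurable_snd)
    refine Iff.trans ?_ (condDistrib_ae_eq_iff_measure_eq_compProd (befores i) hm.aemeasurable
      (stepKernel μ ν i))
    constructor
    · intro h
      refine condDistrib_ae_eq_of_measure_eq_compProd (befores i) hm.aemeasurable ?_
      -- both kernels agree along `befores i`, so the two compositions with `γ` coincide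
      rw [← compProd_map_condDistrib hm.aemeasurable]
      ext S hS
      rw [Measure.compProd_apply hS, Measure.compProd_apply hS,
        lintegral_map (Kernel.measurable_kernel_prodMk_left hS) (measurable_befores i),
        lintegral_map (Kernel.measurable_kernel_prodMk_left hS) (measurable_befores i)]
      refine lintegral_congr_ae ?_
      filter_upwards [h] with z hz
      exact congrArg (fun m : Measure (ℝ × ℝ) => m (Prod.mk (befores i z) ⁻¹' S)) hz
    · exact fun h => ae_of_ae_map (measurable_befores i).aemeasurable h
  exact ⟨fun h => ⟨h.coupling, fun i => (key i).1 (h.monotone i)⟩,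
    fun h => ⟨h.1, fun i => (key i).2 (h.2 i)⟩⟩

/-- Both points of a pair, with their coordinates of index at least `n` replaced by `0`. -/
noncomputable def truncs (n : ℕ) (z : E d × E d) : E d × E d := (trunc n z.1, trunc n z.2)

lemma measurable_truncs (n : ℕ) : Measurable (truncs n : E d × E d → E d × E d) :=
  ((measurable_trunc n).comp measurable_fst).prodMk ((measurable_trunc n).comp measurable_snd)

lemma map_befores_eq_of_map_truncs {γ γ' : Measure (E d × E d)} (i : Fin d)
    (h : γ.map (truncs i) = γ'.map (truncs i)) : γ.map (befores i) = γ'.map (befores i) := by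
  have hb : befores i = befores i ∘ truncs (i : ℕ) := by
    ext z <;> simp [befores, truncs, before_trunc]
  rw [hb, ← Measure.map_map (measurable_befores i) (measurable_truncs _), h,
    Measure.map_map (measurable_befores i) (measurable_truncs _)]

lemma map_truncs_succ {γ γ' : Measure (E d × E d)} (i : Fin d)
    (h : γ.map (upTos i) = γ'.map (upTos i)) :
    γ.map (truncs (i + 1)) = γ'.map (truncs (i + 1)) := by
  let G : ((Set.Iio i → ℝ) × (Set.Iio i → ℝ)) × (ℝ × ℝ) → E d × E d :=
    fun p => (glue i p.1.1 p.2.1, glue i p.1.2 p.2.2)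
  have hG : Measurable G :=
    ((measurable_glue i).comp ((measurable_fst.comp measurable_fst).prodMk
      (measurable_fst.comp measurable_snd))).prodMk
    ((measurable_glue i).comp ((measurable_snd.comp measurable_fst).prodMk
      (measurable_snd.comp measurable_snd)))
  have hb : truncs (i + 1 : ℕ) = G ∘ upTos i := by
    funext z
    simp [G, truncs, trunc_succ, upTos, befores]
  rw [hb, ← Measure.map_map hG (measurable_upTos i), h, Measure.map_map hG (measurable_upTos i)]

lemma map_truncs_zero {γ γ' : Measure (E d × E d)} [IsProbabilityMeasure γ]
    [IsProbabilityMeasure γ'] : γ.map (truncs 0) = γ'.map (truncs 0) := by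
  have : (truncs 0 : E d × E d → E d × E d) = fun _ => (0, 0) := by
    funext z; simp [truncs, trunc_zero]
  rw [this, Measure.map_const, Measure.map_const, measure_univ, measure_univ]

/-- Induction on the number of coordinates: a plan is determined by its conditional laws. -/
lemma eq_of_forall_map_upTos {γ γ' : Measure (E d × E d)} [IsProbabilityMeasure γ]
    [IsProbabilityMeasure γ']
    (h : ∀ i : Fin d, γ.map (truncs i) = γ'.map (truncs i) → γ.map (upTos i) = γ'.map (upTos i)) :
    γ = γ' := by
  have key : ∀ n ≤ d, γ.map (truncs n) = γ'.map (truncs n) := by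
    intro n
    induction n with
    | zero => exact fun _ => map_truncs_zero
    | succ n ih =>
      intro hn
      exact map_truncs_succ ⟨n, hn⟩ (h ⟨n, hn⟩ (ih (Nat.le_of_succ_le hn)))
  have hid : (truncs d : E d × E d → E d × E d) = id := by
    funext z; simp [truncs, trunc_dim]
  simpa [hid] using key d le_rfl

/-- There is at most one Knothe–Rosenblatt plan. -/
lemma IsKRPlan.unique {μ ν : Measure (E d)} [IsFiniteMeasure μ] [IsFiniteMeasure ν]
    {γ γ' : Measure (E d × E d)} [IsProbabilityMeasure γ] [IsProbabilityMeasure γ']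
    (h : IsKRPlan μ ν γ) (h' : IsKRPlan μ ν γ') : γ = γ' := by
  refine eq_of_forall_map_upTos fun i hi => ?_
  rw [(isKRPlan_iff.1 h).2 i, (isKRPlan_iff.1 h').2 i, map_befores_eq_of_map_truncs i hi]

lemma IsKRPlan.swap {μ ν : Measure (E d)} [IsFiniteMeasure μ] [IsFiniteMeasure ν]
    {γ : Measure (E d × E d)} [IsProbabilityMeasure γ] [IsFiniteMeasure (γ.map Prod.swap)]
    (h : IsKRPlan μ ν γ) : IsKRPlan ν μ (γ.map Prod.swap) := by
  rw [isKRPlan_iff] at h ⊢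
  refine ⟨⟨by rw [Measure.fst_map_swap, h.1.2], by rw [Measure.snd_map_swap, h.1.1]⟩, fun i => ?_⟩
  have h1 : (γ.map Prod.swap).map (befores i) = (γ.map (befores i)).map Prod.swap := by
    rw [Measure.map_map (measurable_befores i) measurable_swap,
      Measure.map_map measurable_swap (measurable_befores i)]
    rfl
  rw [h1, map_compProd_eq (κ := stepKernel μ ν i) (g := fun _ => Prod.swap) measurable_swap
    (measurable_swap.comp measurable_snd), ← h.2 i, Measure.map_map (measurable_upTos i)
      measurable_swap, Measure.map_map _ (measurable_upTos i)]
  · rfl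
  · exact (measurable_swap.comp measurable_fst).prodMk (measurable_swap.comp measurable_snd)
  · refine ae_of_all _ fun p => ?_
    rw [stepKernel_apply, stepKernel_apply, monotoneCoupling_map_swap]
    rfl

end Plans

/-! ### Knothe–Rosenblatt maps -/

section Maps

variable {d : ℕ}

/-- The coordinates before `i` of the image under a triangular map, as a function of the
coordinates before `i` of the point. -/
noncomputable def mapBefore (T : E d → E d) (i : Fin d) (a : Set.Iio i → ℝ) : Set.Iio i → ℝ :=
  before i (T (glue i a 0))

/-- The coordinate `i` of the image under a triangular map, as a function of the coordinates up to
`i` of the point. -/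
noncomputable def mapCoord (T : E d → E d) (i : Fin d) (a : Set.Iio i → ℝ) (s : ℝ) : ℝ :=
  T (glue i a s) i

lemma measurable_mapBefore {T : E d → E d} (hT : Measurable T) (i : Fin d) :
    Measurable (mapBefore T i) :=
  (measurable_before i).comp (hT.comp ((measurable_glue i).comp
    (measurable_id.prodMk measurable_const)))

lemma measurable_mapCoord {T : E d → E d} (hT : Measurable T) (i : Fin d) :
    Measurable fun p : (Set.Iio i → ℝ) × ℝ => mapCoord T i p.1 p.2 :=
  (measurable_coord i).comp (hT.comp (measurable_glue i))

lemma before_apply_eq_mapBefore {T : E d → E d} {i : Fin d}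
    (hT : ∀ j < i, ∀ x x' : E d, (∀ k ≤ j, x k = x' k) → T x j = T x' j) (x : E d) :
    before i (T x) = mapBefore T i (before i x) := by
  ext j
  refine hT j j.2 x _ fun k hk => ?_
  rw [glue_apply_of_lt (hk.trans_lt j.2)]; rfl

/-- Resampling the coordinate `i` from its conditional law does not change the law of the
coordinates up to `i`. -/
lemma map_upTo_eq_resample (μ : Measure (E d)) [IsFiniteMeasure μ] (i : Fin d) :
    μ.map (upTo i) = (μ ⊗ₘ (conditional μ i).comap (before i) (measurable_before i)).map
      fun p => (before i p.1, p.2) := by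
  rw [map_upTo]
  refine map_compProd_eq (g := fun _ s => s) (measurable_before i) measurable_snd
    (ae_of_all _ fun x => ?_)
  rw [Kernel.comap_apply, Measure.map_id']

/-- The law of the image of the coordinates up to `i`, when it is known before `i` and the map
rearranges the conditional laws at `i`. -/
lemma map_upTo_comp {μ ν : Measure (E d)} [IsFiniteMeasure μ] [IsFiniteMeasure ν]
    {T : E d → E d} (hT : Measurable T) (i : Fin d)
    (htri : ∀ j ≤ i, ∀ x x' : E d, (∀ k ≤ j, x k = x' k) → T x j = T x' j)
    (hpush : ∀ᵐ x ∂μ, (conditional μ i (before i x)).map (fun t => T (replace x i t) i) =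
      conditional ν i (before i (T x)))
    (hbefore : μ.map (fun x => before i (T x)) = ν.map (before i)) :
    μ.map (fun x => upTo i (T x)) = ν.map (upTo i) := by
  have hc : ∀ x, T x i = mapCoord T i (before i x) (x i) := fun x =>
    htri i le_rfl x _ (upTo_glue_agree i x rfl)
  have hr : ∀ x t, T (replace x i t) i = mapCoord T i (before i x) t := fun x t => by
    rw [hc, before_replace, replace_self_apply]
  have hb : ∀ x, before i (T x) = mapBefore T i (before i x) :=
    before_apply_eq_mapBefore fun j hj => htri j hj.le
  have hmB := measurable_mapBefore hT i
  have hmC := measurable_mapCoord hT i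
  have hG : Measurable fun p : (Set.Iio i → ℝ) × ℝ => (mapBefore T i p.1, mapCoord T i p.1 p.2) :=
    (hmB.comp measurable_fst).prodMk hmC
  have h2 : (fun x => upTo i (T x)) =
      (fun p : (Set.Iio i → ℝ) × ℝ => (mapBefore T i p.1, mapCoord T i p.1 p.2)) ∘ upTo i := by
    funext x
    simp only [upTo, Function.comp, hc x, hb x]
  have hbs : Measurable fun p : E d × ℝ => (before i p.1, p.2) :=
    ((measurable_before i).comp measurable_fst).prodMk measurable_snd
  rw [h2, ← Measure.map_map hG (measurable_upTo i), map_upTo_eq_resample,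
    Measure.map_map hG hbs, map_upTo, ← hbefore]
  refine Eq.symm ((map_compProd_eq (m := μ) (g := fun x s => mapCoord T i (before i x) s)
    (κ := (conditional μ i).comap (before i) (measurable_before i)) (K := conditional ν i)
    ((measurable_before i).comp hT)
    (hmC.comp (((measurable_before i).comp measurable_fst).prodMk measurable_snd)) ?_).trans ?_)
  · filter_upwards [hpush] with x hx
    rw [Function.comp, ← hx, Kernel.comap_apply]
    simp only [hr]
  · congr 1
    funext p
    simp only [Function.comp, hb p.1]

/-- A Knothe–Rosenblatt map induces a Knothe–Rosenblatt plan. -/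
lemma IsKRMap.isKRPlan {μ ν : Measure (E d)} [IsFiniteMeasure μ] [IsFiniteMeasure ν]
    {T : E d → E d} (h : IsKRMap μ ν T) [IsFiniteMeasure (μ.map fun x => (x, T x))] :
    IsKRPlan μ ν (μ.map fun x => (x, T x)) := by
  have hm : Measurable fun x => (x, T x) := measurable_id.prodMk h.measurable
  rw [isKRPlan_iff]
  refine ⟨⟨?_, ?_⟩, fun i => ?_⟩
  · rw [Measure.fst_map_prodMk h.measurable, Measure.map_id']
  · rw [Measure.snd_map_prodMk measurable_id', h.map_eq]
  have hc : ∀ x, T x i = mapCoord T i (before i x) (x i) := fun x =>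
    h.triangular i x _ (upTo_glue_agree i x rfl)
  have hr : ∀ x t, T (replace x i t) i = mapCoord T i (before i x) t := fun x t => by
    rw [hc, before_replace, replace_self_apply]
  have hb : ∀ x, before i (T x) = mapBefore T i (before i x) :=
    before_apply_eq_mapBefore fun j _ => h.triangular j
  have hmB := measurable_mapBefore h.measurable i
  have hmC := measurable_mapCoord h.measurable i
  have hG : Measurable fun p : (Set.Iio i → ℝ) × ℝ =>
      ((p.1, mapBefore T i p.1), (p.2, mapCoord T i p.1 p.2)) :=
    (measurable_fst.prodMk (hmB.comp measurable_fst)).prodMk (measurable_snd.prodMk hmC)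
  have h2 : (upTos i ∘ fun x => (x, T x)) = (fun p : (Set.Iio i → ℝ) × ℝ =>
      ((p.1, mapBefore T i p.1), (p.2, mapCoord T i p.1 p.2))) ∘ upTo i := by
    funext x
    simp only [upTos, befores, upTo, Function.comp, hc x, hb x]
  have hbs : Measurable fun p : E d × ℝ => (before i p.1, p.2) :=
    ((measurable_before i).comp measurable_fst).prodMk measurable_snd
  rw [Measure.map_map (measurable_upTos i) hm, Measure.map_map (measurable_befores i) hm, h2,
    ← Measure.map_map hG (measurable_upTo i), map_upTo_eq_resample, Measure.map_map hG hbs]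
  refine Eq.symm ((map_compProd_eq (g := fun x s => (s, mapCoord T i (before i x) s))
    (κ := (conditional μ i).comap (before i) (measurable_before i))
    ((measurable_befores i).comp hm)
    (measurable_snd.prodMk
      (hmC.comp (((measurable_before i).comp measurable_fst).prodMk measurable_snd))) ?_).trans ?_)
  · filter_upwards [h.rearrangement i] with x hx
    simp only [hr] at hx
    rw [Kernel.comap_apply, map_prodMk_eq_monotoneCoupling hx.1 hx.2]
    rfl
  · congr 1
    funext p
    simp only [Function.comp, befores, hb p.1]

/-- Fubini: a set whose sections in the direction of the coordinate `i` are negligible is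
negligible. -/
lemma volume_eq_zero_of_sections (i : Fin d) {S : Set (E d)} (hS : MeasurableSet S)
    (h : ∀ x : E d, volume {t : ℝ | replace x i t ∈ S} = 0) : volume S = 0 := by
  have hmp := (EuclideanSpace.volume_preserving_symm_measurableEquiv_toLp (Fin d)).symm
  rw [← hmp.measure_preimage hS.nullMeasurableSet, ← lintegral_indicator_one
    (hmp.measurable hS)]
  have hmeas : Measurable (((MeasurableEquiv.toLp 2 (Fin d → ℝ)).symm.symm ⁻¹' S).indicator
      (1 : (Fin d → ℝ) → ℝ≥0∞)) := measurable_one.indicator (hmp.measurable hS)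
  rw [volume_pi, lintegral_eq_lmarginal_univ (0 : Fin d → ℝ),
    lmarginal_erase' _ hmeas (Finset.mem_univ i)]
  have h0 : (fun x => ∫⁻ t, ((MeasurableEquiv.toLp 2 (Fin d → ℝ)).symm.symm ⁻¹' S).indicator
      (1 : (Fin d → ℝ) → ℝ≥0∞) (Function.update x i t) ∂(volume : Measure ℝ)) = 0 := by
    funext x
    have h1 : ∀ t, ((MeasurableEquiv.toLp 2 (Fin d → ℝ)).symm.symm ⁻¹' S).indicator
        (1 : (Fin d → ℝ) → ℝ≥0∞) (Function.update x i t) =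
        {t : ℝ | replace (WithLp.toLp 2 x : E d) i t ∈ S}.indicator 1 t := fun t => rfl
    have hm : MeasurableSet {t : ℝ | replace (WithLp.toLp 2 x : E d) i t ∈ S} :=
      (hmp.measurable.comp (measurable_update x)) hS
    simp only [h1, lintegral_indicator_one hm, h, Pi.zero_apply]
  rw [h0]
  simp [lmarginal]

/-- The conditional laws of an absolutely continuous measure have no atoms: each of them has at most
countably many, so that the set of all atoms has negligible sections. -/
lemma ae_nullSingletonClass_conditional {μ : Measure (E d)} [IsFiniteMeasure μ]
    (hμ : μ ≪ volume) (i : Fin d) :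
    ∀ᵐ x ∂μ, NullSingletonClass (conditional μ i (before i x)) := by
  set κ := conditional μ i
  -- the set of the pairs `(a, s)` such that `s` is an atom of the conditional law at `a`
  let D : Set ((Set.Iio i → ℝ) × ℝ) := {p | κ p.1 {p.2} ≠ 0}
  have hD : MeasurableSet D := by
    have hs : MeasurableSet {q : ((Set.Iio i → ℝ) × ℝ) × ℝ | q.2 = q.1.2} :=
      measurableSet_eq_fun measurable_snd (measurable_snd.comp measurable_fst)
    have := Kernel.measurable_kernel_prodMk_left (κ := κ.comap Prod.fst measurable_fst) hs
    exact this (measurableSet_singleton (0 : ℝ≥0∞)).compl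
  have hsec : ∀ a, {s | (a, s) ∈ D}.Countable := fun a =>
    Measure.countable_meas_pos_of_disjoint_iUnion (μ := κ a) (As := fun s : ℝ => {s})
      (fun s => measurableSet_singleton s) (fun s t hst => by simpa using hst) |>.mono
      fun s hs => pos_iff_ne_zero.2 hs
  have h0 : μ.map (upTo i) D = 0 := by
    rw [Measure.map_apply (measurable_upTo i) hD]
    refine hμ (volume_eq_zero_of_sections i (measurable_upTo i hD) fun x => ?_)
    refine Set.Countable.measure_zero ((hsec (before i x)).mono fun t ht => ?_) _
    have ht' : (before i (replace x i t), replace x i t i) ∈ D := ht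
    rwa [before_replace, replace_self_apply] at ht'
  rw [map_upTo, Measure.compProd_apply hD,
    lintegral_eq_zero_iff (Kernel.measurable_kernel_prodMk_left hD)] at h0
  filter_upwards [ae_of_ae_map (measurable_before i).aemeasurable h0] with x hx
  refine ⟨fun s => ?_⟩
  by_contra hne
  exact hne (measure_mono_null (Set.singleton_subset_iff.2
    (show s ∈ Prod.mk (before i x) ⁻¹' D from hne)) hx)

lemma measurable_clampedQuantile_kernel {Z : Type*} [MeasurableSpace Z] {R : ℝ} (hR : 0 ≤ R)
    (η : Kernel Z ℝ) [IsMarkovKernel η] {u : Z → ℝ} (hu : Measurable u) :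
    Measurable fun z => clampedQuantile R (η z) (u z) := by
  refine measurable_of_Iic fun s => ?_
  have : (fun z => clampedQuantile R (η z) (u z)) ⁻¹' Set.Iic s =
      {z | -R ≤ s ∧ (R ≤ s ∨ u z ≤ (η z).real (Set.Iic s))} := by
    ext z
    simp [clampedQuantile_le_iff hR, cdf_eq_real]
  rw [this]
  have hm : MeasurableSet {z | u z ≤ (η z).real (Set.Iic s)} :=
    measurableSet_le hu (η.measurable_coe measurableSet_Iic).ennreal_toReal
  exact (MeasurableSet.const _).inter ((MeasurableSet.const _).union hm)

lemma measurable_cdf_kernel {Z : Type*} [MeasurableSpace Z]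
    (κ : Kernel Z ℝ) [IsMarkovKernel κ] {u : Z → ℝ} (hu : Measurable u) :
    Measurable fun z => cdf (κ z) (u z) := by
  have hs : MeasurableSet {q : Z × ℝ | q.2 ≤ u q.1} :=
    measurableSet_le measurable_snd (hu.comp measurable_fst)
  have h := (Kernel.measurable_kernel_prodMk_left (κ := κ) hs).ennreal_toReal
  have : (fun z => cdf (κ z) (u z)) =
      fun z => (κ z (Prod.mk z ⁻¹' {q : Z × ℝ | q.2 ≤ u q.1})).toReal := by
    funext z
    rw [cdf_eq_real]
    rfl
  rwa [this]

/-- Existence of the Knothe–Rosenblatt map: the coordinates of the map are built one after the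
other, each one as the monotone rearrangement of the conditional laws determined by the previous
coordinates. -/
lemma exists_isKRMap {μ ν : Measure (E d)} [IsProbabilityMeasure μ] [IsProbabilityMeasure ν]
    (hμ : μ ≪ volume) {R : ℝ} (hR : 0 ≤ R)
    (hν : ∀ i : Fin d, ∀ᵐ y ∂ν, y i ∈ Set.Icc (-R) R) : ∃ T, IsKRMap μ ν T := by
  have key : ∀ n ≤ d, ∃ T : E d → E d, Measurable T ∧
      (∀ i : Fin d, (i : ℕ) < n → (∀ x x' : E d, (∀ j ≤ i, x j = x' j) → T x i = T x' i) ∧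
        ∀ᵐ x ∂μ, Monotone (fun t : ℝ => T (replace x i t) i) ∧
          (conditional μ i (before i x)).map (fun t : ℝ => T (replace x i t) i) =
            conditional ν i (before i (T x))) ∧
      μ.map (fun x => trunc n (T x)) = ν.map (trunc n) := by
    intro n
    induction n with
    | zero =>
      refine fun _ => ⟨id, measurable_id, fun i hi => absurd hi (Nat.not_lt_zero _), ?_⟩
      have h0 : (trunc 0 : E d → E d) = fun _ => 0 := funext trunc_zero
      simp [h0, Measure.map_const]
    | succ n ih =>
      intro hn
      obtain ⟨T, hT, hTi, hlaw⟩ := ih (Nat.le_of_succ_le hn)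
      let i : Fin d := ⟨n, hn⟩
      have hbefore : μ.map (fun x => before i (T x)) = ν.map (before i) := by
        have h1 : (fun x => before i (T x)) = before i ∘ fun x => trunc n (T x) := by
          funext x; exact (before_trunc i (T x)).symm
        have h2 : (before i : E d → _) = before i ∘ trunc n := by
          funext x; exact (before_trunc i x).symm
        have hm : Measurable fun x => trunc n (T x) := (measurable_trunc n).comp hT
        rw [h1, ← Measure.map_map (measurable_before i) hm, hlaw,
          Measure.map_map (measurable_before i) (measurable_trunc n), ← h2]
      let S : E d → ℝ := fun x => clampedQuantile R (conditional ν i (before i (T x)))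
        (cdf (conditional μ i (before i x)) (x i))
      have hS : Measurable S :=
        measurable_clampedQuantile_kernel hR
          ((conditional ν i).comap (fun x => before i (T x)) ((measurable_before i).comp hT))
          (measurable_cdf_kernel ((conditional μ i).comap (before i) (measurable_before i))
            (measurable_coord i))
      -- keep the coordinates before `i`, and set the coordinate `i` to its rearrangement; the next
      -- ones do not matter yet
      let T' : E d → E d := fun x => glue i (before i (T x)) (S x)
      have hT' : Measurable T' :=
        (measurable_glue i).comp (((measurable_before i).comp hT).prodMk hS)
      have hlt : ∀ j < i, ∀ x, T' x j = T x j := fun j hj x => glue_apply_of_lt hj _ _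
      have hself : ∀ x, T' x i = S x := fun x => glue_apply_self i _ _
      have hb : ∀ x, before i (T' x) = before i (T x) := fun x => before_glue i _ _
      have hbT : ∀ x x' : E d, (∀ j < i, x j = x' j) → before i (T x) = before i (T x') := by
        intro x x' hx
        ext j
        exact (hTi j (Fin.lt_def.1 j.2)).1 x x' fun k hk => hx k (hk.trans_lt j.2)
      have htri : ∀ j ≤ i, ∀ x x' : E d, (∀ k ≤ j, x k = x' k) → T' x j = T' x' j := by
        intro j hj x x' hx
        rcases hj.lt_or_eq with hj | rfl
        · rw [hlt j hj, hlt j hj]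
          exact (hTi j (Fin.lt_def.1 hj)).1 x x' hx
        · have hbx : before i x = before i x' := by
            ext k; exact hx k (le_of_lt k.2)
          rw [hself, hself]
          simp only [S, hbx, hbT x x' fun k hk => hx k hk.le, hx i le_rfl]
      have hrep : ∀ x t, T' (replace x i t) i =
          clampedQuantile R (conditional ν i (before i (T x)))
            (cdf (conditional μ i (before i x)) t) := by
        intro x t
        rw [hself]
        simp only [S, before_replace, replace_self_apply,
          hbT (replace x i t) x fun j hj => replace_apply_of_lt hj x t]
      -- the conditional laws of `ν` are carried by `[-R, R]`
      have hsupp : ∀ᵐ x ∂μ, conditional ν i (before i (T x)) (Set.Icc (-R) R)ᶜ = 0 := by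
        have h1 : ∀ᵐ p ∂(ν.map (upTo i)), p.2 ∈ Set.Icc (-R) R := by
          rw [ae_map_iff (measurable_upTo i).aemeasurable (measurable_snd measurableSet_Icc)]
          exact hν i
        rw [map_upTo] at h1
        have h2 := Measure.ae_ae_of_ae_compProd h1
        rw [← hbefore] at h2
        exact ae_of_ae_map ((measurable_before i).comp hT).aemeasurable h2
      have hre : ∀ᵐ x ∂μ, Monotone (fun t : ℝ => T' (replace x i t) i) ∧
          (conditional μ i (before i x)).map (fun t : ℝ => T' (replace x i t) i) =
            conditional ν i (before i (T' x)) := by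
        filter_upwards [hsupp, ae_nullSingletonClass_conditional hμ i] with x hx1 hx2
        simp only [hrep, hb]
        exact ⟨(monotone_clampedQuantile hR _).comp (monotone_cdf _),
          map_clampedQuantile_cdf hR _ _ hx1⟩
      refine ⟨T', hT', fun j hj => ?_, ?_⟩
      · rcases (Nat.lt_succ_iff.1 hj).lt_or_eq with hj' | hj'
        · have hji : j < i := hj'
          refine ⟨htri j hji.le, ?_⟩
          have hbj : ∀ x, before j (T' x) = before j (T x) := fun x => by
            ext k; exact hlt k (lt_trans k.2 hji) x
          simpa only [hlt j hji, hbj] using (hTi j hj').2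
        · obtain rfl : j = i := Fin.ext hj'
          exact ⟨htri i le_rfl, hre⟩
      · have hup := map_upTo_comp (ν := ν) hT' i htri (hre.mono fun x hx => hx.2)
          (by simpa only [hb] using hbefore)
        have h1 : (fun x => trunc (n + 1) (T' x)) =
            (fun p : (Set.Iio i → ℝ) × ℝ => glue i p.1 p.2) ∘ fun x => upTo i (T' x) := by
          funext x; exact trunc_succ i (T' x)
        have h2 : (trunc (n + 1) : E d → E d) =
            (fun p : (Set.Iio i → ℝ) × ℝ => glue i p.1 p.2) ∘ upTo i := by
          funext x; exact trunc_succ i x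
        have hm : Measurable fun x => upTo i (T' x) := (measurable_upTo i).comp hT'
        rw [h1, h2, ← Measure.map_map (measurable_glue i) hm, hup,
          Measure.map_map (measurable_glue i) (measurable_upTo i)]
  obtain ⟨T, hT, hTi, hlaw⟩ := key d le_rfl
  refine ⟨T, hT, ?_, fun i => (hTi i i.2).1, fun i => (hTi i i.2).2⟩
  have hid : (trunc d : E d → E d) = id := funext trunc_dim
  simpa [trunc_dim, hid] using hlaw

/-- The Knothe–Rosenblatt map is unique up to null sets, since its plan is. -/
lemma IsKRMap.ae_eq {μ ν : Measure (E d)} [IsProbabilityMeasure μ] [IsProbabilityMeasure ν]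
    {T T' : E d → E d} (h : IsKRMap μ ν T) (h' : IsKRMap μ ν T') : T' =ᵐ[μ] T := by
  have hm : Measurable fun x => (x, T x) := measurable_id.prodMk h.measurable
  have hm' : Measurable fun x => (x, T' x) := measurable_id.prodMk h'.measurable
  have := Measure.isProbabilityMeasure_map (μ := μ) hm.aemeasurable
  have := Measure.isProbabilityMeasure_map (μ := μ) hm'.aemeasurable
  have heq := h.isKRPlan.unique h'.isKRPlan
  have hs : MeasurableSet {z : E d × E d | z.2 = T z.1} :=
    measurableSet_eq_fun measurable_snd (h.measurable.comp measurable_fst)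
  have h1 : ∀ᵐ z ∂(μ.map fun x => (x, T x)), z.2 = T z.1 :=
    (ae_map_iff hm.aemeasurable hs).2 (ae_of_all _ fun _ => rfl)
  rw [heq] at h1
  exact ae_of_ae_map hm'.aemeasurable h1

end Maps

/-! ### Narrow convergence of plans with marginals converging in total variation -/

section Convergence

variable {A B X : Type*}

/-- The total variation distance of `m` and `m'` is at most `τ`, tested on functions with values in
`[0, 1]`. -/
def TVClose [MeasurableSpace X] (m m' : Measure X) (τ : ℝ) : Prop :=
  ∀ φ : X → ℝ, Measurable φ → (∀ x, φ x ∈ Set.Icc (0 : ℝ) 1) → |∫ x, φ x ∂m - ∫ x, φ x ∂m'| ≤ τ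

lemma TVClose.map [MeasurableSpace A] [MeasurableSpace X] {m m' : Measure X} {τ : ℝ}
    (h : TVClose m m' τ) {f : X → A} (hf : Measurable f) : TVClose (m.map f) (m'.map f) τ := by
  intro φ hφ h01
  rw [integral_map hf.aemeasurable hφ.aestronglyMeasurable,
    integral_map hf.aemeasurable hφ.aestronglyMeasurable]
  exact h _ (hφ.comp hf) fun x => h01 _

lemma integrable_of_mem_Icc [MeasurableSpace X] {m : Measure X} [IsFiniteMeasure m] {φ : X → ℝ}
    (hφ : Measurable φ) (h : ∀ x, φ x ∈ Set.Icc (0 : ℝ) 1) : Integrable φ m :=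
  Integrable.of_bound hφ.aestronglyMeasurable 1
    (ae_of_all _ fun x => by rw [Real.norm_of_nonneg (h x).1]; exact (h x).2)

/-- Conditional laws are close in `L¹` when the laws are close in total variation. One `τ` comes
from the mass of a rectangle and one from the change of the law of the first coordinate, on each of
the two sets where the difference of the kernels has a constant sign. -/
lemma integral_abs_kernel_sub_le [MeasurableSpace A] {α α' : Measure (A × ℝ)}
    [IsProbabilityMeasure α] [IsProbabilityMeasure α'] {κ κ' : Kernel A ℝ} [IsMarkovKernel κ]
    [IsMarkovKernel κ'] (hα : α = α.map Prod.fst ⊗ₘ κ) (hα' : α' = α'.map Prod.fst ⊗ₘ κ')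
    {τ : ℝ} (hτ : TVClose α α' τ) {S : Set ℝ} (hS : MeasurableSet S) :
    ∫ a, |(κ a).real S - (κ' a).real S| ∂(α.map Prod.fst) ≤ 4 * τ := by
  have := Measure.isProbabilityMeasure_map (μ := α) measurable_fst.aemeasurable
  have := Measure.isProbabilityMeasure_map (μ := α') measurable_fst.aemeasurable
  have hm : ∀ (κ : Kernel A ℝ), Measurable fun a => (κ a).real S := fun κ =>
    (κ.measurable_coe hS).ennreal_toReal
  have h01 : ∀ (κ : Kernel A ℝ) [IsMarkovKernel κ] a, (κ a).real S ∈ Set.Icc (0 : ℝ) 1 :=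
    fun κ _ a => ⟨measureReal_nonneg, measureReal_le_one⟩
  have hint : ∀ (κ : Kernel A ℝ) [IsMarkovKernel κ] (m : Measure A) [IsFiniteMeasure m],
      Integrable (fun a => (κ a).real S) m := fun κ _ m _ => integrable_of_mem_Icc (hm κ) (h01 κ)
  -- integrals of the kernels over a set are masses of rectangles
  have hrect : ∀ (β : Measure (A × ℝ)) [IsProbabilityMeasure β] (κ : Kernel A ℝ)
      [IsMarkovKernel κ], β = β.map Prod.fst ⊗ₘ κ → ∀ P, MeasurableSet P →
      ∫ a in P, (κ a).real S ∂(β.map Prod.fst) = β.real (P ×ˢ S) := by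
    intro β _ κ _ hβ P hP
    have := Measure.isProbabilityMeasure_map (μ := β) measurable_fst.aemeasurable
    have h1 : β (P ×ˢ S) = ∫⁻ a in P, κ a S ∂(β.map Prod.fst) := by
      conv_lhs => rw [hβ]
      rw [Measure.compProd_apply_prod hP hS]
    rw [measureReal_def, h1]
    exact integral_toReal (κ.measurable_coe hS).aemeasurable
      (ae_of_all _ fun a => measure_lt_top _ _)
  have key : ∀ P, MeasurableSet P →
      |∫ a in P, ((κ a).real S - (κ' a).real S) ∂(α.map Prod.fst)| ≤ 2 * τ := by
    intro P hP
    rw [integral_sub (hint κ _) (hint κ' _), hrect α κ hα P hP]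
    have e1 := hτ ((P ×ˢ S).indicator 1) (measurable_one.indicator (hP.prod hS)) (fun x => by
      by_cases hx : x ∈ P ×ˢ S <;> simp [hx])
    rw [integral_indicator_one (hP.prod hS), integral_indicator_one (hP.prod hS)] at e1
    have hmφ : Measurable (P.indicator fun a => (κ' a).real S) := (hm κ').indicator hP
    have e2 := hτ (fun p => P.indicator (fun a => (κ' a).real S) p.1) (hmφ.comp measurable_fst)
      (fun x => by
        by_cases hx : x.1 ∈ P
        · simp [hx]
        · simp [hx])
    have e3 : ∀ m : Measure (A × ℝ), ∫ p, P.indicator (fun a => (κ' a).real S) p.1 ∂m =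
        ∫ a in P, (κ' a).real S ∂(m.map Prod.fst) := fun m => by
      rw [← integral_indicator hP,
        integral_map measurable_fst.aemeasurable hmφ.aestronglyMeasurable]
    rw [e3, e3, hrect α' κ' hα' P hP] at e2
    rw [abs_le] at e1 e2 ⊢
    constructor <;> linarith [e1.1, e1.2, e2.1, e2.2]
  have hP : MeasurableSet {a | (κ' a).real S ≤ (κ a).real S} := measurableSet_le (hm κ') (hm κ)
  have hi : Integrable (fun a => |(κ a).real S - (κ' a).real S|) (α.map Prod.fst) :=
    ((hint κ _).sub (hint κ' _)).abs
  rw [← integral_add_compl hP hi]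
  have h1 : ∫ a in {a | (κ' a).real S ≤ (κ a).real S}, |(κ a).real S - (κ' a).real S|
      ∂(α.map Prod.fst) = ∫ a in {a | (κ' a).real S ≤ (κ a).real S},
        ((κ a).real S - (κ' a).real S) ∂(α.map Prod.fst) :=
    setIntegral_congr_fun hP fun a ha => abs_of_nonneg (sub_nonneg.2 ha)
  have h2 : ∫ a in {a | (κ' a).real S ≤ (κ a).real S}ᶜ, |(κ a).real S - (κ' a).real S|
      ∂(α.map Prod.fst) = - ∫ a in {a | (κ' a).real S ≤ (κ a).real S}ᶜ,
        ((κ a).real S - (κ' a).real S) ∂(α.map Prod.fst) := by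
    rw [← integral_neg]
    exact setIntegral_congr_fun hP.compl fun a ha =>
      abs_of_neg (sub_neg.2 (not_le.1 ha))
  rw [h1, h2]
  have k1 := abs_le.1 (key _ hP)
  have k2 := abs_le.1 (key _ hP.compl)
  linarith [k1.2, k2.1]

lemma abs_min_sub_min_le (a b c d : ℝ) : |min a b - min c d| ≤ |a - c| + |b - d| :=
  (abs_min_sub_min_le_max a b c d).trans (max_le_add_of_nonneg (abs_nonneg _) (abs_nonneg _))

lemma abs_clamp_sub_clamp_le (l u a b : ℝ) :
    |max l (min u a) - max l (min u b)| ≤ |a - b| := by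
  refine (abs_max_sub_max_le_max _ _ _ _).trans (max_le (by simp) ?_)
  exact (abs_min_sub_min_le_max _ _ _ _).trans (by simp)

variable [TopologicalSpace A] [TopologicalSpace.PseudoMetrizableSpace A] [SecondCountableTopology A]
  [MeasurableSpace A] [BorelSpace A]
  [TopologicalSpace B] [TopologicalSpace.PseudoMetrizableSpace B] [SecondCountableTopology B]
  [MeasurableSpace B] [BorelSpace B]

/-- A function with values in `[0, 1]` is approximated in `L¹` by continuous ones. -/
lemma exists_continuous_integral_abs_sub_le {m : Measure A} [IsFiniteMeasure m] {φ : A → ℝ}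
    (hφ : Measurable φ) (h01 : ∀ a, φ a ∈ Set.Icc (0 : ℝ) 1) {δ : ℝ} (hδ : 0 < δ) :
    ∃ g : A → ℝ, Continuous g ∧ (∀ a, g a ∈ Set.Icc (0 : ℝ) 1) ∧
      ∫ a, |φ a - g a| ∂m ≤ δ := by
  obtain ⟨g, hg, hgi⟩ :=
    (integrable_of_mem_Icc (m := m) hφ h01).exists_boundedContinuous_integral_sub_le hδ
  have hc : Continuous fun a => max 0 (min 1 (g a)) := by fun_prop
  have hg01 : ∀ a, max 0 (min 1 (g a)) ∈ Set.Icc (0 : ℝ) 1 := fun a =>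
    ⟨le_max_left _ _, max_le zero_le_one (min_le_left _ _)⟩
  refine ⟨_, hc, hg01, le_trans (integral_mono ?_ ?_ fun a => ?_) hg⟩
  · exact ((integrable_of_mem_Icc hφ h01).sub (integrable_of_mem_Icc hc.measurable hg01)).abs
  · exact ((integrable_of_mem_Icc hφ h01).sub hgi).norm
  · have hφ' : φ a = max 0 (min 1 (φ a)) := by
      rw [min_eq_right (h01 a).2, max_eq_right (h01 a).1]
    show |φ a - max 0 (min 1 (g a))| ≤ |φ a - g a|
    conv_lhs => rw [hφ']
    exact abs_clamp_sub_clamp_le 0 1 _ _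

/-- Along a narrowly convergent sequence of plans whose marginals converge in total variation,
discontinuous functions of each of the two variables may be used as test functions. -/
lemma tendsto_integral_min {θs : ℕ → ProbabilityMeasure (A × B)} {θ : ProbabilityMeasure (A × B)}
    (hθ : Tendsto θs atTop (𝓝 θ)) {τ : ℕ → ℝ} (hτ : Tendsto τ atTop (𝓝 0))
    (h1 : ∀ n, TVClose ((θs n : Measure (A × B)).map Prod.fst)
      ((θ : Measure (A × B)).map Prod.fst) (τ n))
    (h2 : ∀ n, TVClose ((θs n : Measure (A × B)).map Prod.snd)
      ((θ : Measure (A × B)).map Prod.snd) (τ n))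
    {φ : A → ℝ} (hφ : Measurable φ) (hφ1 : ∀ a, φ a ∈ Set.Icc (0 : ℝ) 1)
    {ψ : B → ℝ} (hψ : Measurable ψ) (hψ1 : ∀ b, ψ b ∈ Set.Icc (0 : ℝ) 1) :
    Tendsto (fun n => ∫ z, min (φ z.1) (ψ z.2) ∂(θs n : Measure (A × B))) atTop
      (𝓝 (∫ z, min (φ z.1) (ψ z.2) ∂(θ : Measure (A × B)))) := by
  rw [Metric.tendsto_atTop]
  intro δ hδ
  have := Measure.isProbabilityMeasure_map (μ := (θ : Measure (A × B))) measurable_fst.aemeasurable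
  have := Measure.isProbabilityMeasure_map (μ := (θ : Measure (A × B))) measurable_snd.aemeasurable
  obtain ⟨f, hfc, hf1, hf⟩ := exists_continuous_integral_abs_sub_le
    (m := (θ : Measure (A × B)).map Prod.fst) hφ hφ1 (δ := δ / 8) (by positivity)
  obtain ⟨g, hgc, hg1, hg⟩ := exists_continuous_integral_abs_sub_le
    (m := (θ : Measure (A × B)).map Prod.snd) hψ hψ1 (δ := δ / 8) (by positivity)
  have habs01 : ∀ {x y : ℝ}, x ∈ Set.Icc (0 : ℝ) 1 → y ∈ Set.Icc (0 : ℝ) 1 →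
      |x - y| ∈ Set.Icc (0 : ℝ) 1 := fun hx hy =>
    ⟨abs_nonneg _, abs_le.2 ⟨by linarith [hx.1, hy.2], by linarith [hx.2, hy.1]⟩⟩
  have hmin01 : ∀ {x y : ℝ}, x ∈ Set.Icc (0 : ℝ) 1 → y ∈ Set.Icc (0 : ℝ) 1 →
      min x y ∈ Set.Icc (0 : ℝ) 1 := fun hx hy => ⟨le_min hx.1 hy.1, (min_le_left _ _).trans hx.2⟩
  have hmf : Measurable fun a => |φ a - f a| := (hφ.sub hfc.measurable).abs
  have hmg : Measurable fun b => |ψ b - g b| := (hψ.sub hgc.measurable).abs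
  -- the error made by replacing `φ` and `ψ` by continuous functions
  have herr : ∀ m : ProbabilityMeasure (A × B),
      |∫ z, min (φ z.1) (ψ z.2) ∂(m : Measure (A × B)) -
        ∫ z, min (f z.1) (g z.2) ∂(m : Measure (A × B))| ≤
      ∫ a, |φ a - f a| ∂((m : Measure (A × B)).map Prod.fst) +
        ∫ b, |ψ b - g b| ∂((m : Measure (A × B)).map Prod.snd) := by
    intro m
    rw [integral_map measurable_fst.aemeasurable hmf.aestronglyMeasurable,
      integral_map measurable_snd.aemeasurable hmg.aestronglyMeasurable,
      ← integral_sub, ← integral_add]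
    · refine abs_integral_le_integral_abs.trans (integral_mono ?_ ?_ fun z => ?_)
      · exact ((integrable_of_mem_Icc ((hφ.comp measurable_fst).min (hψ.comp measurable_snd))
          fun z => hmin01 (hφ1 _) (hψ1 _)).sub
          (integrable_of_mem_Icc ((hfc.measurable.comp measurable_fst).min
            (hgc.measurable.comp measurable_snd)) fun z => hmin01 (hf1 _) (hg1 _))).abs
      · exact (integrable_of_mem_Icc (hmf.comp measurable_fst) fun z => habs01 (hφ1 _) (hf1 _)).add
          (integrable_of_mem_Icc (hmg.comp measurable_snd) fun z => habs01 (hψ1 _) (hg1 _))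
      · exact abs_min_sub_min_le _ _ _ _
    · exact integrable_of_mem_Icc (hmf.comp measurable_fst) fun z => habs01 (hφ1 _) (hf1 _)
    · exact integrable_of_mem_Icc (hmg.comp measurable_snd) fun z => habs01 (hψ1 _) (hg1 _)
    · exact integrable_of_mem_Icc ((hφ.comp measurable_fst).min (hψ.comp measurable_snd))
          fun z => hmin01 (hφ1 _) (hψ1 _)
    · exact integrable_of_mem_Icc ((hfc.measurable.comp measurable_fst).min
            (hgc.measurable.comp measurable_snd)) fun z => hmin01 (hf1 _) (hg1 _)
  let F : BoundedContinuousFunction (A × B) ℝ :=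
    BoundedContinuousFunction.mkOfBound ⟨fun z => min (f z.1) (g z.2), by fun_prop⟩ 1 fun x y => by
      have hx := hmin01 (hf1 x.1) (hg1 x.2)
      have hy := hmin01 (hf1 y.1) (hg1 y.2)
      exact (habs01 hx hy).2
  have hF := (ProbabilityMeasure.tendsto_iff_forall_integral_tendsto.1 hθ F)
  obtain ⟨N1, hN1⟩ := Metric.tendsto_atTop.1 hF (δ / 8) (by positivity)
  obtain ⟨N2, hN2⟩ := Metric.tendsto_atTop.1 hτ (δ / 8) (by positivity)
  refine ⟨max N1 N2, fun n hn => ?_⟩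
  have a1 := hN1 n ((le_max_left _ _).trans hn)
  have a2 := hN2 n ((le_max_right _ _).trans hn)
  have a3 := h1 n _ hmf fun a => habs01 (hφ1 a) (hf1 a)
  have a4 := h2 n _ hmg fun b => habs01 (hψ1 b) (hg1 b)
  have a5 := herr (θs n)
  have a6 := herr θ
  have a1' : |∫ z, min (f z.1) (g z.2) ∂(θs n : Measure (A × B)) -
      ∫ z, min (f z.1) (g z.2) ∂(θ : Measure (A × B))| < δ / 8 := a1
  rw [Real.dist_eq, sub_zero] at a2
  rw [Real.dist_eq]
  rw [abs_lt] at a1' a2 ⊢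
  rw [abs_le] at a3 a4 a5 a6
  constructor <;> linarith [a1'.1, a1'.2, a2.1, a2.2, a3.1, a3.2, a4.1, a4.2, a5.1, a5.2, a6.1,
    a6.2]

end Convergence

/-! ### Identification of the limit of a sequence of nearly optimal couplings -/

section Limit

lemma ae_mem_of_tendsto {X : Type*} [TopologicalSpace X] [MeasurableSpace X]
    [OpensMeasurableSpace X] [HasOuterApproxClosed X] {ρs : ℕ → ProbabilityMeasure X}
    {ρ : ProbabilityMeasure X} (hρ : Tendsto ρs atTop (𝓝 ρ)) {F : Set X} (hF : IsClosed F)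
    (h : ∀ n, ∀ᵐ x ∂(ρs n : Measure X), x ∈ F) : ∀ᵐ x ∂(ρ : Measure X), x ∈ F := by
  have h1 := ProbabilityMeasure.limsup_measure_closed_le_of_tendsto hρ hF
  have h2 : ∀ n, (ρs n : Measure X) F = 1 := fun n =>
    (prob_compl_eq_zero_iff hF.measurableSet).1 (h n)
  simp only [h2, limsup_const] at h1
  exact (prob_compl_eq_zero_iff hF.measurableSet).2 (le_antisymm prob_le_one h1)

/-- Continuous functions that are bounded along the sequence are admissible test functions for
narrow convergence. -/
lemma tendsto_integral_of_ae_abs_le {X : Type*} [TopologicalSpace X] [MeasurableSpace X]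
    [OpensMeasurableSpace X] [HasOuterApproxClosed X] {ρs : ℕ → ProbabilityMeasure X}
    {ρ : ProbabilityMeasure X} (hρ : Tendsto ρs atTop (𝓝 ρ)) {g : X → ℝ} (hg : Continuous g)
    {C : ℝ} (h : ∀ n, ∀ᵐ x ∂(ρs n : Measure X), |g x| ≤ C) :
    Tendsto (fun n => ∫ x, g x ∂(ρs n : Measure X)) atTop (𝓝 (∫ x, g x ∂(ρ : Measure X))) := by
  have hlim : ∀ᵐ x ∂(ρ : Measure X), |g x| ≤ C :=
    ae_mem_of_tendsto hρ (isClosed_le hg.abs continuous_const) h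
  have hmem : ∀ x, |max (-|C|) (min |C| (g x))| ≤ |C| := fun x => abs_le.2
    ⟨le_max_left _ _, max_le (by linarith [abs_nonneg C]) (min_le_left _ _)⟩
  let G : BoundedContinuousFunction X ℝ :=
    BoundedContinuousFunction.ofNormedAddCommGroup (fun x => max (-|C|) (min |C| (g x)))
      (by fun_prop) |C| hmem
  have hG : ∀ x, |g x| ≤ C → g x = G x := fun x hx => by
    have h1 := abs_le.1 (hx.trans (le_abs_self C))
    show g x = max (-|C|) (min |C| (g x))
    rw [min_eq_right h1.2, max_eq_right h1.1]
  have := ProbabilityMeasure.tendsto_iff_forall_integral_tendsto.1 hρ G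
  rw [integral_congr_ae (g := G) (hlim.mono hG)]
  refine this.congr fun n => ?_
  exact (integral_congr_ae ((h n).mono hG)).symm

/-- The relation between a point `q.2` and the corner `q.1` of a quadrant that contains it. -/
lemma measurableSet_quadrant_incidence :
    MeasurableSet {q : (ℝ × ℝ) × (ℝ × ℝ) | q.2.1 ≤ q.1.1 ∧ q.2.2 ≤ q.1.2} :=
  (measurableSet_le (f := fun q : (ℝ × ℝ) × (ℝ × ℝ) => q.2.1) (g := fun q => q.1.1)
    (by fun_prop) (by fun_prop)).inter
  (measurableSet_le (f := fun q : (ℝ × ℝ) × (ℝ × ℝ) => q.2.2) (g := fun q => q.1.2)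
    (by fun_prop) (by fun_prop))

/-- A correlation written in terms of the masses of the lower left quadrants (Hoeffding's formula),
by Tonelli's theorem. -/
lemma lintegral_measure_Iic_prod {P : Measure (ℝ × ℝ)} [IsProbabilityMeasure P] {R : ℝ}
    (hP : ∀ᵐ z ∂P, z.1 ∈ Set.Icc (-R) R ∧ z.2 ∈ Set.Icc (-R) R) :
    ∫⁻ p, P (Set.Iic p.1 ×ˢ Set.Iic p.2)
        ∂((volume.restrict (Set.Icc (-R) R)).prod (volume.restrict (Set.Icc (-R) R))) =
      ENNReal.ofReal (∫ z, (R - z.1) * (R - z.2) ∂P) := by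
  set l := volume.restrict (Set.Icc (-R) R)
  have hW := measurableSet_quadrant_incidence
  have h1 : ∫⁻ p, P (Set.Iic p.1 ×ˢ Set.Iic p.2) ∂(l.prod l) =
      ((l.prod l).prod P) {q : (ℝ × ℝ) × (ℝ × ℝ) | q.2.1 ≤ q.1.1 ∧ q.2.2 ≤ q.1.2} := by
    rw [Measure.prod_apply hW]
    rfl
  rw [h1, Measure.prod_apply_symm hW, ofReal_integral_eq_lintegral_ofReal]
  · refine lintegral_congr_ae ?_
    filter_upwards [hP] with z hz
    have h2 : (fun x => (x, z)) ⁻¹' {q : (ℝ × ℝ) × (ℝ × ℝ) | q.2.1 ≤ q.1.1 ∧ q.2.2 ≤ q.1.2} =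
        Set.Ici z.1 ×ˢ Set.Ici z.2 := by
      ext p; simp [Prod.le_def]
    have h3 : ∀ x ∈ Set.Icc (-R) R, l (Set.Ici x) = ENNReal.ofReal (R - x) := by
      intro x hx
      have : Set.Ici x ∩ Set.Icc (-R) R = Set.Icc x R := by
        ext y
        simp only [Set.mem_inter_iff, Set.mem_Ici, Set.mem_Icc]
        exact ⟨fun h => ⟨h.1, h.2.2⟩, fun h => ⟨h.1, hx.1.trans h.1, h.2⟩⟩
      rw [Measure.restrict_apply measurableSet_Ici, this, Real.volume_Icc]
    rw [h2, Measure.prod_prod, h3 _ hz.1, h3 _ hz.2, ← ENNReal.ofReal_mul (by linarith [hz.1.2])]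
  · refine Integrable.of_bound (by fun_prop) ((2 * R) * (2 * R)) ?_
    filter_upwards [hP] with z hz
    rw [norm_mul]
    have k1 : ‖R - z.1‖ ≤ 2 * R := abs_le.2 ⟨by linarith [hz.1.1, hz.1.2], by linarith [hz.1.1]⟩
    have k2 : ‖R - z.2‖ ≤ 2 * R := abs_le.2 ⟨by linarith [hz.2.1, hz.2.2], by linarith [hz.2.1]⟩
    exact mul_le_mul k1 k2 (norm_nonneg _) ((norm_nonneg _).trans k1)
  · filter_upwards [hP] with z hz
    exact mul_nonneg (by linarith [hz.1.2]) (by linarith [hz.2.2])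

lemma measurable_measure_Iic_prod (P : Measure (ℝ × ℝ)) [SFinite P] :
    Measurable fun p : ℝ × ℝ => P (Set.Iic p.1 ×ˢ Set.Iic p.2) := by
  have hW := measurableSet_quadrant_incidence
  exact measurable_measure_prodMk_left hW

/-- Two laws on the plane whose distribution functions are ordered coincide once the integrals of
the distribution functions over large boxes are ordered the other way round. -/
lemma measure_Iic_prod_eq_of_lintegral_le {P Q : Measure (ℝ × ℝ)} [IsProbabilityMeasure P]
    [IsProbabilityMeasure Q] {R₀ : ℝ}
    (hle : ∀ s t, P (Set.Iic s ×ˢ Set.Iic t) ≤ Q (Set.Iic s ×ˢ Set.Iic t))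
    (hint : ∀ R ≥ R₀, ∫⁻ p, Q (Set.Iic p.1 ×ˢ Set.Iic p.2)
        ∂((volume.restrict (Set.Icc (-R) R)).prod (volume.restrict (Set.Icc (-R) R))) ≤
      ∫⁻ p, P (Set.Iic p.1 ×ˢ Set.Iic p.2)
        ∂((volume.restrict (Set.Icc (-R) R)).prod (volume.restrict (Set.Icc (-R) R))))
    (s t : ℝ) : P (Set.Iic s ×ˢ Set.Iic t) = Q (Set.Iic s ×ˢ Set.Iic t) := by
  refine le_antisymm (hle s t) ?_
  obtain ⟨R, hR0, hRs, hRt⟩ : ∃ R ≥ R₀, |s| + 1 ≤ R ∧ |t| + 1 ≤ R :=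
    ⟨max R₀ (max (|s| + 1) (|t| + 1)), le_max_left _ _,
      (le_max_left _ _).trans (le_max_right _ _), (le_max_right _ _).trans (le_max_right _ _)⟩
  set l := volume.restrict (Set.Icc (-R) R) with hl
  have hfin : ∫⁻ p, P (Set.Iic p.1 ×ˢ Set.Iic p.2) ∂(l.prod l) ≠ ∞ := by
    refine ne_top_of_le_ne_top (measure_ne_top (l.prod l) Set.univ) ?_
    rw [← lintegral_one]
    exact lintegral_mono fun p => prob_le_one
  have hae := ae_eq_of_ae_le_of_lintegral_le (μ := l.prod l)
    (ae_of_all _ fun p => hle p.1 p.2) hfin (measurable_measure_Iic_prod Q).aemeasurable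
    (hint R hR0)
  refine ge_of_tendsto' (tendsto_measure_Iic_prod P s t) fun n => ?_
  set δ : ℝ := 1 / ((n : ℝ) + 1)
  have hδ : 0 < δ := by positivity
  have hδ1 : δ ≤ 1 := by
    rw [div_le_one (by positivity)]
    linarith [(Nat.cast_nonneg n : (0 : ℝ) ≤ n)]
  -- a point of equality just above and to the right of `(s, t)`
  have hpos : (l.prod l) (Set.Ioo s (s + δ) ×ˢ Set.Ioo t (t + δ)) ≠ 0 := by
    have hI : ∀ x : ℝ, |x| + 1 ≤ R → l (Set.Ioo x (x + δ)) ≠ 0 := by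
      intro x hx
      have : Set.Ioo x (x + δ) ∩ Set.Icc (-R) R = Set.Ioo x (x + δ) :=
        Set.inter_eq_left.2 fun y hy => ⟨by linarith [hy.1, neg_abs_le x],
          by linarith [hy.2, le_abs_self x]⟩
      rw [hl, Measure.restrict_apply measurableSet_Ioo, this, Real.volume_Ioo]
      simpa using hδ
    rw [Measure.prod_prod]
    exact mul_ne_zero (hI s hRs) (hI t hRt)
  obtain ⟨p, hp, hpe⟩ := ((frequently_ae_mem_iff.2 hpos).and_eventually hae).exists
  calc Q (Set.Iic s ×ˢ Set.Iic t) ≤ Q (Set.Iic p.1 ×ˢ Set.Iic p.2) :=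
        measure_mono (Set.prod_mono (Set.Iic_subset_Iic.2 hp.1.1.le)
          (Set.Iic_subset_Iic.2 hp.2.1.le))
    _ = P (Set.Iic p.1 ×ˢ Set.Iic p.2) := hpe.symm
    _ ≤ _ := measure_mono (Set.prod_mono (Set.Iic_subset_Iic.2 hp.1.2.le)
          (Set.Iic_subset_Iic.2 hp.2.2.le))

variable {A B : Type*} [MeasurableSpace A] [MeasurableSpace B]

/-- When `b = f a` almost surely, conditioning on `(a, b)` amounts to conditioning on `a`. -/
lemma map_left_eq_compProd {ρ : Measure ((A × B) × (ℝ × ℝ))} [IsProbabilityMeasure ρ]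
    {κ : Kernel A ℝ} [IsMarkovKernel κ]
    (hκ : ρ.map (fun p => (p.1.1, p.2.1)) = ρ.map (fun p => p.1.1) ⊗ₘ κ)
    {f : A → B} (hf : Measurable f) (hgraph : ∀ᵐ p ∂ρ, p.1.2 = f p.1.1) :
    ρ.map (fun p => (p.1, p.2.1)) = ρ.map Prod.fst ⊗ₘ κ.comap Prod.fst measurable_fst := by
  have hG : Measurable fun a => (a, f a) := measurable_id.prodMk hf
  have hG' : Measurable fun q : A × ℝ => ((q.1, f q.1), q.2) :=
    (hG.comp measurable_fst).prodMk measurable_snd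
  have h1 : ρ.map Prod.fst = (ρ.map fun p => p.1.1).map fun a => (a, f a) := by
    rw [Measure.map_map hG (by fun_prop)]
    refine Measure.map_congr ?_
    filter_upwards [hgraph] with p hp
    exact Prod.ext rfl hp
  have hs : SFinite (ρ.map fun p => p.1.1) := inferInstance
  rw [h1, map_compProd_eq (κ := κ) (g := fun _ s => s) hG measurable_snd
    (ae_of_all _ fun a => by rw [Kernel.comap_apply, Measure.map_id']), ← hκ,
    Measure.map_map hG' (by fun_prop)]
  refine Measure.map_congr ?_
  filter_upwards [hgraph] with p hp
  exact Prod.ext (Prod.ext rfl hp) rfl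

lemma map_right_eq_compProd {ρ : Measure ((A × B) × (ℝ × ℝ))} [IsProbabilityMeasure ρ]
    {η : Kernel B ℝ} [IsMarkovKernel η]
    (hη : ρ.map (fun p => (p.1.2, p.2.2)) = ρ.map (fun p => p.1.2) ⊗ₘ η)
    {g : B → A} (hg : Measurable g) (hgraph : ∀ᵐ p ∂ρ, p.1.1 = g p.1.2) :
    ρ.map (fun p => (p.1, p.2.2)) = ρ.map Prod.fst ⊗ₘ η.comap Prod.snd measurable_snd := by
  have hG : Measurable fun b => (g b, b) := hg.prodMk measurable_id
  have hG' : Measurable fun q : B × ℝ => ((g q.1, q.1), q.2) :=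
    (hG.comp measurable_fst).prodMk measurable_snd
  have h1 : ρ.map Prod.fst = (ρ.map fun p => p.1.2).map fun b => (g b, b) := by
    rw [Measure.map_map hG (by fun_prop)]
    refine Measure.map_congr ?_
    filter_upwards [hgraph] with p hp
    exact Prod.ext hp rfl
  have hs : SFinite (ρ.map fun p => p.1.2) := inferInstance
  rw [h1, map_compProd_eq (κ := η) (g := fun _ s => s) hG measurable_snd
    (ae_of_all _ fun a => by rw [Kernel.comap_apply, Measure.map_id']), ← hη,
    Measure.map_map hG' (by fun_prop)]
  refine Measure.map_congr ?_
  filter_upwards [hgraph] with p hp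
  exact Prod.ext (Prod.ext hp rfl) rfl

/-- Among the plans with prescribed conditional laws of the two coordinates, the one with monotone
fibres gives the largest mass to every quadrant. -/
lemma apply_prod_quadrant_le {ρ : Measure ((A × B) × (ℝ × ℝ))} [IsProbabilityMeasure ρ]
    {κ : Kernel A ℝ} [IsMarkovKernel κ] {η : Kernel B ℝ} [IsMarkovKernel η]
    (h1 : ρ.map (fun p => (p.1, p.2.1)) = ρ.map Prod.fst ⊗ₘ κ.comap Prod.fst measurable_fst)
    (h2 : ρ.map (fun p => (p.1, p.2.2)) = ρ.map Prod.fst ⊗ₘ η.comap Prod.snd measurable_snd)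
    {C : Set (A × B)} (hC : MeasurableSet C) (s t : ℝ) :
    ρ (C ×ˢ (Set.Iic s ×ˢ Set.Iic t)) ≤
      (ρ.map Prod.fst ⊗ₘ pairKernel κ η) (C ×ˢ (Set.Iic s ×ˢ Set.Iic t)) := by
  have hmκ : Measurable fun z : A × B => κ z.1 (Set.Iic s) :=
    (κ.measurable_coe measurableSet_Iic).comp measurable_fst
  have hmη : Measurable fun z : A × B => η z.2 (Set.Iic t) :=
    (η.measurable_coe measurableSet_Iic).comp measurable_snd
  -- the half planes bound the quadrant; use the better of the two bounds at each point of `C`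
  have b1 : ∀ D : Set (A × B), MeasurableSet D → ρ (D ×ˢ (Set.Iic s ×ˢ Set.Iic t)) ≤
      ∫⁻ z in D, κ z.1 (Set.Iic s) ∂(ρ.map Prod.fst) := by
    intro D hD
    have e := Measure.compProd_apply_prod (μ := ρ.map Prod.fst)
      (κ := κ.comap Prod.fst measurable_fst) hD (measurableSet_Iic (a := s))
    rw [← h1, Measure.map_apply (by fun_prop) (hD.prod measurableSet_Iic)] at e
    refine le_trans (measure_mono ?_) e.le
    rintro ⟨z, x, y⟩ ⟨hz, hx, hy⟩
    exact ⟨hz, hx⟩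
  have b2 : ∀ D : Set (A × B), MeasurableSet D → ρ (D ×ˢ (Set.Iic s ×ˢ Set.Iic t)) ≤
      ∫⁻ z in D, η z.2 (Set.Iic t) ∂(ρ.map Prod.fst) := by
    intro D hD
    have e := Measure.compProd_apply_prod (μ := ρ.map Prod.fst)
      (κ := η.comap Prod.snd measurable_snd) hD (measurableSet_Iic (a := t))
    rw [← h2, Measure.map_apply (by fun_prop) (hD.prod measurableSet_Iic)] at e
    refine le_trans (measure_mono ?_) e.le
    rintro ⟨z, x, y⟩ ⟨hz, hx, hy⟩
    exact ⟨hz, hy⟩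
  have hE : MeasurableSet {z : A × B | κ z.1 (Set.Iic s) ≤ η z.2 (Set.Iic t)} :=
    measurableSet_le hmκ hmη
  set E' := {z : A × B | κ z.1 (Set.Iic s) ≤ η z.2 (Set.Iic t)}
  rw [Measure.compProd_apply_prod hC (measurableSet_Iic.prod measurableSet_Iic)]
  simp only [pairKernel_apply, monotoneCoupling_Iic_prod]
  rw [← lintegral_inter_add_sdiff _ C hE]
  have hsplit : C ×ˢ (Set.Iic s ×ˢ Set.Iic t) ⊆
      (C ∩ E') ×ˢ (Set.Iic s ×ˢ Set.Iic t) ∪ (C \ E') ×ˢ (Set.Iic s ×ˢ Set.Iic t) := by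
    rintro ⟨z, q⟩ ⟨hz, hq⟩
    by_cases h : z ∈ E'
    · exact Or.inl ⟨⟨hz, h⟩, hq⟩
    · exact Or.inr ⟨⟨hz, h⟩, hq⟩
  refine (measure_mono hsplit).trans ((measure_union_le _ _).trans (add_le_add ?_ ?_))
  · refine (b1 _ (hC.inter hE)).trans_eq (setLIntegral_congr_fun (hC.inter hE) fun z hz => ?_)
    exact (min_eq_left hz.2).symm
  · refine (b2 _ (hC.diff hE)).trans_eq (setLIntegral_congr_fun (hC.diff hE) fun z hz => ?_)
    exact (min_eq_right (le_of_lt (not_le.1 hz.2))).symm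

/-- A plan is the one with monotone fibres as soon as it gives the same total mass to every
quadrant: over a set of conditioning variables and over its complement, the masses are ordered, so
that equal sums have equal terms. -/
lemma eq_compProd_pairKernel_of_quadrants {ρ : Measure ((A × B) × (ℝ × ℝ))}
    [IsProbabilityMeasure ρ]
    {κ : Kernel A ℝ} [IsMarkovKernel κ] {η : Kernel B ℝ} [IsMarkovKernel η]
    (h1 : ρ.map (fun p => (p.1, p.2.1)) = ρ.map Prod.fst ⊗ₘ κ.comap Prod.fst measurable_fst)
    (h2 : ρ.map (fun p => (p.1, p.2.2)) = ρ.map Prod.fst ⊗ₘ η.comap Prod.snd measurable_snd)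
    (h : ∀ s t : ℝ, ρ (Set.univ ×ˢ (Set.Iic s ×ˢ Set.Iic t)) =
      (ρ.map Prod.fst ⊗ₘ pairKernel κ η) (Set.univ ×ˢ (Set.Iic s ×ˢ Set.Iic t))) :
    ρ = ρ.map Prod.fst ⊗ₘ pairKernel κ η := by
  have := Measure.isProbabilityMeasure_map (μ := ρ) measurable_fst.aemeasurable
  set Q := ρ.map Prod.fst ⊗ₘ pairKernel κ η with hQ
  have hq : IsCountablySpanning quadrants :=
    ⟨fun n : ℕ => Set.Iic (n : ℝ) ×ˢ Set.Iic (n : ℝ), fun n => ⟨_, _, rfl⟩, by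
      ext ⟨x, y⟩
      obtain ⟨n, hn⟩ := exists_nat_ge (max x y)
      simp only [Set.mem_iUnion, Set.mem_prod, Set.mem_Iic, Set.mem_univ, iff_true]
      exact ⟨n, (le_max_left _ _).trans hn, (le_max_right _ _).trans hn⟩⟩
  refine ext_of_generate_finite
    (Set.image2 (· ×ˢ ·) {C : Set (A × B) | MeasurableSet C} quadrants)
    (generateFrom_eq_prod MeasurableSpace.generateFrom_measurableSet generateFrom_quadrants.symm
      isCountablySpanning_measurableSet hq).symm
    (MeasurableSpace.isPiSystem_measurableSet.prod isPiSystem_quadrants) ?_ (by simp)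
  rintro _ ⟨C, hC', _, ⟨s, t, rfl⟩, rfl⟩
  have hC : MeasurableSet C := hC'
  have hq' : MeasurableSet (Set.Iic s ×ˢ Set.Iic t) := measurableSet_Iic.prod measurableSet_Iic
  have hadd : ∀ m : Measure ((A × B) × (ℝ × ℝ)), m (Set.univ ×ˢ (Set.Iic s ×ˢ Set.Iic t)) =
      m (C ×ˢ (Set.Iic s ×ˢ Set.Iic t)) + m (Cᶜ ×ˢ (Set.Iic s ×ˢ Set.Iic t)) := by
    intro m
    rw [← measure_union _ (MeasurableSet.prod (MeasurableSet.compl hC) hq'), ← Set.union_prod,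
      Set.union_compl_self]
    exact Set.disjoint_prod.2 (Or.inl disjoint_compl_right)
  have e1 := apply_prod_quadrant_le h1 h2 hC s t
  have e2 := apply_prod_quadrant_le h1 h2 (MeasurableSet.compl hC) s t
  refine le_antisymm e1 ?_
  by_contra hlt
  have h3 := h s t
  rw [hadd ρ, hadd Q] at h3
  exact (ENNReal.add_lt_add_of_lt_of_le (measure_ne_top _ _) (not_le.1 hlt) e2).ne h3

end Limit

/-! ### Limits of couplings with nearly optimal fibres -/

section LimitStep

/-- For fixed marginals, the quadratic cost and the correlation differ by a constant. -/
lemma integral_correlation_sub {P Q : Measure (ℝ × ℝ)} [IsProbabilityMeasure P]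
    [IsProbabilityMeasure Q] (h1 : Q.map Prod.fst = P.map Prod.fst)
    (h2 : Q.map Prod.snd = P.map Prod.snd) {R : ℝ}
    (hP : ∀ᵐ z ∂P, z.1 ∈ Set.Icc (-R) R ∧ z.2 ∈ Set.Icc (-R) R)
    (hQ : ∀ᵐ z ∂Q, z.1 ∈ Set.Icc (-R) R ∧ z.2 ∈ Set.Icc (-R) R) :
    ∫ z, (R - z.1) * (R - z.2) ∂Q - ∫ z, (R - z.1) * (R - z.2) ∂P =
      1 / 2 * (∫ z, (z.1 - z.2) ^ 2 ∂P - ∫ z, (z.1 - z.2) ^ 2 ∂Q) := by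
  have hb : ∀ {u : ℝ}, |u| ≤ 2 * R → ‖u ^ 2‖ ≤ (2 * R) ^ 2 := fun {u} hu => by
    rw [norm_pow]
    exact pow_le_pow_left₀ (norm_nonneg _) hu 2
  have key : ∀ m : Measure (ℝ × ℝ), IsProbabilityMeasure m →
      (∀ᵐ z ∂m, z.1 ∈ Set.Icc (-R) R ∧ z.2 ∈ Set.Icc (-R) R) →
      ∫ z, (R - z.1) * (R - z.2) ∂m = 1 / 2 * (∫ x, (R - x) ^ 2 ∂(m.map Prod.fst) +
        ∫ y, (R - y) ^ 2 ∂(m.map Prod.snd) - ∫ z, (z.1 - z.2) ^ 2 ∂m) := by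
    intro m _ hm
    have i1 : Integrable (fun z : ℝ × ℝ => (R - z.1) ^ 2) m :=
      Integrable.of_bound (by fun_prop) ((2 * R) ^ 2) (hm.mono fun z hz => hb
        (abs_le.2 ⟨by linarith [hz.1.1, hz.1.2], by linarith [hz.1.1]⟩))
    have i2 : Integrable (fun z : ℝ × ℝ => (R - z.2) ^ 2) m :=
      Integrable.of_bound (by fun_prop) ((2 * R) ^ 2) (hm.mono fun z hz => hb
        (abs_le.2 ⟨by linarith [hz.2.1, hz.2.2], by linarith [hz.2.1]⟩))
    have i12 : Integrable (fun z : ℝ × ℝ => (R - z.1) ^ 2 + (R - z.2) ^ 2) m := i1.add i2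
    have i3 : Integrable (fun z : ℝ × ℝ => (z.1 - z.2) ^ 2) m :=
      Integrable.of_bound (by fun_prop) ((2 * R) ^ 2) (hm.mono fun z hz => hb
        (abs_le.2 ⟨by linarith [hz.1.1, hz.2.2], by linarith [hz.1.2, hz.2.1]⟩))
    rw [integral_map measurable_fst.aemeasurable (by fun_prop),
      integral_map measurable_snd.aemeasurable (by fun_prop), ← integral_add i1 i2,
      ← integral_sub i12 i3, ← integral_const_mul]
    congr 1
    funext z
    ring
  rw [key P inferInstance hP, key Q inferInstance hQ, h1, h2]
  ring

variable {A B : Type*} [TopologicalSpace A] [TopologicalSpace.PseudoMetrizableSpace A]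
  [SecondCountableTopology A] [MeasurableSpace A] [BorelSpace A]
  [TopologicalSpace B] [TopologicalSpace.PseudoMetrizableSpace B] [SecondCountableTopology B]
  [MeasurableSpace B] [BorelSpace B]

lemma compProd_pairKernel_quadrant {A B : Type*} [MeasurableSpace A] [MeasurableSpace B]
    (θ : Measure (A × B)) [IsProbabilityMeasure θ]
    (κ : Kernel A ℝ) [IsMarkovKernel κ] (η : Kernel B ℝ) [IsMarkovKernel η] (s t : ℝ) :
    (θ ⊗ₘ pairKernel κ η) (Set.univ ×ˢ (Set.Iic s ×ˢ Set.Iic t)) =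
      ENNReal.ofReal (∫ z, min ((κ z.1).real (Set.Iic s)) ((η z.2).real (Set.Iic t)) ∂θ) := by
  have hm : Measurable fun z : A × B =>
      min ((κ z.1).real (Set.Iic s)) ((η z.2).real (Set.Iic t)) :=
    (((κ.measurable_coe measurableSet_Iic).comp measurable_fst).ennreal_toReal).min
      (((η.measurable_coe measurableSet_Iic).comp measurable_snd).ennreal_toReal)
  rw [Measure.compProd_apply_prod MeasurableSet.univ (measurableSet_Iic.prod measurableSet_Iic),
    Measure.restrict_univ, ofReal_integral_eq_lintegral_ofReal]
  · refine lintegral_congr fun z => ?_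
    rw [pairKernel_apply, monotoneCoupling_Iic_prod, ENNReal.ofReal_min, ofReal_measureReal,
      ofReal_measureReal]
  · exact integrable_of_mem_Icc hm fun z =>
      ⟨le_min measureReal_nonneg measureReal_nonneg, (min_le_left _ _).trans measureReal_le_one⟩
  · exact ae_of_all _ fun z => le_min measureReal_nonneg measureReal_nonneg

/-- Convergence of the distribution functions of the plans with monotone fibres. -/
lemma tendsto_compProd_pairKernel_quadrant {θs : ℕ → ProbabilityMeasure (A × B)}
    {θ : ProbabilityMeasure (A × B)} (hθ : Tendsto θs atTop (𝓝 θ))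
    {αs : ℕ → Measure (A × ℝ)} {α : Measure (A × ℝ)} {βs : ℕ → Measure (B × ℝ)}
    {β : Measure (B × ℝ)} [∀ n, IsProbabilityMeasure (αs n)] [∀ n, IsProbabilityMeasure (βs n)]
    [IsProbabilityMeasure α] [IsProbabilityMeasure β]
    (hα1 : ∀ n, (αs n).map Prod.fst = (θs n : Measure (A × B)).map Prod.fst)
    (hα2 : α.map Prod.fst = (θ : Measure (A × B)).map Prod.fst)
    (hβ1 : ∀ n, (βs n).map Prod.fst = (θs n : Measure (A × B)).map Prod.snd)
    (hβ2 : β.map Prod.fst = (θ : Measure (A × B)).map Prod.snd)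
    {κs : ℕ → Kernel A ℝ} {κ : Kernel A ℝ} {ηs : ℕ → Kernel B ℝ} {η : Kernel B ℝ}
    [∀ n, IsMarkovKernel (κs n)] [IsMarkovKernel κ] [∀ n, IsMarkovKernel (ηs n)]
    [IsMarkovKernel η]
    (hκs : ∀ n, αs n = (αs n).map Prod.fst ⊗ₘ κs n) (hκ : α = α.map Prod.fst ⊗ₘ κ)
    (hηs : ∀ n, βs n = (βs n).map Prod.fst ⊗ₘ ηs n) (hη : β = β.map Prod.fst ⊗ₘ η)
    {τ : ℕ → ℝ} (hτ : Tendsto τ atTop (𝓝 0)) (hτα : ∀ n, TVClose (αs n) α (τ n))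
    (hτβ : ∀ n, TVClose (βs n) β (τ n)) (s t : ℝ) :
    Tendsto (fun n => ((θs n : Measure (A × B)) ⊗ₘ pairKernel (κs n) (ηs n))
      (Set.univ ×ˢ (Set.Iic s ×ˢ Set.Iic t))) atTop
      (𝓝 (((θ : Measure (A × B)) ⊗ₘ pairKernel κ η) (Set.univ ×ˢ (Set.Iic s ×ˢ Set.Iic t)))) := by
  simp only [compProd_pairKernel_quadrant]
  refine (ENNReal.continuous_ofReal.tendsto _).comp ?_
  have hmκ : ∀ κ : Kernel A ℝ, Measurable fun a => (κ a).real (Set.Iic s) := fun κ =>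
    (κ.measurable_coe measurableSet_Iic).ennreal_toReal
  have hmη : ∀ η : Kernel B ℝ, Measurable fun b => (η b).real (Set.Iic t) := fun η =>
    (η.measurable_coe measurableSet_Iic).ennreal_toReal
  have hκ1 : ∀ (κ : Kernel A ℝ) [IsMarkovKernel κ] a, (κ a).real (Set.Iic s) ∈ Set.Icc (0 : ℝ) 1 :=
    fun κ _ a => ⟨measureReal_nonneg, measureReal_le_one⟩
  have hη1 : ∀ (η : Kernel B ℝ) [IsMarkovKernel η] b, (η b).real (Set.Iic t) ∈ Set.Icc (0 : ℝ) 1 :=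
    fun η _ b => ⟨measureReal_nonneg, measureReal_le_one⟩
  have hlim := tendsto_integral_min hθ hτ
    (fun n => hα1 n ▸ hα2 ▸ (hτα n).map measurable_fst)
    (fun n => hβ1 n ▸ hβ2 ▸ (hτβ n).map measurable_fst)
    (hmκ κ) (hκ1 κ) (hmη η) (hη1 η)
  refine hlim.congr_dist ?_
  have h8 : Tendsto (fun n => 4 * τ n + 4 * τ n) atTop (𝓝 0) := by
    simpa using (hτ.const_mul 4).add (hτ.const_mul 4)
  refine squeeze_zero (fun n => dist_nonneg) (fun n => ?_) h8
  have e1 := integral_abs_kernel_sub_le (hκs n) hκ (hτα n) (measurableSet_Iic (a := s))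
  have e2 := integral_abs_kernel_sub_le (hηs n) hη (hτβ n) (measurableSet_Iic (a := t))
  have m1 : Measurable fun a => |(κs n a).real (Set.Iic s) - (κ a).real (Set.Iic s)| :=
    ((hmκ (κs n)).sub (hmκ κ)).abs
  have m2 : Measurable fun b => |(ηs n b).real (Set.Iic t) - (η b).real (Set.Iic t)| :=
    ((hmη (ηs n)).sub (hmη η)).abs
  rw [hα1 n, integral_map measurable_fst.aemeasurable m1.aestronglyMeasurable] at e1
  rw [hβ1 n, integral_map measurable_snd.aemeasurable m2.aestronglyMeasurable] at e2
  have i0 : ∀ (κ : Kernel A ℝ) [IsMarkovKernel κ] (η : Kernel B ℝ) [IsMarkovKernel η],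
      Integrable (fun z : A × B => min ((κ z.1).real (Set.Iic s)) ((η z.2).real (Set.Iic t)))
        (θs n : Measure (A × B)) := fun κ _ η _ =>
    integrable_of_mem_Icc (((hmκ κ).comp measurable_fst).min ((hmη η).comp measurable_snd))
      fun z => ⟨le_min measureReal_nonneg measureReal_nonneg,
        (min_le_left _ _).trans measureReal_le_one⟩
  have i1 : Integrable (fun z : A × B => |(κs n z.1).real (Set.Iic s) - (κ z.1).real (Set.Iic s)|)
      (θs n : Measure (A × B)) :=
    ((integrable_of_mem_Icc ((hmκ (κs n)).comp measurable_fst) fun z => hκ1 (κs n) z.1).sub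
      (integrable_of_mem_Icc ((hmκ κ).comp measurable_fst) fun z => hκ1 κ z.1)).abs
  have i2 : Integrable (fun z : A × B => |(ηs n z.2).real (Set.Iic t) - (η z.2).real (Set.Iic t)|)
      (θs n : Measure (A × B)) :=
    ((integrable_of_mem_Icc ((hmη (ηs n)).comp measurable_snd) fun z => hη1 (ηs n) z.2).sub
      (integrable_of_mem_Icc ((hmη η).comp measurable_snd) fun z => hη1 η z.2)).abs
  rw [dist_comm, Real.dist_eq, ← integral_sub (i0 (κs n) (ηs n)) (i0 κ η)]
  refine abs_integral_le_integral_abs.trans (le_trans ?_ (add_le_add e1 e2))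
  rw [← integral_add i1 i2]
  exact integral_mono ((i0 (κs n) (ηs n)).sub (i0 κ η)).abs (i1.add i2)
    fun z => abs_min_sub_min_le _ _ _ _

/-- The limit step: couplings whose cost is at most that of the plans with monotone fibres, up to a
vanishing error, have a limit with monotone fibres, provided that the conditioning variables `a`
and `b` determine each other in the limit. -/
theorem eq_compProd_pairKernel_of_tendsto
    {ρs : ℕ → ProbabilityMeasure ((A × B) × (ℝ × ℝ))}
    {ρ : ProbabilityMeasure ((A × B) × (ℝ × ℝ))} (hρ : Tendsto ρs atTop (𝓝 ρ))
    {κs : ℕ → Kernel A ℝ} {κ : Kernel A ℝ} {ηs : ℕ → Kernel B ℝ} {η : Kernel B ℝ}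
    [∀ n, IsMarkovKernel (κs n)] [IsMarkovKernel κ] [∀ n, IsMarkovKernel (ηs n)]
    [IsMarkovKernel η]
    (hκs : ∀ n, (ρs n : Measure ((A × B) × (ℝ × ℝ))).map (fun p => (p.1.1, p.2.1)) =
      (ρs n : Measure ((A × B) × (ℝ × ℝ))).map (fun p => p.1.1) ⊗ₘ κs n)
    (hκ : (ρ : Measure ((A × B) × (ℝ × ℝ))).map (fun p => (p.1.1, p.2.1)) =
      (ρ : Measure ((A × B) × (ℝ × ℝ))).map (fun p => p.1.1) ⊗ₘ κ)
    (hηs : ∀ n, (ρs n : Measure ((A × B) × (ℝ × ℝ))).map (fun p => (p.1.2, p.2.2)) =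
      (ρs n : Measure ((A × B) × (ℝ × ℝ))).map (fun p => p.1.2) ⊗ₘ ηs n)
    (hη : (ρ : Measure ((A × B) × (ℝ × ℝ))).map (fun p => (p.1.2, p.2.2)) =
      (ρ : Measure ((A × B) × (ℝ × ℝ))).map (fun p => p.1.2) ⊗ₘ η)
    {τ : ℕ → ℝ} (hτ : Tendsto τ atTop (𝓝 0))
    (hτα : ∀ n, TVClose ((ρs n : Measure ((A × B) × (ℝ × ℝ))).map (fun p => (p.1.1, p.2.1)))
      ((ρ : Measure ((A × B) × (ℝ × ℝ))).map (fun p => (p.1.1, p.2.1))) (τ n))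
    (hτβ : ∀ n, TVClose ((ρs n : Measure ((A × B) × (ℝ × ℝ))).map (fun p => (p.1.2, p.2.2)))
      ((ρ : Measure ((A × B) × (ℝ × ℝ))).map (fun p => (p.1.2, p.2.2))) (τ n))
    {f : A → B} (hf : Measurable f) (hgf : ∀ᵐ p ∂(ρ : Measure ((A × B) × (ℝ × ℝ))), p.1.2 = f p.1.1)
    {g : B → A} (hg : Measurable g) (hgg : ∀ᵐ p ∂(ρ : Measure ((A × B) × (ℝ × ℝ))), p.1.1 = g p.1.2)
    {R₀ : ℝ} (hsupp : ∀ n, ∀ᵐ p ∂(ρs n : Measure ((A × B) × (ℝ × ℝ))),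
      p.2.1 ∈ Set.Icc (-R₀) R₀ ∧ p.2.2 ∈ Set.Icc (-R₀) R₀)
    {δ : ℕ → ℝ} (hδ : Tendsto δ atTop (𝓝 0))
    (hcost : ∀ n, ∫ p, (p.2.1 - p.2.2) ^ 2 ∂(ρs n : Measure ((A × B) × (ℝ × ℝ))) ≤
      ∫ p, (p.2.1 - p.2.2) ^ 2
        ∂((ρs n : Measure ((A × B) × (ℝ × ℝ))).map Prod.fst ⊗ₘ pairKernel (κs n) (ηs n)) + δ n) :
    (ρ : Measure ((A × B) × (ℝ × ℝ))) =
      (ρ : Measure ((A × B) × (ℝ × ℝ))).map Prod.fst ⊗ₘ pairKernel κ η := by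
  have hfst : ∀ m : ProbabilityMeasure ((A × B) × (ℝ × ℝ)),
      IsProbabilityMeasure ((m : Measure ((A × B) × (ℝ × ℝ))).map Prod.fst) := fun m =>
    Measure.isProbabilityMeasure_map measurable_fst.aemeasurable
  have hsnd : ∀ m : ProbabilityMeasure ((A × B) × (ℝ × ℝ)),
      IsProbabilityMeasure ((m : Measure ((A × B) × (ℝ × ℝ))).map Prod.snd) := fun m =>
    Measure.isProbabilityMeasure_map measurable_snd.aemeasurable
  have hl : ∀ m : ProbabilityMeasure ((A × B) × (ℝ × ℝ)),
      IsProbabilityMeasure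
        ((m : Measure ((A × B) × (ℝ × ℝ))).map fun p => (p.1.1, p.2.1)) := fun m =>
    Measure.isProbabilityMeasure_map (by fun_prop)
  have hr : ∀ m : ProbabilityMeasure ((A × B) × (ℝ × ℝ)),
      IsProbabilityMeasure
        ((m : Measure ((A × B) × (ℝ × ℝ))).map fun p => (p.1.2, p.2.2)) := fun m =>
    Measure.isProbabilityMeasure_map (by fun_prop)
  have h1 := map_left_eq_compProd hκ hf hgf
  have h2 := map_right_eq_compProd hη hg hgg
  -- laws on the plane of the pair of the last coordinates
  set Q : Measure (ℝ × ℝ) :=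
    ((ρ : Measure ((A × B) × (ℝ × ℝ))).map Prod.fst ⊗ₘ pairKernel κ η).map Prod.snd with hQ
  let Qs : ℕ → Measure (ℝ × ℝ) := fun n =>
    ((ρs n : Measure ((A × B) × (ℝ × ℝ))).map Prod.fst ⊗ₘ pairKernel (κs n) (ηs n)).map Prod.snd
  have : IsProbabilityMeasure Q := Measure.isProbabilityMeasure_map measurable_snd.aemeasurable
  have : ∀ n, IsProbabilityMeasure (Qs n) := fun n =>
    Measure.isProbabilityMeasure_map measurable_snd.aemeasurable
  have hsndapp : ∀ (m : Measure ((A × B) × (ℝ × ℝ))) (s t : ℝ),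
      m.map Prod.snd (Set.Iic s ×ˢ Set.Iic t) = m (Set.univ ×ˢ (Set.Iic s ×ˢ Set.Iic t)) := by
    intro m s t
    rw [Measure.map_apply measurable_snd (measurableSet_Iic.prod measurableSet_Iic),
      Set.univ_prod]
  refine eq_compProd_pairKernel_of_quadrants h1 h2 fun s t => ?_
  rw [← hsndapp, ← hsndapp]
  refine measure_Iic_prod_eq_of_lintegral_le (R₀ := R₀) (fun s t => ?_) (fun R hR => ?_) s t
  · rw [hsndapp, hsndapp]
    exact apply_prod_quadrant_le h1 h2 MeasurableSet.univ s t
  have hIcc : Set.Icc (-R₀) R₀ ⊆ Set.Icc (-R) R := Set.Icc_subset_Icc (by linarith) hR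
  have hsuppR : ∀ n, ∀ᵐ p ∂(ρs n : Measure ((A × B) × (ℝ × ℝ))),
      p.2.1 ∈ Set.Icc (-R) R ∧ p.2.2 ∈ Set.Icc (-R) R := fun n =>
    (hsupp n).mono fun p hp => ⟨hIcc hp.1, hIcc hp.2⟩
  have hmbox : MeasurableSet {z : ℝ × ℝ | z.1 ∈ Set.Icc (-R) R ∧ z.2 ∈ Set.Icc (-R) R} :=
    (measurable_fst measurableSet_Icc).inter (measurable_snd measurableSet_Icc)
  have hP : ∀ m : ProbabilityMeasure ((A × B) × (ℝ × ℝ)),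
      (∀ᵐ p ∂(m : Measure ((A × B) × (ℝ × ℝ))), p.2.1 ∈ Set.Icc (-R) R ∧ p.2.2 ∈ Set.Icc (-R) R) →
      ∀ᵐ z ∂((m : Measure ((A × B) × (ℝ × ℝ))).map Prod.snd),
        z.1 ∈ Set.Icc (-R) R ∧ z.2 ∈ Set.Icc (-R) R :=
    fun m hm => (ae_map_iff measurable_snd.aemeasurable hmbox).2 hm
  have hlimsupp : ∀ᵐ p ∂(ρ : Measure ((A × B) × (ℝ × ℝ))),
      p.2.1 ∈ Set.Icc (-R) R ∧ p.2.2 ∈ Set.Icc (-R) R :=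
    ae_mem_of_tendsto hρ (F := {p | p.2.1 ∈ Set.Icc (-R) R ∧ p.2.2 ∈ Set.Icc (-R) R})
      ((isClosed_Icc.preimage (by fun_prop)).inter (isClosed_Icc.preimage (by fun_prop))) hsuppR
  -- the competitors have the same marginals on the line
  have hQ1 : ∀ n, (Qs n).map Prod.fst =
      ((ρs n : Measure ((A × B) × (ℝ × ℝ))).map Prod.snd).map Prod.fst := by
    intro n
    have e := map_compProd_pairKernel_left
      ((ρs n : Measure ((A × B) × (ℝ × ℝ))).map Prod.fst) (κs n) (ηs n)
    rw [Measure.map_map measurable_fst measurable_fst] at e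
    have e' := congrArg (fun m : Measure (A × ℝ) => m.map Prod.snd) (e.trans (hκs n).symm)
    rw [Measure.map_map measurable_snd (by fun_prop),
      Measure.map_map measurable_snd (by fun_prop)] at e'
    rw [Measure.map_map measurable_fst measurable_snd,
      Measure.map_map measurable_fst measurable_snd]
    exact e'
  have hQ2 : ∀ n, (Qs n).map Prod.snd =
      ((ρs n : Measure ((A × B) × (ℝ × ℝ))).map Prod.snd).map Prod.snd := by
    intro n
    have e := map_compProd_pairKernel_right
      ((ρs n : Measure ((A × B) × (ℝ × ℝ))).map Prod.fst) (κs n) (ηs n)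
    rw [Measure.map_map measurable_snd measurable_fst] at e
    have e' := congrArg (fun m : Measure (B × ℝ) => m.map Prod.snd) (e.trans (hηs n).symm)
    rw [Measure.map_map measurable_snd (by fun_prop),
      Measure.map_map measurable_snd (by fun_prop)] at e'
    rw [Measure.map_map measurable_snd measurable_snd,
      Measure.map_map measurable_snd measurable_snd]
    exact e'
  have hQsupp : ∀ n, ∀ᵐ z ∂(Qs n), z.1 ∈ Set.Icc (-R) R ∧ z.2 ∈ Set.Icc (-R) R := by
    intro n
    have k1 : ∀ᵐ x ∂((ρs n : Measure ((A × B) × (ℝ × ℝ))).map Prod.snd).map Prod.fst,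
        x ∈ Set.Icc (-R) R := by
      refine (ae_map_iff measurable_fst.aemeasurable measurableSet_Icc).2 ?_
      exact (hP (ρs n) (hsuppR n)).mono fun z hz => hz.1
    have k2 : ∀ᵐ x ∂((ρs n : Measure ((A × B) × (ℝ × ℝ))).map Prod.snd).map Prod.snd,
        x ∈ Set.Icc (-R) R := by
      refine (ae_map_iff measurable_snd.aemeasurable measurableSet_Icc).2 ?_
      exact (hP (ρs n) (hsuppR n)).mono fun z hz => hz.2
    rw [← hQ1] at k1
    rw [← hQ2] at k2
    exact (ae_of_ae_map measurable_fst.aemeasurable k1).and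
      (ae_of_ae_map measurable_snd.aemeasurable k2)
  set l := (volume.restrict (Set.Icc (-R) R)).prod (volume.restrict (Set.Icc (-R) R))
  have hstep : ∀ n, ∫⁻ p, Qs n (Set.Iic p.1 ×ˢ Set.Iic p.2) ∂l ≤
      ∫⁻ p, (ρs n : Measure ((A × B) × (ℝ × ℝ))).map Prod.snd (Set.Iic p.1 ×ˢ Set.Iic p.2) ∂l +
        ENNReal.ofReal (1 / 2 * δ n) := by
    intro n
    have e := integral_correlation_sub (hQ1 n) (hQ2 n) (hP (ρs n) (hsuppR n)) (hQsupp n)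
    have c := hcost n
    have m1 : ∫ p, (p.2.1 - p.2.2) ^ 2 ∂(ρs n : Measure ((A × B) × (ℝ × ℝ))) =
        ∫ z, (z.1 - z.2) ^ 2 ∂((ρs n : Measure ((A × B) × (ℝ × ℝ))).map Prod.snd) := by
      rw [integral_map measurable_snd.aemeasurable (by fun_prop)]
    have m2 : ∫ p, (p.2.1 - p.2.2) ^ 2
        ∂((ρs n : Measure ((A × B) × (ℝ × ℝ))).map Prod.fst ⊗ₘ pairKernel (κs n) (ηs n)) =
        ∫ z, (z.1 - z.2) ^ 2 ∂(Qs n) := by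
      rw [integral_map measurable_snd.aemeasurable (by fun_prop)]
    rw [m1, m2] at c
    rw [lintegral_measure_Iic_prod (hQsupp n), lintegral_measure_Iic_prod (hP _ (hsuppR n))]
    refine le_trans (ENNReal.ofReal_le_ofReal ?_) ENNReal.ofReal_add_le
    linarith
  have hlimP : Tendsto
      (fun n => ∫⁻ p, (ρs n : Measure ((A × B) × (ℝ × ℝ))).map Prod.snd
        (Set.Iic p.1 ×ˢ Set.Iic p.2) ∂l) atTop
      (𝓝 (∫⁻ p, (ρ : Measure ((A × B) × (ℝ × ℝ))).map Prod.snd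
        (Set.Iic p.1 ×ˢ Set.Iic p.2) ∂l)) := by
    rw [lintegral_measure_Iic_prod (hP _ hlimsupp)]
    refine ((ENNReal.continuous_ofReal.tendsto _).comp ?_).congr
      fun n => (lintegral_measure_Iic_prod (hP _ (hsuppR n))).symm
    have hmap : ∀ m : ProbabilityMeasure ((A × B) × (ℝ × ℝ)),
        ∫ z, (R - z.1) * (R - z.2) ∂((m : Measure ((A × B) × (ℝ × ℝ))).map Prod.snd) =
        ∫ p, (R - p.2.1) * (R - p.2.2) ∂(m : Measure ((A × B) × (ℝ × ℝ))) := fun m => by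
      rw [integral_map measurable_snd.aemeasurable (by fun_prop)]
    simp only [hmap]
    refine tendsto_integral_of_ae_abs_le hρ (by fun_prop) (C := (2 * R) * (2 * R)) fun n => ?_
    filter_upwards [hsuppR n] with p hp
    rw [abs_mul]
    have k1 : |R - p.2.1| ≤ 2 * R := abs_le.2 ⟨by linarith [hp.1.1, hp.1.2], by linarith [hp.1.1]⟩
    have k2 : |R - p.2.2| ≤ 2 * R := abs_le.2 ⟨by linarith [hp.2.1, hp.2.2], by linarith [hp.2.1]⟩
    exact mul_le_mul k1 k2 (abs_nonneg _) ((abs_nonneg _).trans k1)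
  have hlimQ : Tendsto (fun n => ∫⁻ p, Qs n (Set.Iic p.1 ×ˢ Set.Iic p.2) ∂l) atTop
      (𝓝 (∫⁻ p, Q (Set.Iic p.1 ×ˢ Set.Iic p.2) ∂l)) := by
    refine tendsto_lintegral_of_dominated_convergence 1
      (fun n => measurable_measure_Iic_prod (Qs n)) (fun n => ae_of_all _ fun p => prob_le_one)
      (by simp [l])
      (ae_of_all _ fun p => ?_)
    simp only [Qs, hQ, hsndapp]
    have hθ := ProbabilityMeasure.tendsto_map_of_tendsto_of_continuous ρs ρ hρ
      (f := Prod.fst) continuous_fst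
    have hfl : ∀ m : Measure ((A × B) × (ℝ × ℝ)),
        (m.map fun p => (p.1.1, p.2.1)).map Prod.fst = m.map fun p => p.1.1 := fun m =>
      Measure.map_map measurable_fst (by fun_prop)
    have hfr : ∀ m : Measure ((A × B) × (ℝ × ℝ)),
        (m.map fun p => (p.1.2, p.2.2)).map Prod.fst = m.map fun p => p.1.2 := fun m =>
      Measure.map_map measurable_fst (by fun_prop)
    have hgl : ∀ m : Measure ((A × B) × (ℝ × ℝ)),
        m.map (fun p => p.1.1) = (m.map Prod.fst).map Prod.fst := fun m =>
      (Measure.map_map measurable_fst measurable_fst).symm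
    have hgr : ∀ m : Measure ((A × B) × (ℝ × ℝ)),
        m.map (fun p => p.1.2) = (m.map Prod.fst).map Prod.snd := fun m =>
      (Measure.map_map measurable_snd measurable_fst).symm
    exact tendsto_compProd_pairKernel_quadrant hθ
      (αs := fun n => (ρs n : Measure ((A × B) × (ℝ × ℝ))).map fun p => (p.1.1, p.2.1))
      (α := (ρ : Measure ((A × B) × (ℝ × ℝ))).map fun p => (p.1.1, p.2.1))
      (βs := fun n => (ρs n : Measure ((A × B) × (ℝ × ℝ))).map fun p => (p.1.2, p.2.2))
      (β := (ρ : Measure ((A × B) × (ℝ × ℝ))).map fun p => (p.1.2, p.2.2))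
      (fun n => (hfl _).trans (hgl _)) ((hfl _).trans (hgl _))
      (fun n => (hfr _).trans (hgr _)) ((hfr _).trans (hgr _))
      (fun n => by rw [hfl]; exact hκs n) (by rw [hfl]; exact hκ)
      (fun n => by rw [hfr]; exact hηs n) (by rw [hfr]; exact hη)
      hτ hτα hτβ p.1 p.2
  have hδ' : Tendsto (fun n => ENNReal.ofReal (1 / 2 * δ n)) atTop (𝓝 0) := by
    have h := (ENNReal.continuous_ofReal.tendsto _).comp (hδ.const_mul (1 / 2 : ℝ))
    rw [mul_zero, ENNReal.ofReal_zero] at h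
    exact h
  have hfinal := le_of_tendsto_of_tendsto' hlimQ (hlimP.add hδ') hstep
  simpa using hfinal

end LimitStep

/-! ### Competitors obtained by gluing -/

section Gluing

/-- Every coupling of the images of two laws lifts to a coupling of the laws themselves. -/
lemma exists_coupling_map_eq {X Y A B : Type*} [MeasurableSpace X] [StandardBorelSpace X]
    [Nonempty X] [MeasurableSpace Y] [StandardBorelSpace Y] [Nonempty Y] [MeasurableSpace A]
    [MeasurableEq A] [MeasurableSpace B] [MeasurableEq B] {μ : Measure X} {ν : Measure Y}
    [IsProbabilityMeasure μ] [IsProbabilityMeasure ν] {p : X → A} {q : Y → B} (hp : Measurable p)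
    (hq : Measurable q) {ρ : Measure (A × B)} [IsProbabilityMeasure ρ]
    (h1 : ρ.map Prod.fst = μ.map p) (h2 : ρ.map Prod.snd = ν.map q) :
    ∃ η : Measure (X × Y), η.map Prod.fst = μ ∧ η.map Prod.snd = ν ∧
      η.map (fun z => (p z.1, q z.2)) = ρ := by
  let κ : Kernel A X := condDistrib id p μ
  let l : Kernel B Y := condDistrib id q ν
  -- conditionally independent lifts of the two coordinates
  let Ξ : Measure ((A × B) × (X × Y)) :=
    ρ ⊗ₘ ((κ.comap Prod.fst measurable_fst) ×ₖ (l.comap Prod.snd measurable_snd))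
  have e1 : Ξ.map (fun t => (t.1.1, t.2.1)) = μ.map fun x => (p x, x) := by
    have : μ.map (fun x => (p x, x)) = μ.map p ⊗ₘ κ :=
      (compProd_map_condDistrib aemeasurable_id).symm
    rw [this, ← h1]
    refine (map_compProd_eq (g := fun _ => Prod.fst) measurable_fst
      (measurable_fst.comp measurable_snd) (ae_of_all _ fun z => ?_)).symm
    rw [Kernel.prod_apply, Measure.map_fst_prod, measure_univ, one_smul]
    rfl
  have e2 : Ξ.map (fun t => (t.1.2, t.2.2)) = ν.map fun y => (q y, y) := by
    have : ν.map (fun y => (q y, y)) = ν.map q ⊗ₘ l :=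
      (compProd_map_condDistrib aemeasurable_id).symm
    rw [this, ← h2]
    refine (map_compProd_eq (g := fun _ => Prod.snd) measurable_snd
      (measurable_snd.comp measurable_snd) (ae_of_all _ fun z => ?_)).symm
    rw [Kernel.prod_apply, Measure.map_snd_prod, measure_univ, one_smul]
    rfl
  have hpx : Measurable fun x => (p x, x) := hp.prodMk measurable_id
  have hqy : Measurable fun y => (q y, y) := hq.prodMk measurable_id
  have hpq : Measurable fun z : X × Y => (p z.1, q z.2) :=
    (hp.comp measurable_fst).prodMk (hq.comp measurable_snd)
  have m1 : Measurable fun t : (A × B) × (X × Y) => (t.1.1, t.2.1) := by fun_prop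
  have m2 : Measurable fun t : (A × B) × (X × Y) => (t.1.2, t.2.2) := by fun_prop
  have a1 : ∀ᵐ t ∂Ξ, p t.2.1 = t.1.1 := by
    have hs : MeasurableSet {r : A × X | p r.2 = r.1} :=
      measurableSet_eq_fun (hp.comp measurable_snd) measurable_fst
    have : ∀ᵐ r ∂(μ.map fun x => (p x, x)), p r.2 = r.1 :=
      (ae_map_iff hpx.aemeasurable hs).2 (ae_of_all _ fun _ => rfl)
    rw [← e1] at this
    exact ae_of_ae_map m1.aemeasurable this
  have a2 : ∀ᵐ t ∂Ξ, q t.2.2 = t.1.2 := by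
    have hs : MeasurableSet {r : B × Y | q r.2 = r.1} :=
      measurableSet_eq_fun (hq.comp measurable_snd) measurable_fst
    have : ∀ᵐ r ∂(ν.map fun y => (q y, y)), q r.2 = r.1 :=
      (ae_map_iff hqy.aemeasurable hs).2 (ae_of_all _ fun _ => rfl)
    rw [← e2] at this
    exact ae_of_ae_map m2.aemeasurable this
  refine ⟨Ξ.map Prod.snd, ?_, ?_, ?_⟩
  · have e := congrArg (fun m : Measure (A × X) => m.map Prod.snd) e1
    rw [Measure.map_map measurable_snd m1,
      Measure.map_map measurable_snd hpx] at e
    rw [Measure.map_map measurable_fst measurable_snd]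
    exact e.trans Measure.map_id
  · have e := congrArg (fun m : Measure (B × Y) => m.map Prod.snd) e2
    rw [Measure.map_map measurable_snd m2,
      Measure.map_map measurable_snd hqy] at e
    rw [Measure.map_map measurable_snd measurable_snd]
    exact e.trans Measure.map_id
  · rw [Measure.map_map hpq measurable_snd]
    have : Ξ.map Prod.fst = ρ := Measure.fst_compProd ρ _
    rw [← this]
    refine Measure.map_congr ?_
    filter_upwards [a1, a2] with t h h'
    exact Prod.ext h h'

variable {d : ℕ}

lemma map_before_of_isCoupling {μ ν : Measure (E d)} {γ : Measure (E d × E d)}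
    (h : IsCoupling μ ν γ) (i : Fin d) :
    (γ.map (befores i)).map Prod.fst = μ.map (before i) ∧
      (γ.map (befores i)).map Prod.snd = ν.map (before i) := by
  rw [Measure.map_map measurable_fst (measurable_befores i),
    Measure.map_map measurable_snd (measurable_befores i), ← h.1, ← h.2, Measure.fst, Measure.snd,
    Measure.map_map (measurable_before i) measurable_fst,
    Measure.map_map (measurable_before i) measurable_snd]
  exact ⟨rfl, rfl⟩

/-- A coupling may be modified after the coordinates `j < i` so that the coordinates `i` become
coupled monotonically, conditionally on the previous ones. -/
lemma exists_competitor {μ ν : Measure (E d)} [IsProbabilityMeasure μ] [IsProbabilityMeasure ν]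
    {γ : Measure (E d × E d)} [IsProbabilityMeasure γ] (h : IsCoupling μ ν γ) (i : Fin d) :
    ∃ η : Measure (E d × E d), IsCoupling μ ν η ∧
      η.map (upTos i) = γ.map (befores i) ⊗ₘ stepKernel μ ν i := by
  have := Measure.isProbabilityMeasure_map (μ := γ) (measurable_befores i).aemeasurable
  let r : ((Set.Iio i → ℝ) × (Set.Iio i → ℝ)) × (ℝ × ℝ) →
      ((Set.Iio i → ℝ) × ℝ) × ((Set.Iio i → ℝ) × ℝ) :=
    fun p => ((p.1.1, p.2.1), (p.1.2, p.2.2))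
  let r' : ((Set.Iio i → ℝ) × ℝ) × ((Set.Iio i → ℝ) × ℝ) →
      ((Set.Iio i → ℝ) × (Set.Iio i → ℝ)) × (ℝ × ℝ) :=
    fun p => ((p.1.1, p.2.1), (p.1.2, p.2.2))
  have hr : Measurable r := by fun_prop
  have hr' : Measurable r' := by fun_prop
  set Q := γ.map (befores i) ⊗ₘ stepKernel μ ν i
  have := Measure.isProbabilityMeasure_map (μ := Q) hr.aemeasurable
  obtain ⟨η, hη1, hη2, hη⟩ := exists_coupling_map_eq (μ := μ) (ν := ν) (measurable_upTo i)
    (measurable_upTo i) (ρ := Q.map r)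
    (by
      rw [Measure.map_map measurable_fst hr, map_upTo, ← (map_before_of_isCoupling h i).1]
      exact map_compProd_pairKernel_left _ _ _)
    (by
      rw [Measure.map_map measurable_snd hr, map_upTo, ← (map_before_of_isCoupling h i).2]
      exact map_compProd_pairKernel_right _ _ _)
  refine ⟨η, ⟨hη1, hη2⟩, ?_⟩
  have e := congrArg (fun m => m.map r') hη
  have hu : Measurable fun z : E d × E d => (upTo i z.1, upTo i z.2) :=
    ((measurable_upTo i).comp measurable_fst).prodMk ((measurable_upTo i).comp measurable_snd)
  rw [Measure.map_map hr' hr, Measure.map_map hr' hu] at e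
  exact e.trans Measure.map_id

end Gluing

/-! ### Comparison of costs -/

section Cost

variable {d : ℕ}

lemma continuous_weightedCost (ε : ℝ) :
    Continuous fun z : E d × E d => weightedCost ε z.1 z.2 := by
  unfold weightedCost
  fun_prop

lemma weightedCost_nonneg {ε : ℝ} (hε : 0 ≤ ε) (x y : E d) : 0 ≤ weightedCost ε x y :=
  Finset.sum_nonneg fun _ _ => mul_nonneg (pow_nonneg hε _) (sq_nonneg _)

/-- Both points of almost every pair have their coordinates in `[-R, R]`. -/
def InBox (R : ℝ) (γ : Measure (E d × E d)) : Prop :=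
  ∀ᵐ z ∂γ, ∀ j : Fin d, z.1 j ∈ Set.Icc (-R) R ∧ z.2 j ∈ Set.Icc (-R) R

lemma IsCoupling.inBox {μ ν : Measure (E d)} {γ : Measure (E d × E d)} (h : IsCoupling μ ν γ)
    {R : ℝ} (hμ : ∀ j : Fin d, ∀ᵐ x ∂μ, x j ∈ Set.Icc (-R) R)
    (hν : ∀ j : Fin d, ∀ᵐ y ∂ν, y j ∈ Set.Icc (-R) R) : InBox R γ := by
  refine ae_all_iff.2 fun j => ?_
  have h1 := hμ j
  have h2 := hν j
  rw [← h.1] at h1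
  rw [← h.2] at h2
  exact (ae_of_ae_map measurable_fst.aemeasurable h1).and
    (ae_of_ae_map measurable_snd.aemeasurable h2)

lemma InBox.sq_le {R : ℝ} {γ : Measure (E d × E d)} (h : InBox R γ) (j : Fin d) :
    ∀ᵐ z ∂γ, (z.1 j - z.2 j) ^ 2 ≤ (2 * R) ^ 2 := by
  filter_upwards [h] with z hz
  obtain ⟨h1, h2⟩ := hz j
  exact sq_le_sq' (by linarith [h1.1, h2.2]) (by linarith [h1.2, h2.1])

lemma InBox.integrable_sq {R : ℝ} {γ : Measure (E d × E d)} [IsFiniteMeasure γ] (h : InBox R γ)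
    (j : Fin d) : Integrable (fun z : E d × E d => (z.1 j - z.2 j) ^ 2) γ := by
  refine Integrable.of_bound (by fun_prop) ((2 * R) ^ 2) ((h.sq_le j).mono fun z hz => ?_)
  rwa [Real.norm_of_nonneg (sq_nonneg _)]

lemma InBox.integrable_weightedCost {R : ℝ} {γ : Measure (E d × E d)} [IsFiniteMeasure γ]
    (h : InBox R γ) (ε : ℝ) : Integrable (fun z => weightedCost ε z.1 z.2) γ :=
  integrable_finsetSum _ fun j _ => (h.integrable_sq j).const_mul _

lemma InBox.integral_weightedCost {R : ℝ} {γ : Measure (E d × E d)} [IsFiniteMeasure γ]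
    (h : InBox R γ) (ε : ℝ) : ∫ z, weightedCost ε z.1 z.2 ∂γ =
      ∑ j : Fin d, ε ^ (j : ℕ) * ∫ z, (z.1 j - z.2 j) ^ 2 ∂γ := by
  unfold weightedCost
  rw [integral_finsetSum _ fun j _ => (h.integrable_sq j).const_mul _]
  simp only [integral_const_mul]

/-- The coordinate `i` of an optimal plan is coupled almost as well as it could be given the
coupling of the previous coordinates, since the weight of the next ones is smaller by a factor
`ε`. -/
lemma IsOptimalPlan.integral_sq_le {μ ν : Measure (E d)} [IsProbabilityMeasure μ]
    [IsProbabilityMeasure ν] {γ : Measure (E d × E d)} [IsProbabilityMeasure γ] {ε R : ℝ}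
    (hε0 : 0 < ε) (hε1 : ε ≤ 1) (h : IsOptimalPlan (weightedCost ε) μ ν γ)
    (hμ : ∀ j : Fin d, ∀ᵐ x ∂μ, x j ∈ Set.Icc (-R) R)
    (hν : ∀ j : Fin d, ∀ᵐ y ∂ν, y j ∈ Set.Icc (-R) R) (i : Fin d) :
    ∫ z, (z.1 i - z.2 i) ^ 2 ∂γ ≤
      ∫ p, (p.2.1 - p.2.2) ^ 2 ∂(γ.map (befores i) ⊗ₘ stepKernel μ ν i) +
        ε * (d * (2 * R) ^ 2) := by
  obtain ⟨η, hη, hηi⟩ := exists_competitor h.1 i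
  have hηp : IsProbabilityMeasure η := by
    have : IsProbabilityMeasure (η.map Prod.fst) := by
      rw [show η.map Prod.fst = μ from hη.1]; infer_instance
    exact Measure.isProbabilityMeasure_of_map Prod.fst
  have bγ := h.1.inBox hμ hν
  have bη := hη.inBox hμ hν
  have hopt : ∫ z, weightedCost ε z.1 z.2 ∂γ ≤ ∫ z, weightedCost ε z.1 z.2 ∂η := by
    have h1 := h.2 η hη
    rw [← ofReal_integral_eq_lintegral_ofReal (bγ.integrable_weightedCost ε)
      (ae_of_all _ fun z => weightedCost_nonneg hε0.le _ _),
      ← ofReal_integral_eq_lintegral_ofReal (bη.integrable_weightedCost ε)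
      (ae_of_all _ fun z => weightedCost_nonneg hε0.le _ _)] at h1
    exact (ENNReal.ofReal_le_ofReal_iff
      (integral_nonneg fun z => weightedCost_nonneg hε0.le _ _)).1 h1
  rw [bγ.integral_weightedCost, bη.integral_weightedCost] at hopt
  have hbef : γ.map (befores i) = η.map (befores i) := by
    have e := congrArg (fun m => m.map Prod.fst) hηi
    rw [Measure.map_map measurable_fst (measurable_upTos i)] at e
    have := Measure.isProbabilityMeasure_map (μ := γ) (measurable_befores i).aemeasurable
    exact ((e.trans (Measure.fst_compProd _ _))).symm
  -- the coordinates before `i` have the same cost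
  have hlt : ∀ j < i, ∫ z, (z.1 j - z.2 j) ^ 2 ∂γ = ∫ z, (z.1 j - z.2 j) ^ 2 ∂η := by
    intro j hj
    have key : ∀ m : Measure (E d × E d), ∫ z, (z.1 j - z.2 j) ^ 2 ∂m =
        ∫ p, (p.1 ⟨j, hj⟩ - p.2 ⟨j, hj⟩) ^ 2 ∂(m.map (befores i)) := fun m => by
      rw [integral_map (measurable_befores i).aemeasurable (by fun_prop)]
      rfl
    rw [key, key, hbef]
  have hi : ∫ z, (z.1 i - z.2 i) ^ 2 ∂η =
      ∫ p, (p.2.1 - p.2.2) ^ 2 ∂(γ.map (befores i) ⊗ₘ stepKernel μ ν i) := by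
    rw [← hηi, integral_map (measurable_upTos i).aemeasurable (by fun_prop)]
    rfl
  have hterm : ∀ j ≠ i, ε ^ (j : ℕ) * ∫ z, (z.1 j - z.2 j) ^ 2 ∂η -
      ε ^ (j : ℕ) * ∫ z, (z.1 j - z.2 j) ^ 2 ∂γ ≤ ε ^ (i : ℕ) * (ε * (2 * R) ^ 2) := by
    intro j hj
    rcases lt_or_gt_of_ne hj with hj | hj
    · rw [hlt j hj, sub_self]
      positivity
    · have b1 : 0 ≤ ∫ z, (z.1 j - z.2 j) ^ 2 ∂γ := integral_nonneg fun z => sq_nonneg _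
      have b2 : ∫ z, (z.1 j - z.2 j) ^ 2 ∂η ≤ (2 * R) ^ 2 := by
        have := integral_mono_ae (bη.integrable_sq j) (integrable_const ((2 * R) ^ 2))
          (bη.sq_le j)
        simpa using this
      have b3 : ε ^ (j : ℕ) ≤ ε ^ (i : ℕ) * ε := by
        rw [← pow_succ]
        exact pow_le_pow_of_le_one hε0.le hε1 (Fin.lt_def.1 hj)
      calc ε ^ (j : ℕ) * ∫ z, (z.1 j - z.2 j) ^ 2 ∂η - ε ^ (j : ℕ) * ∫ z, (z.1 j - z.2 j) ^ 2 ∂γ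
          ≤ ε ^ (j : ℕ) * ∫ z, (z.1 j - z.2 j) ^ 2 ∂η :=
            sub_le_self _ (mul_nonneg (by positivity) b1)
        _ ≤ (ε ^ (i : ℕ) * ε) * (2 * R) ^ 2 :=
            mul_le_mul b3 b2 (integral_nonneg fun z => sq_nonneg _) (by positivity)
        _ = _ := by ring
  rw [← Finset.add_sum_erase _ _ (Finset.mem_univ i),
    ← Finset.add_sum_erase _ _ (Finset.mem_univ i), hi] at hopt
  have hsum : ∑ j ∈ Finset.univ.erase i, ε ^ (j : ℕ) * ∫ z, (z.1 j - z.2 j) ^ 2 ∂η -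
      ∑ j ∈ Finset.univ.erase i, ε ^ (j : ℕ) * ∫ z, (z.1 j - z.2 j) ^ 2 ∂γ ≤
      d * (ε ^ (i : ℕ) * (ε * (2 * R) ^ 2)) := by
    rw [← Finset.sum_sub_distrib]
    refine (Finset.sum_le_card_nsmul _ _ _
      fun j hj => hterm j (Finset.ne_of_mem_erase hj)).trans ?_
    rw [nsmul_eq_mul]
    refine mul_le_mul_of_nonneg_right ?_ (by positivity)
    have := Finset.card_le_univ (Finset.univ.erase i)
    rw [Fintype.card_fin] at this
    exact_mod_cast this
  have hpos : 0 < ε ^ (i : ℕ) := by positivity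
  refine le_of_mul_le_mul_left ?_ hpos
  linarith [hopt, hsum]

end Cost

/-! ### Total variation convergence from convergence of densities -/

section Scheffe

/-- Scheffé's lemma: laws with almost everywhere convergent densities converge in total
variation. -/
lemma exists_tvClose_of_tendsto_density {X : Type*} [MeasurableSpace X] {m : Measure X}
    {μs : ℕ → Measure X} {μ : Measure X} [∀ n, IsProbabilityMeasure (μs n)]
    [IsProbabilityMeasure μ] {fs : ℕ → X → ℝ≥0∞} {f : X → ℝ≥0∞}
    (hfs : ∀ n, AEMeasurable (fs n) m ∧ μs n = m.withDensity (fs n))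
    (hf : AEMeasurable f m ∧ μ = m.withDensity f)
    (hlim : ∀ᵐ x ∂m, Tendsto (fun n => fs n x) atTop (𝓝 (f x))) :
    ∃ τ : ℕ → ℝ, Tendsto τ atTop (𝓝 0) ∧ ∀ n, TVClose (μs n) μ (τ n) := by
  have hf1 : ∫⁻ x, f x ∂m = 1 := by
    have h : μ Set.univ = 1 := measure_univ
    rwa [hf.2, withDensity_apply _ MeasurableSet.univ, Measure.restrict_univ] at h
  have he : ∀ n, ∫⁻ x, (f x - fs n x) ∂m ≤ 1 := fun n =>
    (lintegral_mono fun x => tsub_le_self).trans hf1.le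
  -- the truncated difference `f - fs n` is dominated by `f`, unlike the absolute value
  refine ⟨fun n => (∫⁻ x, (f x - fs n x) ∂m).toReal, ?_, fun n => ?_⟩
  · rw [← ENNReal.toReal_zero]
    refine (ENNReal.tendsto_toReal ENNReal.zero_ne_top).comp ?_
    have hfin : ∀ᵐ x ∂m, f x < ∞ := ae_lt_top' hf.1 (by rw [hf1]; exact ENNReal.one_ne_top)
    have := tendsto_lintegral_of_dominated_convergence' (μ := m) (F := fun n x => f x - fs n x)
      (f := fun _ => 0) f (fun n => hf.1.sub (hfs n).1)
      (fun n => ae_of_all _ fun x => tsub_le_self) (by rw [hf1]; exact ENNReal.one_ne_top)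
      (by
        filter_upwards [hlim, hfin] with x hx hx'
        have := ENNReal.Tendsto.sub (tendsto_const_nhds (x := f x)) hx (Or.inl hx'.ne)
        rwa [tsub_self] at this)
    simpa using this
  · -- one inequality, to be applied to `φ` and to `1 - φ`
    have key : ∀ φ : X → ℝ, Measurable φ → (∀ x, φ x ∈ Set.Icc (0 : ℝ) 1) →
        ∫ x, φ x ∂μ - ∫ x, φ x ∂(μs n) ≤ (∫⁻ x, (f x - fs n x) ∂m).toReal := by
      intro φ hφ h01
      have hw : ∀ (ν : Measure X) [IsProbabilityMeasure ν],
          ENNReal.ofReal (∫ x, φ x ∂ν) = ∫⁻ x, ENNReal.ofReal (φ x) ∂ν := fun ν _ =>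
        ofReal_integral_eq_lintegral_ofReal (integrable_of_mem_Icc hφ h01)
          (ae_of_all _ fun x => (h01 x).1)
      have hd : ∀ g : X → ℝ≥0∞, AEMeasurable g m →
          ∫⁻ x, ENNReal.ofReal (φ x) ∂(m.withDensity g) =
            ∫⁻ x, g x * ENNReal.ofReal (φ x) ∂m := fun g hg =>
        lintegral_withDensity_eq_lintegral_mul₀ hg hφ.ennreal_ofReal.aemeasurable
      have h1 : ENNReal.ofReal (∫ x, φ x ∂μ) ≤
          ENNReal.ofReal (∫ x, φ x ∂(μs n)) + ∫⁻ x, (f x - fs n x) ∂m := by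
        have hfφ : AEMeasurable (fun x => fs n x * ENNReal.ofReal (φ x)) m :=
          (hfs n).1.mul hφ.ennreal_ofReal.aemeasurable
        rw [hw, hw, hf.2, (hfs n).2, hd f hf.1, hd (fs n) (hfs n).1, ← lintegral_add_left' hfφ]
        refine lintegral_mono fun x => ?_
        have hle : ENNReal.ofReal (φ x) ≤ 1 := by
          rw [← ENNReal.ofReal_one]; exact ENNReal.ofReal_le_ofReal (h01 x).2
        calc f x * ENNReal.ofReal (φ x) ≤ (fs n x + (f x - fs n x)) * ENNReal.ofReal (φ x) := by
              gcongr; exact le_add_tsub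
          _ = fs n x * ENNReal.ofReal (φ x) + (f x - fs n x) * ENNReal.ofReal (φ x) := add_mul _ _ _
          _ ≤ _ := by gcongr; exact mul_le_of_le_one_right' hle
      have hfin : ∫⁻ x, (f x - fs n x) ∂m ≠ ∞ := ne_top_of_le_ne_top ENNReal.one_ne_top (he n)
      rw [← ENNReal.ofReal_toReal hfin, ← ENNReal.ofReal_add
        (integral_nonneg fun x => (h01 x).1) ENNReal.toReal_nonneg] at h1
      have h2 := (ENNReal.ofReal_le_ofReal_iff (add_nonneg
        (integral_nonneg fun x => (h01 x).1) ENNReal.toReal_nonneg)).1 h1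
      linarith
    intro φ hφ h01
    have k1 := key φ hφ h01
    have k2 := key (fun x => 1 - φ x) (measurable_const.sub hφ)
      fun x => ⟨by linarith [(h01 x).2], by linarith [(h01 x).1]⟩
    rw [integral_sub (integrable_const _) (integrable_of_mem_Icc hφ h01),
      integral_sub (integrable_const _) (integrable_of_mem_Icc hφ h01)] at k2
    simp only [integral_const, probReal_univ, smul_eq_mul] at k2
    rw [abs_le]
    constructor <;> linarith

end Scheffe

/-! ### The limit of the optimal plans -/

section LimitPlan

variable {d : ℕ}

lemma continuous_upTos (i : Fin d) : Continuous (upTos i) := by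
  unfold upTos befores before
  fun_prop

/-- Every limit of optimal plans for the costs `c_ε` is the Knothe–Rosenblatt plan, by induction on
the coordinates. -/
theorem eq_of_tendsto_of_isOptimalPlan {μs νs : ℕ → ProbabilityMeasure (E d)}
    {μ ν : ProbabilityMeasure (E d)} (hμs : Tendsto μs atTop (𝓝 μ))
    (hνs : Tendsto νs atTop (𝓝 ν)) {τ : ℕ → ℝ} (hτ : Tendsto τ atTop (𝓝 0))
    (hτμ : ∀ n, TVClose (μs n : Measure (E d)) μ (τ n))
    (hτν : ∀ n, TVClose (νs n : Measure (E d)) ν (τ n))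
    {R : ℝ} (hμR : ∀ n, ∀ j : Fin d, ∀ᵐ x ∂(μs n : Measure (E d)), x j ∈ Set.Icc (-R) R)
    (hνR : ∀ n, ∀ j : Fin d, ∀ᵐ x ∂(νs n : Measure (E d)), x j ∈ Set.Icc (-R) R)
    {ε : ℕ → ℝ} (hε0 : ∀ n, 0 < ε n) (hε1 : ∀ n, ε n ≤ 1) (hε : Tendsto ε atTop (𝓝 0))
    {γs : ℕ → ProbabilityMeasure (E d × E d)} {γ γ' : ProbabilityMeasure (E d × E d)}
    (hopt : ∀ n, IsOptimalPlan (weightedCost (ε n)) (μs n : Measure (E d)) (νs n) (γs n))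
    (hγ : Tendsto γs atTop (𝓝 γ)) (hγ' : IsKRPlan (μ : Measure (E d)) (ν : Measure (E d)) γ')
    {T S : E d → E d} (hT : IsKRMap (μ : Measure (E d)) (ν : Measure (E d)) T)
    (hS : IsKRMap (ν : Measure (E d)) (μ : Measure (E d)) S) : γ = γ' := by
  refine ProbabilityMeasure.toMeasure_injective (eq_of_forall_map_upTos fun i hi => ?_)
  have hb := map_befores_eq_of_map_truncs i hi
  rw [(isKRPlan_iff.1 hγ').2 i, ← hb]
  -- the limit plan is a coupling of the limit marginals
  have hcoup : IsCoupling (μ : Measure (E d)) (ν : Measure (E d)) (γ : Measure (E d × E d)) := by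
    constructor
    · have h1 := ProbabilityMeasure.tendsto_map_of_tendsto_of_continuous γs γ hγ
        (f := Prod.fst) continuous_fst
      have h2 : (fun n => (γs n).map (f := Prod.fst) continuous_fst.measurable.aemeasurable) = μs :=
        funext fun n => ProbabilityMeasure.toMeasure_injective (hopt n).1.1
      rw [h2] at h1
      exact congrArg ProbabilityMeasure.toMeasure (tendsto_nhds_unique h1 hμs)
    · have h1 := ProbabilityMeasure.tendsto_map_of_tendsto_of_continuous γs γ hγ
        (f := Prod.snd) continuous_snd
      have h2 : (fun n => (γs n).map (f := Prod.snd) continuous_snd.measurable.aemeasurable) = νs :=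
        funext fun n => ProbabilityMeasure.toMeasure_injective (hopt n).1.2
      rw [h2] at h1
      exact congrArg ProbabilityMeasure.toMeasure (tendsto_nhds_unique h1 hνs)
  have hρ := ProbabilityMeasure.tendsto_map_of_tendsto_of_continuous γs γ hγ
    (f := upTos i) (continuous_upTos i)
  -- laws of the coordinates up to `i` of each of the two points
  have mu := measurable_upTos i
  have hl : ∀ {μ' ν' : Measure (E d)} {m : Measure (E d × E d)}, IsCoupling μ' ν' m →
      (m.map (upTos i)).map (fun p => (p.1.1, p.2.1)) = μ'.map (upTo i) := by
    intro μ' ν' m h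
    rw [← h.1, Measure.fst, Measure.map_map (by fun_prop) mu,
      Measure.map_map (measurable_upTo i) measurable_fst]
    rfl
  have hr : ∀ {μ' ν' : Measure (E d)} {m : Measure (E d × E d)}, IsCoupling μ' ν' m →
      (m.map (upTos i)).map (fun p => (p.1.2, p.2.2)) = ν'.map (upTo i) := by
    intro μ' ν' m h
    rw [← h.2, Measure.snd, Measure.map_map (by fun_prop) mu,
      Measure.map_map (measurable_upTo i) measurable_snd]
    rfl
  have hbl : ∀ {μ' ν' : Measure (E d)} {m : Measure (E d × E d)}, IsCoupling μ' ν' m →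
      (m.map (upTos i)).map (fun p => p.1.1) = μ'.map (before i) := by
    intro μ' ν' m h
    rw [← h.1, Measure.fst, Measure.map_map (by fun_prop) mu,
      Measure.map_map (measurable_before i) measurable_fst]
    rfl
  have hbr : ∀ {μ' ν' : Measure (E d)} {m : Measure (E d × E d)}, IsCoupling μ' ν' m →
      (m.map (upTos i)).map (fun p => p.1.2) = ν'.map (before i) := by
    intro μ' ν' m h
    rw [← h.2, Measure.snd, Measure.map_map (by fun_prop) mu,
      Measure.map_map (measurable_before i) measurable_snd]
    rfl
  have hfst : ∀ m : Measure (E d × E d), (m.map (upTos i)).map Prod.fst = m.map (befores i) :=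
    fun m => Measure.map_map measurable_fst mu
  -- the coordinates before `i` of the two points determine each other
  have hTm : Measurable fun x => (x, T x) := measurable_id.prodMk hT.measurable
  have hSm : Measurable fun y => (y, S y) := measurable_id.prodMk hS.measurable
  have := Measure.isProbabilityMeasure_map (μ := (μ : Measure (E d))) hTm.aemeasurable
  have := Measure.isProbabilityMeasure_map (μ := (ν : Measure (E d))) hSm.aemeasurable
  have := Measure.isProbabilityMeasure_map (μ := (ν : Measure (E d)).map fun y => (y, S y))
    measurable_swap.aemeasurable
  have hgT : ∀ᵐ p ∂((γ : Measure (E d × E d)).map (upTos i)), p.1.2 = mapBefore T i p.1.1 := by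
    have hs : MeasurableSet {q : (Set.Iio i → ℝ) × (Set.Iio i → ℝ) | q.2 = mapBefore T i q.1} :=
      measurableSet_eq_fun measurable_snd ((measurable_mapBefore hT.measurable i).comp
        measurable_fst)
    have h1 : ∀ᵐ q ∂((γ : Measure (E d × E d)).map (befores i)), q.2 = mapBefore T i q.1 := by
      rw [hb, hγ'.unique hT.isKRPlan, Measure.map_map (measurable_befores i) hTm]
      refine (ae_map_iff ((measurable_befores i).comp hTm).aemeasurable hs).2
        (ae_of_all _ fun x => ?_)
      exact before_apply_eq_mapBefore (fun j _ => hT.triangular j) x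
    rw [← hfst] at h1
    exact ae_of_ae_map measurable_fst.aemeasurable h1
  have hgS : ∀ᵐ p ∂((γ : Measure (E d × E d)).map (upTos i)), p.1.1 = mapBefore S i p.1.2 := by
    have hs : MeasurableSet {q : (Set.Iio i → ℝ) × (Set.Iio i → ℝ) | q.1 = mapBefore S i q.2} :=
      measurableSet_eq_fun measurable_fst ((measurable_mapBefore hS.measurable i).comp
        measurable_snd)
    have h1 : ∀ᵐ q ∂((γ : Measure (E d × E d)).map (befores i)), q.1 = mapBefore S i q.2 := by
      rw [hb, hγ'.unique hS.isKRPlan.swap, Measure.map_map measurable_swap hSm,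
        Measure.map_map (measurable_befores i) (measurable_swap.comp hSm)]
      refine (ae_map_iff ((measurable_befores i).comp (measurable_swap.comp hSm)).aemeasurable
        hs).2 (ae_of_all _ fun y => ?_)
      exact before_apply_eq_mapBefore (fun j _ => hS.triangular j) y
    rw [← hfst] at h1
    exact ae_of_ae_map measurable_fst.aemeasurable h1
  have hbox : ∀ n, InBox R (γs n : Measure (E d × E d)) := fun n =>
    (hopt n).1.inBox (hμR n) (hνR n)
  have hmain := eq_compProd_pairKernel_of_tendsto hρ
    (κs := fun n => conditional (μs n : Measure (E d)) i)
    (κ := conditional (μ : Measure (E d)) i)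
    (ηs := fun n => conditional (νs n : Measure (E d)) i)
    (η := conditional (ν : Measure (E d)) i)
    (fun n => (hl (hopt n).1).trans ((map_upTo _ i).trans (by rw [← hbl (hopt n).1]; rfl)))
    ((hl hcoup).trans ((map_upTo _ i).trans (by rw [← hbl hcoup]; rfl)))
    (fun n => (hr (hopt n).1).trans ((map_upTo _ i).trans (by rw [← hbr (hopt n).1]; rfl)))
    ((hr hcoup).trans ((map_upTo _ i).trans (by rw [← hbr hcoup]; rfl)))
    hτ
    (fun n => by
      have h1 := (hτμ n).map (measurable_upTo i)
      rw [← hl (hopt n).1, ← hl hcoup] at h1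
      exact h1)
    (fun n => by
      have h1 := (hτν n).map (measurable_upTo i)
      rw [← hr (hopt n).1, ← hr hcoup] at h1
      exact h1)
    (measurable_mapBefore hT.measurable i) hgT (measurable_mapBefore hS.measurable i) hgS
    (R₀ := R)
    (fun n => by
      refine (ae_map_iff mu.aemeasurable ((measurableSet_Icc.preimage (by fun_prop)).inter
        (measurableSet_Icc.preimage (by fun_prop)))).2 ?_
      exact (hbox n).mono fun z hz => hz i)
    (δ := fun n => ε n * (d * (2 * R) ^ 2))
    (by simpa using hε.mul_const ((d : ℝ) * (2 * R) ^ 2))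
    (fun n => by
      have h1 := (hopt n).integral_sq_le (hε0 n) (hε1 n) (hμR n) (hνR n) i
      rw [← hfst] at h1
      refine le_trans (le_of_eq ?_) h1
      exact integral_map mu.aemeasurable (by fun_prop))
  rw [← hfst]
  exact hmain

end LimitPlan

/-! ### Optimal maps induce optimal plans -/

section Monge

variable {d : ℕ}

/-- An absolutely continuous measure can be transported to any boundedly supported measure of the
same mass. -/
lemma exists_measurable_map_eq {μ ν : Measure (E d)} [IsFiniteMeasure μ]
    (huniv : μ Set.univ = ν Set.univ) (hμ : μ ≪ volume) {R : ℝ} (hR : 0 ≤ R)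
    (hν : ∀ i : Fin d, ∀ᵐ y ∂ν, y i ∈ Set.Icc (-R) R) :
    ∃ T : E d → E d, Measurable T ∧ μ.map T = ν := by
  rcases eq_or_ne (μ Set.univ) 0 with h0 | h0
  · exact ⟨id, measurable_id, by rw [Measure.measure_univ_eq_zero.1 h0, Measure.map_zero,
      Measure.measure_univ_eq_zero.1 (huniv.symm.trans h0)]⟩
  set c := μ Set.univ with hc
  have hcT : c ≠ ∞ := measure_ne_top _ _
  have p1 : IsProbabilityMeasure (c⁻¹ • μ) :=
    ⟨by rw [Measure.smul_apply, smul_eq_mul, ← hc, ENNReal.inv_mul_cancel h0 hcT]⟩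
  have p2 : IsProbabilityMeasure (c⁻¹ • ν) :=
    ⟨by rw [Measure.smul_apply, smul_eq_mul, ← huniv, ENNReal.inv_mul_cancel h0 hcT]⟩
  obtain ⟨T, hT⟩ := exists_isKRMap (μ := c⁻¹ • μ) (ν := c⁻¹ • ν) (hμ.smul_left _) hR
    fun i => Measure.ae_smul_measure (hν i) _
  refine ⟨T, hT.measurable, ?_⟩
  have h := hT.map_eq
  rw [Measure.map_smul] at h
  have h2 := congrArg (fun m => c • m) h
  simpa only [smul_smul, ENNReal.mul_inv_cancel h0 hcT, one_smul] using h2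

/-- Every plan from an absolutely continuous law can be replaced by a map, at an arbitrarily small
additional cost: the source is cut into small pieces, and each of them is transported to the part of
the target that the plan assigns to it. -/
lemma exists_map_lintegral_le {μ ν : Measure (E d)} [IsProbabilityMeasure μ] (hμ : μ ≪ volume)
    {R : ℝ} (hR : 0 ≤ R) (hμR : ∀ᵐ x ∂μ, ‖x‖ ≤ R) (hνR : ∀ᵐ y ∂ν, ‖y‖ ≤ R)
    {γ : Measure (E d × E d)} (hγ : IsCoupling μ ν γ) {c : E d → E d → ℝ≥0∞}
    (hc : Measurable fun z : E d × E d => c z.1 z.2) {δ : ℝ} (hδ : 0 < δ) {ω : ℝ≥0∞}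
    (hω : ∀ x x' y, ‖x‖ ≤ R → ‖x'‖ ≤ R → ‖y‖ ≤ R → dist x x' ≤ δ → c x y ≤ c x' y + ω) :
    ∃ T : E d → E d, Measurable T ∧ μ.map T = ν ∧
      ∫⁻ x, c x (T x) ∂μ ≤ ∫⁻ z, c z.1 z.2 ∂γ + 2 * ω := by
  obtain ⟨Q, hQ, hQb, hQd, hQu, hQdis⟩ :=
    SeparableSpace.exists_measurable_partition_diam_le (E d) hδ
  have hfst : γ.map Prod.fst = μ := hγ.1
  have hsnd : γ.map Prod.snd = ν := hγ.2
  have hγ1 : γ Set.univ = 1 := by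
    rw [← measure_univ (μ := μ), ← hfst, Measure.map_apply measurable_fst .univ, Set.preimage_univ]
  have hP : ∀ n, MeasurableSet (Prod.fst ⁻¹' Q n : Set (E d × E d)) := fun n =>
    measurable_fst (hQ n)
  have hPdis : Pairwise (Function.onFun Disjoint fun n => (Prod.fst ⁻¹' Q n : Set (E d × E d))) :=
    fun n m h => (hQdis h).preimage _
  have hPu : ⋃ n, (Prod.fst ⁻¹' Q n : Set (E d × E d)) = Set.univ := by
    rw [← Set.preimage_iUnion, hQu, Set.preimage_univ]
  have hγR : ∀ᵐ z ∂γ, ‖z.1‖ ≤ R ∧ ‖z.2‖ ≤ R :=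
    (ae_of_ae_map measurable_fst.aemeasurable (hfst.symm ▸ hμR)).and
      (ae_of_ae_map measurable_snd.aemeasurable (hsnd.symm ▸ hνR))
  -- the part of the target assigned to the piece `Q n`
  let νs : ℕ → Measure (E d) := fun n => (γ.restrict (Prod.fst ⁻¹' Q n)).map Prod.snd
  have hνs : ∀ n, ∀ᵐ y ∂(νs n), ‖y‖ ≤ R := fun n => by
    refine (ae_map_iff measurable_snd.aemeasurable
      (measurableSet_le measurable_norm measurable_const)).2 ?_
    exact ae_restrict_of_ae (hγR.mono fun z hz => hz.2)
  have hT : ∀ n, ∃ T : E d → E d, Measurable T ∧ (μ.restrict (Q n)).map T = νs n := by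
    intro n
    refine exists_measurable_map_eq ?_ (Measure.absolutelyContinuous_of_le
      Measure.restrict_le_self |>.trans hμ) hR fun i => (hνs n).mono fun y hy => ?_
    · rw [Measure.restrict_apply_univ, Measure.map_apply measurable_snd .univ, Set.preimage_univ,
        Measure.restrict_apply_univ, ← Measure.map_apply measurable_fst (hQ n), hfst]
    · exact abs_le.1 ((PiLp.norm_apply_le y i).trans hy)
  choose Tn hTm hTn using hT
  obtain ⟨T, hTmeas, hTeq⟩ := exists_measurable_piecewise Q hQ Tn hTm fun n m h x hx =>
    absurd hx.2 (Set.disjoint_left.1 (hQdis h) hx.1)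
  have hTr : ∀ n, (μ.restrict (Q n)).map T = νs n := fun n => by
    rw [← hTn n]
    exact Measure.map_congr ((ae_restrict_mem (hQ n)).mono fun x hx => hTeq n hx)
  refine ⟨T, hTmeas, ?_, ?_⟩
  · calc μ.map T = (Measure.sum fun n => μ.restrict (Q n)).map T := by
          rw [← Measure.restrict_iUnion hQdis hQ, hQu, Measure.restrict_univ]
      _ = Measure.sum fun n => νs n := by
          rw [Measure.map_sum hTmeas.aemeasurable]; simp only [hTr]
      _ = (Measure.sum fun n => γ.restrict (Prod.fst ⁻¹' Q n)).map Prod.snd :=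
          (Measure.map_sum measurable_snd.aemeasurable).symm
      _ = ν := by rw [← Measure.restrict_iUnion hPdis hP, hPu, Measure.restrict_univ, hsnd]
  -- both transports of the piece `Q n` cost about as much as if it were a single point `q`
  have hq : ∀ n, ∃ q : E d, ∀ x ∈ Q n, ‖x‖ ≤ R → dist x q ≤ δ ∧ ‖q‖ ≤ R := by
    intro n
    by_cases h : ∃ q ∈ Q n, ‖q‖ ≤ R
    · obtain ⟨q, hqQ, hqR⟩ := h
      exact ⟨q, fun x hx _ => ⟨(Metric.dist_le_diam_of_mem (hQb n) hx hqQ).trans (hQd n), hqR⟩⟩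
    · exact ⟨0, fun x hx hxR => absurd ⟨x, hx, hxR⟩ h⟩
  choose q hq using hq
  have hcω : ∀ n, Measurable fun y => c (q n) y + ω := fun n =>
    (hc.comp measurable_prodMk_left).add measurable_const
  have hpiece : ∀ n, ∫⁻ x in Q n, c x (T x) ∂μ ≤
      ∫⁻ z in Prod.fst ⁻¹' Q n, (c z.1 z.2 + 2 * ω) ∂γ := by
    intro n
    have hTR : ∀ᵐ x ∂(μ.restrict (Q n)), ‖T x‖ ≤ R :=
      ae_of_ae_map hTmeas.aemeasurable (by rw [hTr n]; exact hνs n)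
    calc ∫⁻ x in Q n, c x (T x) ∂μ ≤ ∫⁻ x in Q n, (c (q n) (T x) + ω) ∂μ := by
          refine lintegral_mono_ae ?_
          filter_upwards [hTR, ae_restrict_of_ae hμR, ae_restrict_mem (hQ n)] with x h1 h2 h3
          exact hω _ _ _ h2 (hq n x h3 h2).2 h1 (hq n x h3 h2).1
      _ = ∫⁻ y, (c (q n) y + ω) ∂(νs n) := by
          rw [← hTr n, lintegral_map (hcω n) hTmeas]
      _ = ∫⁻ z in Prod.fst ⁻¹' Q n, (c (q n) z.2 + ω) ∂γ :=
          lintegral_map (hcω n) measurable_snd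
      _ ≤ _ := by
          refine lintegral_mono_ae ?_
          filter_upwards [ae_restrict_of_ae hγR, ae_restrict_mem (hP n)] with z h1 h2
          have := hω (q n) z.1 z.2 (hq n _ h2 h1.1).2 h1.1 h1.2
            (by rw [dist_comm]; exact (hq n _ h2 h1.1).1)
          calc c (q n) z.2 + ω ≤ (c z.1 z.2 + ω) + ω := by gcongr
            _ = _ := by rw [add_assoc, two_mul]
  calc ∫⁻ x, c x (T x) ∂μ = ∑' n, ∫⁻ x in Q n, c x (T x) ∂μ := by
        rw [← lintegral_iUnion hQ hQdis, hQu, Measure.restrict_univ]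
    _ ≤ ∑' n, ∫⁻ z in Prod.fst ⁻¹' Q n, (c z.1 z.2 + 2 * ω) ∂γ := ENNReal.tsum_le_tsum hpiece
    _ = ∫⁻ z, (c z.1 z.2 + 2 * ω) ∂γ := by
        rw [← lintegral_iUnion hP hPdis, hPu, Measure.restrict_univ]
    _ = _ := by rw [lintegral_add_right _ measurable_const, lintegral_const, hγ1, mul_one]

lemma weightedCost_le_add {ε R δ : ℝ} (hε : 0 ≤ ε) {x x' y : E d} (hx : ‖x‖ ≤ R)
    (hx' : ‖x'‖ ≤ R) (hy : ‖y‖ ≤ R) (h : dist x x' ≤ δ) :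
    weightedCost ε x y ≤ weightedCost ε x' y + δ * ∑ i : Fin d, ε ^ (i : ℕ) * (4 * R) := by
  have hR : 0 ≤ R := (norm_nonneg x).trans hx
  unfold weightedCost
  rw [Finset.mul_sum, ← Finset.sum_add_distrib]
  refine Finset.sum_le_sum fun i _ => ?_
  have key : (x i - y i) ^ 2 ≤ (x' i - y i) ^ 2 + δ * (4 * R) := by
    have h1 : |x i - x' i| ≤ δ := by
      rw [dist_eq_norm] at h
      exact (PiLp.norm_apply_le (x - x') i).trans h
    have b1 := abs_le.1 ((PiLp.norm_apply_le x i).trans hx)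
    have b2 := abs_le.1 ((PiLp.norm_apply_le x' i).trans hx')
    have b3 := abs_le.1 ((PiLp.norm_apply_le y i).trans hy)
    have h2 : |x i + x' i - 2 * y i| ≤ 4 * R := abs_le.2
      ⟨by linarith [b1.1, b2.1, b3.2], by linarith [b1.2, b2.2, b3.1]⟩
    have h3 : (x i - y i) ^ 2 - (x' i - y i) ^ 2 = (x i - x' i) * (x i + x' i - 2 * y i) := by ring
    have h4 := le_abs_self ((x i - x' i) * (x i + x' i - 2 * y i))
    rw [abs_mul] at h4
    have h5 := mul_le_mul h1 h2 (abs_nonneg _) ((abs_nonneg _).trans h1)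
    linarith
  calc ε ^ (i : ℕ) * (x i - y i) ^ 2 ≤ ε ^ (i : ℕ) * ((x' i - y i) ^ 2 + δ * (4 * R)) :=
        mul_le_mul_of_nonneg_left key (pow_nonneg hε _)
    _ = _ := by ring

/-- The Monge and Kantorovich problems from an absolutely continuous law have the same value, so
that optimal maps induce optimal plans. -/
lemma IsOptimalMap.isOptimalPlan {μ ν : Measure (E d)} [IsProbabilityMeasure μ]
    (hμ : μ ≪ volume) {R : ℝ} (hR : 0 ≤ R) (hμR : ∀ᵐ x ∂μ, ‖x‖ ≤ R) (hνR : ∀ᵐ y ∂ν, ‖y‖ ≤ R)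
    {ε : ℝ} (hε : 0 ≤ ε) {T : E d → E d} (hT : IsOptimalMap (weightedCost ε) μ ν T) :
    IsOptimalPlan (weightedCost ε) μ ν (μ.map fun x => (x, T x)) := by
  have hm : Measurable fun x => (x, T x) := measurable_id.prodMk hT.1.1
  have hcm : Measurable fun z : E d × E d => ENNReal.ofReal (weightedCost ε z.1 z.2) :=
    (continuous_weightedCost ε).measurable.ennreal_ofReal
  refine ⟨⟨?_, ?_⟩, fun γ hγ => ?_⟩
  · rw [Measure.fst, Measure.map_map measurable_fst hm]
    exact Measure.map_id
  · rw [Measure.snd, Measure.map_map measurable_snd hm]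
    exact hT.1.2
  rw [lintegral_map hcm hm]
  obtain ⟨C, hC, hCle⟩ : ∃ C : ℝ, 0 ≤ C ∧ ∀ (δ : ℝ) (x x' y : E d), ‖x‖ ≤ R → ‖x'‖ ≤ R → ‖y‖ ≤ R →
      dist x x' ≤ δ → weightedCost ε x y ≤ weightedCost ε x' y + δ * C :=
    ⟨_, Finset.sum_nonneg fun i _ => by positivity,
      fun δ x x' y hx hx' hy h => weightedCost_le_add hε hx hx' hy h⟩
  refine ENNReal.le_of_forall_pos_le_add fun η hη _ => ?_
  have hη' : (0 : ℝ) < η := hη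
  have hδ : 0 < (η : ℝ) / (2 * (C + 1)) := by positivity
  obtain ⟨S, hS, hSν, hle⟩ := exists_map_lintegral_le hμ hR hμR hνR hγ hcm hδ
    (ω := ENNReal.ofReal (η / (2 * (C + 1)) * C)) fun x x' y hx hx' hy h => by
      rw [← ENNReal.ofReal_add (weightedCost_nonneg hε _ _) (by positivity)]
      exact ENNReal.ofReal_le_ofReal (hCle _ x x' y hx hx' hy h)
  refine (hT.2 S hS hSν).trans (hle.trans ?_)
  gcongr
  rw [show (2 : ℝ≥0∞) = ENNReal.ofReal 2 by simp, ← ENNReal.ofReal_mul (by norm_num),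
    ← ENNReal.ofReal_coe_nnreal]
  refine ENNReal.ofReal_le_ofReal ?_
  rw [show 2 * ((η : ℝ) / (2 * (C + 1)) * C) = η * (C / (C + 1)) by field_simp]
  exact mul_le_of_le_one_right hη'.le ((div_le_one (by positivity)).2 (by linarith))

end Monge

/-! ### Convergence of maps from convergence of their plans -/

section Maps

variable {d : ℕ}

lemma memLp_two_of_norm_le {μ : Measure (E d)} [IsProbabilityMeasure μ] {T : E d → E d}
    (hT : Measurable T) {R : ℝ} (h : ∀ᵐ x ∂μ, ‖T x‖ ≤ R) : MemLp T 2 μ :=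
  MemLp.of_bound hT.aestronglyMeasurable R h

/-- If the plans induced by uniformly bounded maps converge narrowly to a plan induced by a map,
then the maps converge in `L²`. -/
lemma tendsto_eLpNorm_of_tendsto_plan {μ : Measure (E d)} [IsProbabilityMeasure μ]
    {Ts : ℕ → E d → E d} {T : E d → E d} (hTs : ∀ n, Measurable (Ts n)) (hT : Measurable T)
    {R : ℝ} (hTsR : ∀ n, ∀ᵐ x ∂μ, ‖Ts n x‖ ≤ R) (hTR : ∀ᵐ x ∂μ, ‖T x‖ ≤ R)
    {γs : ℕ → ProbabilityMeasure (E d × E d)} {γ : ProbabilityMeasure (E d × E d)}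
    (hγs : ∀ n, (γs n : Measure (E d × E d)) = μ.map fun x => (x, Ts n x))
    (hγ : (γ : Measure (E d × E d)) = μ.map fun x => (x, T x)) (hlim : Tendsto γs atTop (𝓝 γ)) :
    Tendsto (fun n => eLpNorm (fun x => Ts n x - T x) 2 μ) atTop (𝓝 0) := by
  have hmem : MemLp T 2 μ := memLp_two_of_norm_le hT hTR
  rw [ENNReal.tendsto_nhds_zero]
  intro η hη
  rcases eq_or_ne η ∞ with rfl | hηT
  · exact Eventually.of_forall fun n => le_top
  have hη3 : η / 3 ≠ 0 := (ENNReal.div_pos hη.ne' (by norm_num)).ne'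
  have hη3T : η / 3 ≠ ∞ := (ENNReal.div_lt_top hηT (by norm_num)).ne
  obtain ⟨φ, hφ, hφm⟩ := hmem.exists_boundedContinuous_eLpNorm_sub_le ENNReal.ofNat_ne_top hη3
  -- the distance to the continuous approximation `φ` of the limit map passes to the limit
  have hsq : ∀ (S : E d → E d), Measurable S → ∀ ρ : ProbabilityMeasure (E d × E d),
      (ρ : Measure (E d × E d)) = μ.map (fun x => (x, S x)) → MemLp S 2 μ →
      eLpNorm (fun x => S x - φ x) 2 μ =
        ENNReal.ofReal ((∫ z, ‖z.2 - φ z.1‖ ^ 2 ∂(ρ : Measure (E d × E d))) ^ (2 : ℝ)⁻¹) := by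
    intro S hS ρ hρ hSm
    have hm : Measurable fun x => (x, S x) := measurable_id.prodMk hS
    rw [hρ, integral_map hm.aemeasurable (by fun_prop)]
    have h := (hSm.sub hφm).eLpNorm_eq_integral_rpow_norm (by norm_num) ENNReal.ofNat_ne_top
    simp only [Pi.sub_apply, ENNReal.toReal_ofNat, Real.rpow_ofNat] at h
    exact h
  have hint := tendsto_integral_of_ae_abs_le hlim (g := fun z => ‖z.2 - φ z.1‖ ^ 2)
    (by fun_prop) (C := (R + ‖φ‖) ^ 2) fun n => by
      have hm : Measurable fun x => (x, Ts n x) := measurable_id.prodMk (hTs n)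
      rw [hγs n]
      refine (ae_map_iff hm.aemeasurable (measurableSet_le (by fun_prop) measurable_const)).2 ?_
      filter_upwards [hTsR n] with x hx
      rw [abs_of_nonneg (sq_nonneg _)]
      have := norm_sub_le (Ts n x) (φ x)
      have := φ.norm_coe_le_norm x
      gcongr
      linarith
  have hlim2 : Tendsto (fun n => eLpNorm (fun x => Ts n x - φ x) 2 μ) atTop
      (𝓝 (eLpNorm (fun x => T x - φ x) 2 μ)) := by
    rw [hsq T hT γ hγ hmem]
    simp only [fun n => hsq (Ts n) (hTs n) (γs n) (hγs n) (memLp_two_of_norm_le (hTs n) (hTsR n))]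
    exact ENNReal.tendsto_ofReal (hint.rpow_const (Or.inr (by norm_num)))
  have hφ' : eLpNorm (fun x => T x - φ x) 2 μ ≤ η / 3 := hφ
  have hlt : eLpNorm (fun x => T x - φ x) 2 μ < η / 3 + η / 3 :=
    hφ'.trans_lt (ENNReal.lt_add_right hη3T hη3)
  filter_upwards [hlim2.eventually (gt_mem_nhds hlt)] with n hn
  calc eLpNorm (fun x => Ts n x - T x) 2 μ
      = eLpNorm ((fun x => Ts n x - φ x) - fun x => T x - φ x) 2 μ := by
        congr 1; ext1 x; simp
    _ ≤ eLpNorm (fun x => Ts n x - φ x) 2 μ + eLpNorm (fun x => T x - φ x) 2 μ :=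
        eLpNorm_sub_le (by fun_prop) (by fun_prop) (by norm_num)
    _ ≤ (η / 3 + η / 3) + η / 3 := add_le_add hn.le hφ'
    _ = η := ENNReal.add_thirds η

end Maps

/-! ### Convergence of optimal plans -/

section Convergence

variable {d : ℕ}

/-- Families of optimal plans between converging densities converge to the plan induced by the
Knothe–Rosenblatt map: they are tight, and all of their limits are equal. -/
theorem tendsto_of_isOptimalPlan
    {μs νs : ℝ → ProbabilityMeasure (E d)} {μ ν : ProbabilityMeasure (E d)}
    {fs gs : ℝ → E d → ℝ≥0∞} {f g : E d → ℝ≥0∞} {R : ℝ}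
    (hμR : ∀ ε > 0, ∀ᵐ x ∂(μs ε : Measure (E d)), ‖x‖ ≤ R)
    (hνR : ∀ ε > 0, ∀ᵐ y ∂(νs ε : Measure (E d)), ‖y‖ ≤ R)
    (hμ : Tendsto μs (𝓝[>] 0) (𝓝 μ)) (hν : Tendsto νs (𝓝[>] 0) (𝓝 ν))
    (hfs : ∀ ε > 0, AEMeasurable (fs ε) volume ∧
      (μs ε : Measure (E d)) = volume.withDensity (fs ε))
    (hgs : ∀ ε > 0, AEMeasurable (gs ε) volume ∧
      (νs ε : Measure (E d)) = volume.withDensity (gs ε))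
    (hf : AEMeasurable f volume ∧ (μ : Measure (E d)) = volume.withDensity f)
    (hg : AEMeasurable g volume ∧ (ν : Measure (E d)) = volume.withDensity g)
    (hfs_lim : ∀ᵐ x ∂(volume : Measure (E d)), Tendsto (fun ε => fs ε x) (𝓝[>] 0) (𝓝 (f x)))
    (hgs_lim : ∀ᵐ y ∂(volume : Measure (E d)), Tendsto (fun ε => gs ε y) (𝓝[>] 0) (𝓝 (g y)))
    {T S : E d → E d} (hT : IsKRMap (μ : Measure (E d)) (ν : Measure (E d)) T)
    (hS : IsKRMap (ν : Measure (E d)) (μ : Measure (E d)) S)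
    {γs : ℝ → ProbabilityMeasure (E d × E d)} {γ : ProbabilityMeasure (E d × E d)}
    (hγ : IsKRPlan (μ : Measure (E d)) (ν : Measure (E d)) γ)
    (hγs : ∀ ε > 0, IsOptimalPlan (weightedCost ε) (μs ε : Measure (E d)) (νs ε : Measure (E d))
      (γs ε : Measure (E d × E d))) :
    Tendsto γs (𝓝[>] 0) (𝓝 γ) := by
  refine tendsto_of_subseq_tendsto fun ns hns => ?_
  have hev : ∀ᶠ n in atTop, ns n ∈ Set.Ioc (0 : ℝ) 1 :=
    hns.eventually (Ioc_mem_nhdsGT one_pos)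
  obtain ⟨N, hN⟩ := eventually_atTop.1 hev
  have hpos : ∀ n, 0 < ns (n + N) := fun n => (hN _ (Nat.le_add_left N n)).1
  -- the plans are supported in a common compact set
  have htight : IsTightMeasureSet {((ρ : ProbabilityMeasure (E d × E d)) :
      Measure (E d × E d)) | ρ ∈ Set.range fun n => γs (ns (n + N))} := by
    refine isTightMeasureSet_iff_exists_isCompact_measure_compl_le.2 fun η _ =>
      ⟨Metric.closedBall 0 R ×ˢ Metric.closedBall 0 R,
        (isCompact_closedBall _ _).prod (isCompact_closedBall _ _), ?_⟩
    rintro _ ⟨_, ⟨n, rfl⟩, rfl⟩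
    have hc := (hγs _ (hpos n)).1
    have h1 := hμR _ (hpos n)
    have h2 := hνR _ (hpos n)
    rw [← hc.1] at h1
    rw [← hc.2] at h2
    have h3 : ∀ᵐ z ∂(γs (ns (n + N)) : Measure (E d × E d)),
        z ∈ Metric.closedBall (0 : E d) R ×ˢ Metric.closedBall (0 : E d) R := by
      filter_upwards [ae_of_ae_map measurable_fst.aemeasurable h1,
        ae_of_ae_map measurable_snd.aemeasurable h2] with z hz1 hz2
      exact ⟨mem_closedBall_zero_iff.2 hz1, mem_closedBall_zero_iff.2 hz2⟩
    exact (mem_ae_iff.1 h3).le.trans zero_le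
  obtain ⟨γ', -, φ, hφ, hlim⟩ := (isCompact_closure_of_isTightMeasureSet htight).tendsto_subseq
    fun n => subset_closure (Set.mem_range_self n)
  have hu : Tendsto (fun n => ns (φ n + N)) atTop (𝓝[>] 0) :=
    hns.comp ((tendsto_add_atTop_nat N).comp hφ.tendsto_atTop)
  obtain ⟨τ, hτ, hτμ⟩ := exists_tvClose_of_tendsto_density
    (fun n => hfs (ns (φ n + N)) (hpos _)) hf (hfs_lim.mono fun x hx => hx.comp hu)
  obtain ⟨τ', hτ', hτν⟩ := exists_tvClose_of_tendsto_density
    (fun n => hgs (ns (φ n + N)) (hpos _)) hg (hgs_lim.mono fun x hx => hx.comp hu)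
  have heq : γ' = γ := eq_of_tendsto_of_isOptimalPlan (hμ.comp hu) (hν.comp hu)
    (τ := fun n => max (τ n) (τ' n)) (by simpa using hτ.max hτ')
    (fun n ψ h1 h2 => (hτμ n ψ h1 h2).trans (le_max_left _ _))
    (fun n ψ h1 h2 => (hτν n ψ h1 h2).trans (le_max_right _ _)) (R := R)
    (fun n j => (hμR _ (hpos _)).mono fun x hx => abs_le.1 ((PiLp.norm_apply_le x j).trans hx))
    (fun n j => (hνR _ (hpos _)).mono fun x hx => abs_le.1 ((PiLp.norm_apply_le x j).trans hx))
    (fun n => hpos (φ n)) (fun n => (hN _ (Nat.le_add_left N _)).2)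
    (tendsto_nhds_of_tendsto_nhdsWithin hu) (fun n => hγs _ (hpos _)) hlim hγ hT hS
  exact ⟨fun n => φ n + N, heq ▸ hlim⟩

lemma exists_norm_le_of_isCompact {K : Set (E d)} (hK : IsCompact K)
    {ρs : ℝ → ProbabilityMeasure (E d)} (h : ∀ ε > 0, (ρs ε : Measure (E d)) Kᶜ = 0) :
    ∃ R : ℝ, ∀ ε > 0, ∀ᵐ x ∂(ρs ε : Measure (E d)), ‖x‖ ≤ R := by
  obtain ⟨R, hR⟩ := hK.isBounded.exists_norm_le
  refine ⟨R, fun ε hε => ?_⟩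
  have h1 : ∀ᵐ x ∂(ρs ε : Measure (E d)), x ∈ K := h ε hε
  exact h1.mono hR

lemma norm_le_of_tendsto {ρs : ℝ → ProbabilityMeasure (E d)} {ρ : ProbabilityMeasure (E d)}
    (hρ : Tendsto ρs (𝓝[>] 0) (𝓝 ρ)) {R : ℝ}
    (h : ∀ ε > 0, ∀ᵐ x ∂(ρs ε : Measure (E d)), ‖x‖ ≤ R) :
    ∀ᵐ x ∂(ρ : Measure (E d)), ‖x‖ ≤ R := by
  obtain ⟨u, -, hu0, hu⟩ := exists_seq_strictAnti_tendsto (0 : ℝ)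
  have hu' : Tendsto u atTop (𝓝[>] 0) :=
    tendsto_nhdsWithin_iff.2 ⟨hu, Eventually.of_forall hu0⟩
  exact ae_mem_of_tendsto (hρ.comp hu') (isClosed_le continuous_norm continuous_const)
    fun n => h _ (hu0 n)

end Convergence

end KR

theorem mainTheorem4 {d : ℕ}
    (μs νs : ℝ → ProbabilityMeasure (KR.E d)) (μ ν : ProbabilityMeasure (KR.E d))
    (fs gs : ℝ → KR.E d → ℝ≥0∞) (f g : KR.E d → ℝ≥0∞)
    (γs : ℝ → ProbabilityMeasure (KR.E d × KR.E d))
    -- uniformly compact supports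
    (hμK : ∃ K : Set (KR.E d), IsCompact K ∧ ∀ ε > 0, (μs ε : Measure (KR.E d)) Kᶜ = 0)
    (hνK : ∃ K : Set (KR.E d), IsCompact K ∧ ∀ ε > 0, (νs ε : Measure (KR.E d)) Kᶜ = 0)
    -- narrow convergence
    (hμ : Tendsto μs (𝓝[>] 0) (𝓝 μ)) (hν : Tendsto νs (𝓝[>] 0) (𝓝 ν))
    -- densities with respect to the Lebesgue measure
    (hfs : ∀ ε > 0, AEMeasurable (fs ε) volume ∧
      (μs ε : Measure (KR.E d)) = volume.withDensity (fs ε))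
    (hgs : ∀ ε > 0, AEMeasurable (gs ε) volume ∧
      (νs ε : Measure (KR.E d)) = volume.withDensity (gs ε))
    (hf : AEMeasurable f volume ∧ (μ : Measure (KR.E d)) = volume.withDensity f)
    (hg : AEMeasurable g volume ∧ (ν : Measure (KR.E d)) = volume.withDensity g)
    -- almost everywhere convergence of the densities
    (hfs_lim : ∀ᵐ x ∂(volume : Measure (KR.E d)),
      Tendsto (fun ε => fs ε x) (𝓝[>] 0) (𝓝 (f x)))
    (hgs_lim : ∀ᵐ y ∂(volume : Measure (KR.E d)),
      Tendsto (fun ε => gs ε y) (𝓝[>] 0) (𝓝 (g y)))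
    -- optimal plans
    (hγ : ∀ ε > 0, KR.IsOptimalPlan (KR.weightedCost ε)
      (μs ε : Measure (KR.E d)) (νs ε : Measure (KR.E d))
      (γs ε : Measure (KR.E d × KR.E d))) :
    ∃ γKR : ProbabilityMeasure (KR.E d × KR.E d),
      -- `γKR` is the unique Knothe-Rosenblatt plan from `μ` to `ν`
      KR.IsKRPlan (μ : Measure (KR.E d)) (ν : Measure (KR.E d))
        (γKR : Measure (KR.E d × KR.E d)) ∧
      (∀ γ' : ProbabilityMeasure (KR.E d × KR.E d),
        KR.IsKRPlan (μ : Measure (KR.E d)) (ν : Measure (KR.E d))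
          (γ' : Measure (KR.E d × KR.E d)) → γ' = γKR) ∧
      Tendsto γs (𝓝[>] 0) (𝓝 γKR) ∧
      ∃ T : KR.E d → KR.E d,
        -- `T` is the Knothe-Rosenblatt map from `μ` to `ν`, unique `μ`-a.e., and induces `γKR`
        KR.IsKRMap (μ : Measure (KR.E d)) (ν : Measure (KR.E d)) T ∧
        (∀ T' : KR.E d → KR.E d,
          KR.IsKRMap (μ : Measure (KR.E d)) (ν : Measure (KR.E d)) T' →
            T' =ᵐ[(μ : Measure (KR.E d))] T) ∧
        (γKR : Measure (KR.E d × KR.E d)) = (μ : Measure (KR.E d)).map (fun x => (x, T x)) ∧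
        -- convergence of the optimal maps in `L²(μ)` if the source is fixed
        ((∀ ε > 0, μs ε = μ) → ∀ Ts : ℝ → KR.E d → KR.E d,
          (∀ ε > 0, KR.IsOptimalMap (KR.weightedCost ε)
            (μ : Measure (KR.E d)) (νs ε : Measure (KR.E d)) (Ts ε)) →
          MemLp T 2 (μ : Measure (KR.E d)) ∧
          (∀ ε > 0, MemLp (Ts ε) 2 (μ : Measure (KR.E d))) ∧
          Tendsto (fun ε => eLpNorm (fun x => Ts ε x - T x) 2 (μ : Measure (KR.E d)))
            (𝓝[>] 0) (𝓝 0)) := by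
  obtain ⟨K, hK, hμK⟩ := hμK
  obtain ⟨L, hL, hνL⟩ := hνK
  obtain ⟨R₁, hR₁⟩ := KR.exists_norm_le_of_isCompact hK hμK
  obtain ⟨R₂, hR₂⟩ := KR.exists_norm_le_of_isCompact hL hνL
  -- a common bound of all supports
  obtain ⟨R, hR, hμR, hνR⟩ : ∃ R : ℝ, 0 ≤ R ∧
      (∀ ε > 0, ∀ᵐ x ∂(μs ε : Measure (KR.E d)), ‖x‖ ≤ R) ∧
      ∀ ε > 0, ∀ᵐ y ∂(νs ε : Measure (KR.E d)), ‖y‖ ≤ R :=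
    ⟨max 0 (max R₁ R₂), le_max_left _ _,
      fun ε hε => (hR₁ ε hε).mono fun x hx => hx.trans ((le_max_left _ _).trans (le_max_right _ _)),
      fun ε hε => (hR₂ ε hε).mono fun y hy =>
        hy.trans ((le_max_right _ _).trans (le_max_right _ _))⟩
  have hμR' := KR.norm_le_of_tendsto hμ hμR
  have hνR' := KR.norm_le_of_tendsto hν hνR
  have hμac : (μ : Measure (KR.E d)) ≪ volume := by
    rw [hf.2]; exact withDensity_absolutelyContinuous _ _
  have hνac : (ν : Measure (KR.E d)) ≪ volume := by
    rw [hg.2]; exact withDensity_absolutelyContinuous _ _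
  obtain ⟨T, hT⟩ := KR.exists_isKRMap hμac hR fun i =>
    hνR'.mono fun y hy => abs_le.1 ((PiLp.norm_apply_le y i).trans hy)
  obtain ⟨S, hS⟩ := KR.exists_isKRMap hνac hR fun i =>
    hμR'.mono fun x hx => abs_le.1 ((PiLp.norm_apply_le x i).trans hx)
  have hTm : Measurable fun x => (x, T x) := measurable_id.prodMk hT.measurable
  have hprob := Measure.isProbabilityMeasure_map (μ := (μ : Measure (KR.E d))) hTm.aemeasurable
  let γKR : ProbabilityMeasure (KR.E d × KR.E d) := ⟨(μ : Measure (KR.E d)).map _, hprob⟩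
  have hKR : KR.IsKRPlan (μ : Measure (KR.E d)) (ν : Measure (KR.E d))
      (γKR : Measure (KR.E d × KR.E d)) := hT.isKRPlan
  refine ⟨γKR, hKR, fun γ' h' => ProbabilityMeasure.toMeasure_injective (h'.unique hKR),
    KR.tendsto_of_isOptimalPlan hμR hνR hμ hν hfs hgs hf hg hfs_lim hgs_lim hT hS hKR hγ,
    T, hT, fun T' h' => hT.ae_eq h', rfl, fun hfix Ts hTs => ?_⟩
  have hTR : ∀ᵐ x ∂(μ : Measure (KR.E d)), ‖T x‖ ≤ R :=
    ae_of_ae_map hT.measurable.aemeasurable (by rw [hT.map_eq]; exact hνR')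
  have hTsR : ∀ ε > 0, ∀ᵐ x ∂(μ : Measure (KR.E d)), ‖Ts ε x‖ ≤ R := fun ε hε =>
    ae_of_ae_map (hTs ε hε).1.1.aemeasurable (by rw [(hTs ε hε).1.2]; exact hνR ε hε)
  refine ⟨KR.memLp_two_of_norm_le hT.measurable hTR,
    fun ε hε => KR.memLp_two_of_norm_le (hTs ε hε).1.1 (hTsR ε hε), ?_⟩
  -- the optimal maps induce optimal plans, to which the convergence of plans applies
  have hplan : ∀ ε : ℝ, ∃ ρ : ProbabilityMeasure (KR.E d × KR.E d), 0 < ε →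
      (ρ : Measure (KR.E d × KR.E d)) = (μ : Measure (KR.E d)).map fun x => (x, Ts ε x) := by
    intro ε
    by_cases hε : 0 < ε
    · have hm : Measurable fun x => (x, Ts ε x) := measurable_id.prodMk (hTs ε hε).1.1
      exact ⟨⟨_, Measure.isProbabilityMeasure_map hm.aemeasurable⟩, fun _ => rfl⟩
    · exact ⟨γKR, fun h => absurd h hε⟩
  choose ρ hρ using hplan
  have hlim : Tendsto ρ (𝓝[>] 0) (𝓝 γKR) :=
    KR.tendsto_of_isOptimalPlan hμR hνR hμ hν hfs hgs hf hg hfs_lim hgs_lim hT hS hKR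
      fun ε hε => by
        rw [hρ ε hε, hfix ε hε]
        exact (hTs ε hε).isOptimalPlan hμac hR hμR' (hνR ε hε) hε.le
  refine tendsto_of_subseq_tendsto fun ns hns => ?_
  obtain ⟨N, hN⟩ := eventually_atTop.1 (hns.eventually self_mem_nhdsWithin)
  have hpos : ∀ n, 0 < ns (n + N) := fun n => hN _ (Nat.le_add_left N n)
  exact ⟨fun n => n + N, KR.tendsto_eLpNorm_of_tendsto_plan (fun n => (hTs _ (hpos n)).1.1)
    hT.measurable (fun n => hTsR _ (hpos n)) hTR (fun n => hρ _ (hpos n)) rfl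
    (hlim.comp (hns.comp (tendsto_add_atTop_nat N)))⟩
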